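/- Let $\langle x\rangle=(1+x^2)^{1/2}$, let $a,\alpha,\beta\ge 0$ satisfy $\alpha\le\beta$ and $a\alpha\le\beta$, and set $\gamma=0$ if $a\ge 1$ and $\gamma=(1-a)\alpha$ if $a<1$. Consider the Cauchy problem $$\partial_t^2u=\partial_x\big(u^{2a}\,\partial_xu\big)+F(u)\,\partial_xu\ \text{ in }(0,T]\times\mathbb R,\qquad u(0,x)=u_0(x),\quad \partial_tu(0,x)=u_1(x).$$ Let $u_0\in C^2(\mathbb R)$ and let $u_1\in C^1(\mathbb R)$ be bounded with bounded derivative. Assume that, for positive constants $c_1,c_2,c_3,c_4$, for all $x\in\mathbb R$ and for both choices of the sign, $$c_1\langle x\rangle^{-\alpha}\le u_0(x)\le c_2,\qquad |u_1(x)\pm u_0(x)^au_0'(x)|\le c_3\langle x\rangle^{-\beta},\qquad \Big|\frac{d}{dx}\big(u_1(x)\pm u_0(x)^au_0'(x)\big)\Big|\le c_4\langle x\rangle^{-\gamma}.$$ Let $F\in C([0,\infty))\cap C^1((0,\infty))$ and assume that for every $K>0$ there is a constant $C_K>0$ with $|F(\theta)|\le C_K\theta^a$ and $|F'(\theta)|\le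 C_K\theta^{a-1}$ for all $\theta\in(0,K]$. Then there are $T>0$ and positive constants $C_1,C_2,C_3,C_4$, all depending only on $a,\alpha,\beta,c_1,c_2,c_3,c_4$ and the constants $C_K$, such that the Cauchy problem has a positive classical solution $u\in C^2([0,T]\times\mathbb R)$ satisfying, for all $(t,x)\in[0,T]\times\mathbb R$ and both choices of the sign, $$C_1\langle x\rangle^{-\alpha}\le u(t,x)\le C_2,\qquad |(u_t\pm u^au_x)(t,x)|\le C_3\langle x\rangle^{-\beta},$$ $$\big|\partial_t\big(u_t\pm u^au_x\big)(t,x)\big|+\big|\partial_x\big(u_t\pm u^au_x\big)(t,x)\big|\le C_4\langle x\rangle^{-\gamma},$$ and $u$ is the only positive solution of the Cauchy problem in $C^2([0,T]\times\mathbb R)$. -/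

import Mathlib

open Set

noncomputable section

namespace DegenerateWave

/-- The bracket `⟨x⟩ = (1 + x ^ 2) ^ (1 / 2)`. -/
def bracket (x : ℝ) : ℝ := Real.sqrt (1 + x ^ 2)

/-- The exponent `γ(a, α)`: `0` if `a ≥ 1`, and `(1 - a) α` otherwise. -/
def gammaExp (a α : ℝ) : ℝ := if 1 ≤ a then 0 else (1 - a) * α

/-- `C¹_b(ℝ)`: continuously differentiable functions, bounded together with their derivative. -/
def IsC1b (f : ℝ → ℝ) : Prop :=
  ContDiff ℝ 1 f ∧ (∃ M, ∀ x, |f x| ≤ M) ∧ ∃ M, ∀ x, |deriv f x| ≤ M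

/-- The time derivative of `u` on the slab `[0, T] × ℝ` (one-sided at `t = 0` and `t = T`). -/
def dt (T : ℝ) (u : ℝ → ℝ → ℝ) (t x : ℝ) : ℝ := derivWithin (fun s => u s x) (Icc 0 T) t

/-- The space derivative of `u`. -/
def dx (u : ℝ → ℝ → ℝ) (t x : ℝ) : ℝ := deriv (fun y => u t y) x

/-- The function `u₁ + σ u₀ ^ a u₀'` (with `σ = ± 1`): the initial Riemann invariants. -/
def riemannData (a σ : ℝ) (u₀ u₁ : ℝ → ℝ) (x : ℝ) : ℝ := u₁ x + σ * (u₀ x ^ a * deriv u₀ x)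

/-- The function `u_t + σ u ^ a u_x` (with `σ = ± 1`): the Riemann invariants of `u`. -/
def riemannInv (a σ T : ℝ) (u : ℝ → ℝ → ℝ) (t x : ℝ) : ℝ :=
  dt T u t x + σ * (u t x ^ a * dx u t x)

/-- The assumptions on the initial data, with their constants. -/
structure AdmissibleData (a α β c₁ c₂ c₃ c₄ : ℝ) (u₀ u₁ : ℝ → ℝ) : Prop where
  contDiff_u₀ : ContDiff ℝ 2 u₀
  isC1b_u₁ : IsC1b u₁
  lower : ∀ x, c₁ * bracket x ^ (-α) ≤ u₀ x
  upper : ∀ x, u₀ x ≤ c₂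
  riemann : ∀ σ : ℝ, σ = 1 ∨ σ = -1 → ∀ x,
    |riemannData a σ u₀ u₁ x| ≤ c₃ * bracket x ^ (-β)
  deriv_riemann : ∀ σ : ℝ, σ = 1 ∨ σ = -1 → ∀ x,
    |deriv (riemannData a σ u₀ u₁) x| ≤ c₄ * bracket x ^ (-gammaExp a α)

/-- The assumptions on `F ∈ C([0, ∞)) ∩ C¹((0, ∞))`: Levi type conditions, with a constant `CF K`
on each interval `(0, K]`. Only the values of `F` on `[0, ∞)` matter. -/
structure LeviCondition (a : ℝ) (CF : ℝ → ℝ) (F : ℝ → ℝ) : Prop where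
  continuousOn : ContinuousOn F (Ici 0)
  contDiffOn : ContDiffOn ℝ 1 F (Ioi 0)
  bound : ∀ K, 0 < K → ∀ θ ∈ Ioc 0 K, |F θ| ≤ CF K * θ ^ a
  bound_deriv : ∀ K, 0 < K → ∀ θ ∈ Ioc 0 K, |deriv F θ| ≤ CF K * θ ^ (a - 1)

/-- `u` is a positive classical solution, of class `C²([0, T] × ℝ)`, of
`u_tt = ∂_x (u ^ (2 a) u_x) + F(u) u_x` on `(0, T] × ℝ` with `u(0, ·) = u₀`, `u_t(0, ·) = u₁`. -/
structure IsPositiveClassicalSolution (a : ℝ) (F u₀ u₁ : ℝ → ℝ) (T : ℝ) (u : ℝ → ℝ → ℝ) :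
    Prop where
  contDiffOn : ContDiffOn ℝ 2 (fun p : ℝ × ℝ => u p.1 p.2) (Icc 0 T ×ˢ univ)
  pos : ∀ t ∈ Icc 0 T, ∀ x, 0 < u t x
  equation : ∀ t ∈ Ioc 0 T, ∀ x,
    dt T (dt T u) t x =
      dx (fun s y => u s y ^ (2 * a) * dx u s y) t x + F (u t x) * dx u t x
  initial : ∀ x, u 0 x = u₀ x
  initial_deriv : ∀ x, dt T u 0 x = u₁ x

/-- The weighted bounds for `u`, for `u_t ± u ^ a u_x` and for their first derivatives. -/
structure WeightedBounds (a α β C₁ C₂ C₃ C₄ T : ℝ) (u : ℝ → ℝ → ℝ) : Prop where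
  lower : ∀ t ∈ Icc 0 T, ∀ x, C₁ * bracket x ^ (-α) ≤ u t x
  upper : ∀ t ∈ Icc 0 T, ∀ x, u t x ≤ C₂
  riemann : ∀ σ : ℝ, σ = 1 ∨ σ = -1 → ∀ t ∈ Icc 0 T, ∀ x,
    |riemannInv a σ T u t x| ≤ C₃ * bracket x ^ (-β)
  deriv_riemann : ∀ σ : ℝ, σ = 1 ∨ σ = -1 → ∀ t ∈ Icc 0 T, ∀ x,
    |dt T (riemannInv a σ T u) t x| + |dx (riemannInv a σ T u) t x| ≤
      C₄ * bracket x ^ (-gammaExp a α)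

end DegenerateWave

end

/-! The degeneracy disappears in logarithmic variables and travel time. Let R = u_t + u^a u_x and S
= u_t - u^a u_x; R travels with speed -u^a, S with speed u^a. For w = log u, ρ = R/u, σ = S/u the
equations become a system quadratic in (ρ, σ) whose only other coefficient is f(w) = F(u)/(2u^a).
The hypotheses say that this system has uniformly bounded data: α ≤ β bounds ρ and σ; γ compensates
the factor u₀^(a-1) that appears when the initial Riemann invariants are differentiated in the
travel time y, where dx = u₀^a dy; the Levi conditions bound f and f' as long as w is bounded above
(`AdmissibleData.exists_charData`). No lower bound on w is needed, so the time of existence depends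
on the constants only.

The unknown speeds are removed by taking characteristics as coordinate lines: t = τ(ξ, η), x = X(ξ,
η), with ξ = η as initial line. The unknowns w, ρ, τ, X, q = τ_η are integrated in ξ, and σ, p = τ_ξ
in η. A contraction solves this semilinear problem in a strip |ξ - η| < δ; transversal derivatives
exist because they solve the linearized equation (`exists_characteristic_solution`). The identities
w_η = qρ, τ_η = q, X_η = e^(aw) q are not imposed: they hold on the diagonal and propagate by
equality of cross derivatives (`exists_isCharSolution`). Because p < 0 < q, the map (τ, X) is
injective and covers a slab around t = 0 (`IsCharSolution.exists_inverse`). Going back gives R, S of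
class C¹, and u is C² since its gradient is a smooth function of u, R, S
(`IsCharSolution.exists_isSlabSolution`).

For the weighted bounds, the domain of dependence of a point has bounded width in x, and u varies on
it by a bounded factor. Weights at the initial points are therefore comparable to the weight at the
point itself, and Gronwall arguments in ξ and η carry the data bounds over
(`IsCharSolution.weighted_le`). Passing to x-derivatives costs u^(-a); for the lower order terms
this is paid by aα ≤ β.

For uniqueness, the difference of two solutions of the diagonal system for (u, R, S) satisfies
transport inequalities, and a maximum principle on backward cones makes it vanish
(`eq_zero_of_transport`). The cones use only the speeds of the constructed, bounded solution, so the
competitor need not be bounded. -/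

namespace DegenerateWave
open Filter Topology MeasureTheory
open scoped BoundedContinuousFunction NNReal

/-! ### Truncated integration along characteristic rays -/

section RayIntegral

/-- Truncation of a real number to `[-δ, δ]`. -/
def clip (δ s : ℝ) : ℝ := max (-δ) (min δ s)

theorem continuous_clip (δ : ℝ) : Continuous (clip δ) := by
  unfold clip; fun_prop

theorem abs_clip_le {δ : ℝ} (hδ : 0 ≤ δ) (s : ℝ) : |clip δ s| ≤ δ := by
  unfold clip
  rw [abs_le]
  exact ⟨le_max_left _ _, max_le (by linarith) (min_le_left _ _)⟩

theorem clip_of_abs_le {δ s : ℝ} (h : |s| ≤ δ) : clip δ s = s := by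
  rw [abs_le] at h
  unfold clip
  rw [min_eq_right h.2, max_eq_right h.1]

variable {E : Type*} [NormedAddCommGroup E] [NormedSpace ℝ E]

/-- The integral of `g` in the first variable, from the diagonal to the point `P`, truncated to
a ray of length `δ`. -/
noncomputable def rayIntegral (δ : ℝ) (g : ℝ × ℝ → E) (P : ℝ × ℝ) : E :=
  ∫ s in (0 : ℝ)..(clip δ (P.1 - P.2)), g (P.2 + s, P.2)

theorem continuous_rayIntegral (δ : ℝ) {g : ℝ × ℝ → E} (hg : Continuous g) :
    Continuous (rayIntegral δ g) := by
  unfold rayIntegral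
  refine intervalIntegral.continuous_parametric_intervalIntegral_of_continuous
    (f := fun (P : ℝ × ℝ) s => g (P.2 + s, P.2)) ?_ ?_
  · unfold Function.uncurry; fun_prop
  · exact (continuous_clip δ).comp (by fun_prop)

theorem norm_rayIntegral_le {δ : ℝ} (hδ : 0 ≤ δ) {g : ℝ × ℝ → E} {M : ℝ}
    (hM : ∀ P, ‖g P‖ ≤ M) (P : ℝ × ℝ) : ‖rayIntegral δ g P‖ ≤ δ * M := by
  have hM0 : 0 ≤ M := (norm_nonneg _).trans (hM P)
  calc ‖rayIntegral δ g P‖ ≤ M * |clip δ (P.1 - P.2) - 0| :=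
        intervalIntegral.norm_integral_le_of_norm_le_const fun s _ => hM _
    _ ≤ M * δ := by rw [sub_zero]; gcongr; exact abs_clip_le hδ _
    _ = δ * M := mul_comm _ _

theorem norm_rayIntegral_sub_le {δ : ℝ} (hδ : 0 ≤ δ) {g h : ℝ × ℝ → E} (hg : Continuous g)
    (hh : Continuous h) {M : ℝ} (hM : ∀ P, ‖g P - h P‖ ≤ M) (P : ℝ × ℝ) :
    ‖rayIntegral δ g P - rayIntegral δ h P‖ ≤ δ * M := by
  have : rayIntegral δ g P - rayIntegral δ h P = rayIntegral δ (fun P => g P - h P) P := by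
    unfold rayIntegral
    rw [intervalIntegral.integral_sub] <;>
    exact Continuous.intervalIntegrable (by fun_prop) _ _
  rw [this]
  exact norm_rayIntegral_le hδ hM P

theorem rayIntegral_diag {δ : ℝ} (hδ : 0 ≤ δ) (g : ℝ × ℝ → E) (y : ℝ) :
    rayIntegral δ g (y, y) = 0 := by
  simp [rayIntegral, clip, hδ]

/-- Inside the strip the truncation is inactive, so this is the fundamental theorem of calculus; the
truncation only serves to have bounded operators on the whole plane. -/
theorem hasDerivAt_rayIntegral [CompleteSpace E] {δ : ℝ} {g : ℝ × ℝ → E} (hg : Continuous g)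
    {P : ℝ × ℝ} (hP : |P.1 - P.2| < δ) :
    HasDerivAt (fun s => rayIntegral δ g (s, P.2)) (g P) P.1 := by
  have h1 : HasDerivAt (fun r => ∫ s in (0 : ℝ)..r, g (P.2 + s, P.2)) (g (P.2 + (P.1 - P.2), P.2))
      (P.1 - P.2) :=
    intervalIntegral.integral_hasDerivAt_right (Continuous.intervalIntegrable (by fun_prop) _ _)
      (Continuous.stronglyMeasurableAtFilter (by fun_prop) _ _)
      (Continuous.continuousAt (by fun_prop))
  have h2 := h1.comp_sub_const P.1 P.2
  rw [add_sub_cancel] at h2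
  refine h2.congr_of_eventuallyEq ?_
  have : ∀ᶠ s in 𝓝 P.1, |s - P.2| < δ :=
    (Continuous.abs (by fun_prop)).continuousAt.eventually_lt continuousAt_const hP
  filter_upwards [this] with s hs
  simp [rayIntegral, clip_of_abs_le hs.le]

end RayIntegral

/-! ### Differentiation of an ODE solution in its starting point -/

section Parameter

variable {E : Type*} [NormedAddCommGroup E] [NormedSpace ℝ E]

/-- Differentiability with respect to the initial point, in the strip `|s - η| < δ`, of a family
`y s η` of solutions of `∂ₛ y = g s (η, y)` with `y η η = 0`. -/
theorem hasDerivAt_of_linearized {δ M : ℝ}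
    {g : ℝ → ℝ × E → E} {g' : ℝ → ℝ × E → (ℝ × E →L[ℝ] E)} {y : ℝ → ℝ → E}
    (hy : Continuous (fun P : ℝ × ℝ => y P.1 P.2))
    (hgd : ∀ s η z, |s - η| < δ → HasFDerivAt (g s) (g' s (η, z)) (η, z))
    (hg : Continuous (fun P : ℝ × (ℝ × E) => g P.1 P.2))
    (hg' : Continuous (fun P : ℝ × (ℝ × E) => g' P.1 P.2))
    (hyd : ∀ s η, |s - η| < δ → HasDerivAt (fun r => y r η) (g s (η, y s η)) s)
    (hy0 : ∀ η, y η η = 0) {ξ₀ η₀ : ℝ} (hP : |ξ₀ - η₀| < δ) {V : ℝ → E} (hV : Continuous V)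
    (hM : ∀ s, |s - η₀| < δ → ∀ k, ‖g' s (η₀, y s η₀) (0, k)‖ ≤ M * ‖k‖) (hM0 : 0 ≤ M)
    (hδM : δ * M ≤ 1 / 2)
    (hVd : ∀ s, |s - η₀| < δ → HasDerivAt V (g' s (η₀, y s η₀) (1, V s)) s)
    (hV0 : V η₀ = - g η₀ (η₀, 0)) :
    HasDerivAt (fun η => y ξ₀ η) (V ξ₀) η₀ := by
  have hδ : 0 < δ := (abs_nonneg _).trans_lt hP
  set J : Set ℝ := uIcc η₀ ξ₀ with hJ
  have hJc : IsCompact J := isCompact_uIcc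
  have hJd : ∀ s ∈ J, |s - η₀| ≤ |ξ₀ - η₀| := fun s hs => abs_sub_left_of_mem_uIcc hs
  obtain ⟨Vm, hVm⟩ : ∃ Vm, ∀ s ∈ J, ‖V s‖ ≤ Vm := hJc.exists_bound_of_continuousOn hV.continuousOn
  have hVm0 : 0 ≤ Vm := (norm_nonneg _).trans (hVm η₀ left_mem_uIcc)
  rw [hasDerivAt_iff_isLittleO, Asymptotics.isLittleO_iff]
  intro c hc
  -- the accuracy used in the linearization
  set ε : ℝ := min (1 / (4 * δ)) (c / (8 * (1 + δ * (1 + Vm)))) with hε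
  have hD : 0 < 1 + δ * (1 + Vm) := by positivity
  have hε0 : 0 < ε := by positivity
  have hεδ : ε * δ ≤ 1 / 4 := by
    calc ε * δ ≤ 1 / (4 * δ) * δ := by gcongr; exact min_le_left _ _
      _ = 1 / 4 := by field_simp
  have hεc : ε * (1 + δ * (1 + Vm)) ≤ c / 8 := by
    calc ε * (1 + δ * (1 + Vm)) ≤ c / (8 * (1 + δ * (1 + Vm))) * (1 + δ * (1 + Vm)) := by
          gcongr; exact min_le_right _ _
      _ = c / 8 := by field_simp
  -- uniform continuity of the derivative along the reference solution
  have hcurve : Continuous (fun s : ℝ => (s, (η₀, y s η₀))) := by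
    have := hy.comp (Continuous.prodMk_left η₀ : Continuous fun s : ℝ => (s, η₀))
    exact continuous_id.prodMk (continuous_const.prodMk this)
  have hK : IsCompact ((fun s : ℝ => (s, (η₀, y s η₀))) '' J) := hJc.image hcurve
  have h1 := hK.uniformContinuousAt_of_continuousAt _
    (fun _ _ => hg'.continuousAt) (Metric.dist_mem_uniformity hε0)
  obtain ⟨r₁, hr₁, h1⟩ := Metric.mem_uniformity_dist.1 h1
  have hyK : IsCompact ((fun s : ℝ => (s, η₀)) '' J) := hJc.image (by fun_prop)
  have h2 := hyK.uniformContinuousAt_of_continuousAt (fun P : ℝ × ℝ => y P.1 P.2)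
    (fun _ _ => hy.continuousAt) (Metric.dist_mem_uniformity hr₁)
  obtain ⟨r₂, hr₂, h2⟩ := Metric.mem_uniformity_dist.1 h2
  -- continuity at the initial point
  have h3 : ∀ᶠ P : ℝ × ℝ in 𝓝 (η₀, η₀), ‖g P.1 (P.2, y P.1 P.2) - g η₀ (η₀, 0)‖ < ε := by
    have hc3 : Continuous (fun P : ℝ × ℝ => ‖g P.1 (P.2, y P.1 P.2) - g η₀ (η₀, 0)‖) := by
      have : Continuous (fun P : ℝ × ℝ => g P.1 (P.2, y P.1 P.2)) :=
        hg.comp (continuous_fst.prodMk (continuous_snd.prodMk hy))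
      fun_prop
    refine hc3.continuousAt.eventually_lt continuousAt_const ?_
    simpa [hy0] using hε0
  obtain ⟨r₃, hr₃, h3⟩ := Metric.eventually_nhds_iff.1 h3
  have hrδ : 0 < δ - |ξ₀ - η₀| := sub_pos.2 hP
  filter_upwards [Metric.ball_mem_nhds η₀ hr₁, Metric.ball_mem_nhds η₀ hr₂,
    Metric.ball_mem_nhds η₀ hr₃, Metric.ball_mem_nhds η₀ hrδ, Metric.ball_mem_nhds η₀ hδ]
    with η e1 e2 e3 e4 e5
  rw [Metric.mem_ball, Real.dist_eq] at e1 e2 e3 e4 e5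
  set h := η - η₀ with hh
  have hstrip : ∀ s ∈ J, |s - η| < δ := fun s hs => by
    calc |s - η| = |(s - η₀) - h| := by congr 1; rw [hh]; ring
      _ ≤ |s - η₀| + |h| := abs_sub _ _
      _ < δ := by linarith [hJd s hs]
  have hstrip0 : ∀ s ∈ J, |s - η₀| < δ := fun s hs => (hJd s hs).trans_lt hP
  -- The remainder of the first order expansion in h. It is shown to be at most c|h| uniformly on J,
  -- by a Gronwall argument for its maximum m.
  set D : ℝ → E := fun s => y s η - y s η₀ - h • V s with hDdef
  have hDc : Continuous D := by
    have a1 : Continuous (fun s => y s η) :=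
      hy.comp (Continuous.prodMk_left η : Continuous fun s : ℝ => (s, η))
    have a2 : Continuous (fun s => y s η₀) :=
      hy.comp (Continuous.prodMk_left η₀ : Continuous fun s : ℝ => (s, η₀))
    simp only [hDdef]; fun_prop
  have hDd : ∀ s ∈ J, HasDerivAt D (g s (η, y s η) - g s (η₀, y s η₀)
      - h • (g' s (η₀, y s η₀) (1, V s))) s := fun s hs =>
    ((hyd s η (hstrip s hs)).sub (hyd s η₀ (hstrip0 s hs))).sub
      ((hVd s (hstrip0 s hs)).const_smul h)
  obtain ⟨sm, hsm, hmax⟩ := hJc.exists_isMaxOn ⟨η₀, left_mem_uIcc⟩ hDc.norm.continuousOn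
  set m := ‖D sm‖ with hm
  have hDm : ∀ s ∈ J, ‖D s‖ ≤ m := fun s hs => hmax hs
  have hlin : ∀ s ∈ J, ‖g s (η, y s η) - g s (η₀, y s η₀) - h • (g' s (η₀, y s η₀) (1, V s))‖
      ≤ (M + ε) * m + ε * ((1 + Vm) * |h|) := by
    intro s hs
    set z₀ : ℝ × E := (η₀, y s η₀)
    set z₁ : ℝ × E := (η, y s η)
    have hyr : ‖y s η - y s η₀‖ < r₁ := by
      rw [← dist_eq_norm, dist_comm]
      refine h2 (a := (s, η₀)) (b := (s, η)) ?_ ⟨s, hs, rfl⟩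
      rw [Prod.dist_eq, dist_self, dist_comm, Real.dist_eq]
      exact max_lt hr₂ e2
    have hz : ‖z₁ - z₀‖ < r₁ := by
      rw [Prod.norm_def]
      exact max_lt (by simpa [z₁, z₀] using e1) (by simpa [z₁, z₀] using hyr)
    -- The mean value inequality needs a convex set on which g s is differentiable, and
    -- differentiability is available in the strip only.
    have hconv : Convex ℝ (Metric.ball z₀ r₁ ∩ {z : ℝ × E | |s - z.1| < δ}) := by
      refine (convex_ball _ _).inter ?_
      have : {z : ℝ × E | |s - z.1| < δ} = (LinearMap.fst ℝ ℝ E) ⁻¹' (Metric.ball s δ) := by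
        ext z; simp [Metric.mem_ball, Real.dist_eq, abs_sub_comm]
      rw [this]
      exact (convex_ball s δ).linear_preimage _
    have hmv := hconv.norm_image_sub_le_of_norm_hasFDerivWithin_le' (f := g s) (f' := g' s)
      (φ := g' s z₀) (C := ε) (x := z₀) (y := z₁)
      (fun z hz => (hgd s z.1 z.2 hz.2).hasFDerivWithinAt)
      (fun z hz => by
        have := h1 (a := (s, z₀)) (b := (s, z)) (by
          rw [Prod.dist_eq, dist_self, dist_comm]
          exact max_lt hr₁ hz.1) ⟨s, hs, rfl⟩
        change dist (g' s z₀) (g' s z) < ε at this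
        rw [dist_comm, dist_eq_norm] at this
        exact this.le)
      ⟨Metric.mem_ball_self hr₁, hstrip0 s hs⟩ ⟨by rwa [mem_ball_iff_norm], hstrip s hs⟩
    have hΔ : z₁ - z₀ = h • ((1 : ℝ), V s) + ((0 : ℝ), D s) := by
      simp [z₁, z₀, hDdef, hh]
    have hn : ‖z₁ - z₀‖ ≤ (1 + Vm) * |h| + m := by
      rw [hΔ]
      refine (norm_add_le _ _).trans (add_le_add ?_ ?_)
      · rw [norm_smul, Real.norm_eq_abs, mul_comm]
        gcongr
        rw [Prod.norm_def]
        refine max_le ?_ ?_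
        · simp [hVm0]
        · simpa using (hVm s hs).trans (by linarith)
      · rw [Prod.norm_def]
        simpa using hDm s hs
    have heq : g s z₁ - g s z₀ - h • (g' s z₀ (1, V s))
        = (g s z₁ - g s z₀ - g' s z₀ (z₁ - z₀)) + g' s z₀ (0, D s) := by
      rw [hΔ, map_add, map_smul]; abel
    rw [heq]
    calc _ ≤ ‖g s z₁ - g s z₀ - g' s z₀ (z₁ - z₀)‖ + ‖g' s z₀ (0, D s)‖ := norm_add_le _ _
      _ ≤ ε * ((1 + Vm) * |h| + m) + M * m := by
          gcongr
          · exact hmv.trans (by gcongr)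
          · exact (hM s (hstrip0 s hs) _).trans (by gcongr; exact hDm s hs)
      _ = _ := by ring
  -- the initial value
  have hinit : ‖D η₀‖ ≤ ε * |h| := by
    have hJ' : ∀ s ∈ uIcc η₀ η, |s - η₀| ≤ |h| ∧ |s - η| ≤ |h| := fun s hs =>
      ⟨abs_sub_left_of_mem_uIcc hs, by
        have := abs_sub_right_of_mem_uIcc hs
        rwa [abs_sub_comm] at this⟩
    -- Since y vanishes at (η, η), moving from s = η to s = η₀ changes it by -h g(η₀, (η₀, 0)) to
    -- first order, which is exactly h V(η₀).
    have hmv := (convex_uIcc η₀ η).norm_image_sub_le_of_norm_hasDerivWithin_le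
      (f := fun s => y s η - s • g η₀ (η₀, 0)) (C := ε) (x := η) (y := η₀)
      (f' := fun s => g s (η, y s η) - (1 : ℝ) • g η₀ (η₀, 0))
      (fun s hs => by
        have hs' := (hJ' s hs).2
        exact ((hyd s η (hs'.trans_lt e5)).sub
          ((hasDerivAt_id s).smul_const _)).hasDerivWithinAt)
      (fun s hs => by
        rw [one_smul]
        refine (h3 (y := (s, η)) ?_).le
        rw [Prod.dist_eq, Real.dist_eq, Real.dist_eq]
        exact max_lt ((hJ' s hs).1.trans_lt e3) e3)
      right_mem_uIcc left_mem_uIcc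
    have : D η₀ = (y η₀ η - η₀ • g η₀ (η₀, 0)) - (y η η - η • g η₀ (η₀, 0)) := by
      simp only [hDdef, hy0, hV0, hh, smul_neg, sub_smul]; abel
    rw [this]
    refine hmv.trans_eq ?_
    rw [Real.norm_eq_abs, abs_sub_comm]
  have hmest : m ≤ ε * |h| + ((M + ε) * m + ε * ((1 + Vm) * |h|)) * δ := by
    have hmv := (convex_uIcc η₀ ξ₀).norm_image_sub_le_of_norm_hasDerivWithin_le
      (f := D) (x := η₀) (y := sm) (fun s hs => (hDd s hs).hasDerivWithinAt) hlin
      left_mem_uIcc hsm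
    calc m = ‖D η₀ + (D sm - D η₀)‖ := by rw [add_sub_cancel]
      _ ≤ ‖D η₀‖ + ‖D sm - D η₀‖ := norm_add_le _ _
      _ ≤ _ := by
        refine add_le_add hinit (hmv.trans ?_)
        gcongr
        rw [Real.norm_eq_abs]
        exact (hstrip0 sm hsm).le
  have hm0 : 0 ≤ m := norm_nonneg _
  -- The coefficient of m on the right of `hmest` is at most 1/2 + 1/4, so m is absorbed and m ≤
  -- (c/2)|h|.
  have hfin : m ≤ c * |h| := by
    have q1 : δ * M * m ≤ 1 / 2 * m := by gcongr
    have q2 : ε * δ * m ≤ 1 / 4 * m := by gcongr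
    have q3 : ε * (1 + δ * (1 + Vm)) * |h| ≤ c / 8 * |h| := by gcongr
    have q4 : 0 ≤ c * |h| := by positivity
    nlinarith [q1, q2, q3, q4, hmest]
  have := (hDm ξ₀ right_mem_uIcc).trans hfin
  simpa [hDdef, hh] using this

end Parameter

/-! ### Semilinear characteristic problem: contraction and transversal derivative -/

section Goursat

variable {E E' : Type*} [NormedAddCommGroup E] [NormedSpace ℝ E]
  [NormedAddCommGroup E'] [NormedSpace ℝ E']

/-- Fixed point of the integral formulation of the semilinear characteristic problem. -/
theorem exists_rayIntegral_fixedPoint [CompleteSpace E] [CompleteSpace E']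
    {δ : ℝ} {M : ℝ≥0} (hδ : 0 < δ) (hδM : δ * M ≤ 1 / 4)
    {G : (ℝ × ℝ) × (E × E') → E} {H : (ℝ × ℝ) × (E × E') → E'}
    (hG : Continuous G) (hH : Continuous H)
    (hGb : ∀ P z, ‖z‖ ≤ 1 → ‖G (P, z)‖ ≤ M) (hHb : ∀ P z, ‖z‖ ≤ 1 → ‖H (P, z)‖ ≤ M)
    (hGL : LipschitzOnWith M G {p | ‖p.2‖ ≤ 1}) (hHL : LipschitzOnWith M H {p | ‖p.2‖ ≤ 1}) :
    ∃ (A : ℝ × ℝ → E) (B : ℝ × ℝ → E'), Continuous A ∧ Continuous B ∧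
      (∀ P, ‖A P‖ ≤ 1 / 4) ∧ (∀ P, ‖B P‖ ≤ 1 / 4) ∧
      (∀ P, A P = rayIntegral δ (fun Q => G (Q, (A Q, B Q))) P) ∧
      (∀ P, B P = rayIntegral δ (fun Q => H (Q.swap, (A Q.swap, B Q.swap))) P.swap) := by
  -- The bounds on G and H hold only for states of norm at most 1, hence the unit ball; the choice
  -- δM ≤ 1/4 keeps the image within radius 1/4.
  let X := Metric.closedBall (0 : (ℝ × ℝ) →ᵇ (E × E')) 1
  have hXb : ∀ (Z : X) P, ‖Z.1 P‖ ≤ 1 := fun Z P =>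
    (Z.1.norm_coe_le_norm P).trans (mem_closedBall_zero_iff.1 Z.2)
  let g : X → ℝ × ℝ → E := fun Z Q => G (Q, Z.1 Q)
  let h : X → ℝ × ℝ → E' := fun Z Q => H (Q.swap, Z.1 Q.swap)
  have hg : ∀ Z, Continuous (g Z) := fun Z => by simp only [g]; fun_prop
  have hh : ∀ Z, Continuous (h Z) := fun Z => by simp only [h]; fun_prop
  let f : X → ℝ × ℝ → E × E' := fun Z P => (rayIntegral δ (g Z) P, rayIntegral δ (h Z) P.swap)
  have hfc : ∀ Z, Continuous (f Z) := fun Z =>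
    (continuous_rayIntegral δ (hg Z)).prodMk
      ((continuous_rayIntegral δ (hh Z)).comp continuous_swap)
  have hfb : ∀ Z P, ‖f Z P‖ ≤ 1 / 4 := fun Z P => by
    rw [Prod.norm_def]
    exact max_le ((norm_rayIntegral_le hδ.le (g := g Z)
        (fun Q => hGb Q (Z.1 Q) (hXb Z Q)) P).trans hδM)
      ((norm_rayIntegral_le hδ.le (g := h Z)
        (fun Q => hHb Q.swap (Z.1 Q.swap) (hXb Z Q.swap)) P.swap).trans hδM)
  let T : X → X := fun Z => ⟨BoundedContinuousFunction.ofNormedAddCommGroup (f Z) (hfc Z) (1 / 4)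
    (hfb Z), by
      rw [mem_closedBall_zero_iff]
      exact (BoundedContinuousFunction.norm_ofNormedAddCommGroup_le _ (by norm_num) _).trans
        (by norm_num)⟩
  have hT : ContractingWith (1 / 2) T := by
    refine ⟨by rw [← NNReal.coe_lt_coe]; norm_num, LipschitzWith.of_dist_le_mul fun Z W => ?_⟩
    rw [Subtype.dist_eq, Subtype.dist_eq, BoundedContinuousFunction.dist_le (by positivity)]
    intro P
    have hd : ∀ Q, ‖Z.1 Q - W.1 Q‖ ≤ dist Z.1 W.1 := fun Q => by
      rw [← dist_eq_norm]; exact BoundedContinuousFunction.dist_coe_le_dist Q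
    have key : δ * (M * dist Z.1 W.1) ≤ ((1 / 2 : ℝ≥0) : ℝ) * dist Z.1 W.1 := by
      rw [← mul_assoc]
      gcongr
      exact hδM.trans (by norm_num)
    change dist (f Z P) (f W P) ≤ _
    rw [Prod.dist_eq]
    refine max_le ?_ ?_
    · rw [dist_eq_norm]
      refine (norm_rayIntegral_sub_le hδ.le (hg Z) (hg W) (fun Q => ?_) P).trans key
      have := hGL.norm_sub_le (x := (Q, Z.1 Q)) (y := (Q, W.1 Q)) (hXb Z Q) (hXb W Q)
      refine this.trans ?_
      gcongr
      simpa [Prod.norm_def] using hd Q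
    · rw [dist_eq_norm]
      refine (norm_rayIntegral_sub_le hδ.le (hh Z) (hh W) (fun Q => ?_) P.swap).trans key
      have := hHL.norm_sub_le (x := (Q.swap, Z.1 Q.swap)) (y := (Q.swap, W.1 Q.swap))
        (hXb Z _) (hXb W _)
      refine this.trans ?_
      gcongr
      simpa [Prod.norm_def] using hd Q.swap
  have hXc : CompleteSpace X := Metric.isClosed_closedBall.completeSpace_coe
  have hXn : Nonempty X := ⟨⟨0, Metric.mem_closedBall_self zero_le_one⟩⟩
  obtain ⟨Z, hZ⟩ : ∃ Z, T Z = Z := ⟨_, hT.fixedPoint_isFixedPt⟩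
  have hZP : ∀ P, Z.1 P = f Z P := fun P => by
    conv_lhs => rw [← hZ]
    rfl
  refine ⟨fun P => (Z.1 P).1, fun P => (Z.1 P).2, by fun_prop, by fun_prop,
    fun P => ?_, fun P => ?_, fun P => ?_, fun P => ?_⟩
  · exact (norm_fst_le _).trans ((hZP P).symm ▸ hfb Z P)
  · exact (norm_snd_le _).trans ((hZP P).symm ▸ hfb Z P)
  · exact congrArg Prod.fst (hZP P)
  · exact congrArg Prod.snd (hZP P)

/-- Fixed point of a linear integral equation along rays. -/
theorem exists_rayIntegral_affine_fixedPoint [CompleteSpace E]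
    {δ : ℝ} {M : ℝ≥0} (hδ : 0 < δ) (hδM : δ * M ≤ 1 / 4)
    {L : ℝ × ℝ → E →L[ℝ] E} {c d : ℝ × ℝ → E} (hL : Continuous L) (hc : Continuous c)
    (hd : Continuous d) (hLM : ∀ P, ‖L P‖ ≤ M) {N : ℝ} (hcN : ∀ P, ‖c P‖ ≤ N)
    (hdN : ∀ P, ‖d P‖ ≤ N) :
    ∃ V : ℝ × ℝ → E, Continuous V ∧
      ∀ P, V P = d P + rayIntegral δ (fun Q => L Q (V Q) + c Q) P := by
  let X := (ℝ × ℝ) →ᵇ E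
  let g : X → ℝ × ℝ → E := fun V Q => L Q (V Q) + c Q
  have hg : ∀ V, Continuous (g V) := fun V => by
    have : Continuous (fun Q => L Q (V Q)) := hL.clm_apply V.continuous
    exact this.add hc
  let f : X → ℝ × ℝ → E := fun V P => d P + rayIntegral δ (g V) P
  have hfc : ∀ V, Continuous (f V) := fun V => hd.add (continuous_rayIntegral δ (hg V))
  have hfb : ∀ V P, ‖f V P‖ ≤ N + δ * (M * ‖V‖ + N) := fun V P => by
    refine norm_add_le_of_le (hdN P) (norm_rayIntegral_le hδ.le (fun Q => ?_) P)
    refine norm_add_le_of_le ?_ (hcN Q)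
    exact (L Q).le_of_opNorm_le_of_le (hLM Q) (V.norm_coe_le_norm Q)
  let T : X → X := fun V => BoundedContinuousFunction.ofNormedAddCommGroup (f V) (hfc V) _ (hfb V)
  have hT : ContractingWith (1 / 2) T := by
    refine ⟨by rw [← NNReal.coe_lt_coe]; norm_num, LipschitzWith.of_dist_le_mul fun V W => ?_⟩
    rw [BoundedContinuousFunction.dist_le (by positivity)]
    intro P
    change dist (f V P) (f W P) ≤ _
    rw [dist_eq_norm]
    simp only [f, add_sub_add_left_eq_sub]
    refine (norm_rayIntegral_sub_le hδ.le (hg V) (hg W) (M := M * dist V W) (fun Q => ?_) P).trans ?_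
    · simp only [g, add_sub_add_right_eq_sub, ← map_sub]
      refine (L Q).le_of_opNorm_le_of_le (hLM Q) ?_
      rw [← dist_eq_norm]; exact BoundedContinuousFunction.dist_coe_le_dist Q
    · rw [← mul_assoc]
      gcongr
      exact hδM.trans (by norm_num)
  obtain ⟨V, hV⟩ : ∃ V, T V = V := ⟨_, hT.fixedPoint_isFixedPt⟩
  refine ⟨V, V.continuous, fun P => ?_⟩
  conv_lhs => rw [← hV]
  rfl

/-- Differentiability of the solution transversally to the rays. -/
theorem exists_transversal_deriv [CompleteSpace E]
    {δ : ℝ} {M : ℝ≥0} (hδ : 0 < δ) (hδM : δ * M ≤ 1 / 4)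
    {G : (ℝ × ℝ) × (E × E') → E} (hG : ContDiff ℝ 1 G)
    (hGb : ∀ P z, ‖z‖ ≤ 1 → ‖G (P, z)‖ ≤ M)
    (hGL : LipschitzOnWith M G {p | ‖p.2‖ ≤ 1})
    {A : ℝ × ℝ → E} {B b : ℝ × ℝ → E'} (hA : Continuous A) (hB : Continuous B)
    (hb : Continuous b) {N : ℝ} (hbN : ∀ P, ‖b P‖ ≤ N)
    (hA4 : ∀ P, ‖A P‖ ≤ 1 / 4) (hB4 : ∀ P, ‖B P‖ ≤ 1 / 4)
    (hAeq : ∀ P, A P = rayIntegral δ (fun Q => G (Q, (A Q, B Q))) P)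
    (hBb : ∀ s η, |s - η| < δ → HasDerivAt (fun r => B (s, r)) (b (s, η)) η)
    (hB0 : ∀ η, B (η, η) = 0) :
    ∃ V : ℝ × ℝ → E, Continuous V ∧ (∀ y, V (y, y) = - G ((y, y), (0, 0))) ∧ ∀ s η, |s - η| < δ →
      HasDerivAt (fun r => A (s, r)) (V (s, η)) η ∧
      ∃ k, HasDerivAt (fun r => V (r, η)) k s ∧
        HasDerivAt (fun r => G ((s, r), (A (s, r), B (s, r)))) k η := by
  have hGc : Continuous G := hG.continuous
  have hGd : ∀ p, HasFDerivAt G (fderiv ℝ G p) p := fun p =>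
    (hG.differentiable one_ne_zero p).hasFDerivAt
  have hG'c : Continuous (fderiv ℝ G) := hG.continuous_fderiv one_ne_zero
  set p : ℝ × ℝ → (ℝ × ℝ) × (E × E') := fun Q => (Q, (A Q, B Q)) with hp
  have hpc : Continuous p := by simp only [hp]; fun_prop
  have hA0 : ∀ η, A (η, η) = 0 := fun η => by rw [hAeq, rayIntegral_diag hδ.le]
  have hz : ∀ Q, ‖(A Q, B Q)‖ < 1 := fun Q => by
    rw [Prod.norm_def]
    exact max_lt ((hA4 Q).trans_lt (by norm_num)) ((hB4 Q).trans_lt (by norm_num))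
  -- The Lipschitz constant bounds the derivative because the state lies strictly inside the unit
  -- ball, so the Lipschitz set is a neighbourhood.
  have hG' : ∀ Q, ‖fderiv ℝ G (p Q)‖ ≤ M := fun Q => by
    refine (hGd (p Q)).le_of_lipschitzOn ?_ hGL
    have : {q : (ℝ × ℝ) × (E × E') | ‖q.2‖ < 1} ∈ 𝓝 (p Q) :=
      (isOpen_lt (by fun_prop) continuous_const).mem_nhds (hz Q)
    exact Filter.mem_of_superset this fun q (hq : ‖q.2‖ < 1) => hq.le
  -- the coefficients of the linearized equation
  set ι : E →L[ℝ] (ℝ × ℝ) × (E × E') :=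
    (ContinuousLinearMap.inr ℝ (ℝ × ℝ) (E × E')).comp (ContinuousLinearMap.inl ℝ E E') with hι
  have hι1 : ∀ k, ι k = ((0, 0), (k, 0)) := fun k => rfl
  set L : ℝ × ℝ → E →L[ℝ] E := fun Q => (fderiv ℝ G (p Q)).comp ι with hL
  set c : ℝ × ℝ → E := fun Q => fderiv ℝ G (p Q) ((0, 1), (0, b Q)) with hc
  have hLc : Continuous L := (hG'c.comp hpc).clm_comp continuous_const
  have hcc : Continuous c := (hG'c.comp hpc).clm_apply (by fun_prop)
  have hLM : ∀ Q, ‖L Q‖ ≤ M := fun Q => by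
    refine ContinuousLinearMap.opNorm_le_bound _ M.2 fun k => ?_
    simp only [hL, ContinuousLinearMap.comp_apply, hι1]
    refine ((fderiv ℝ G (p Q)).le_of_opNorm_le (hG' Q) _).trans_eq ?_
    simp [Prod.norm_def]
  have hN0 : 0 ≤ N := (norm_nonneg _).trans (hbN (0, 0))
  have hcN : ∀ Q, ‖c Q‖ ≤ M * (1 + N) := fun Q => by
    refine (fderiv ℝ G (p Q)).le_of_opNorm_le_of_le (hG' Q) ?_
    simp only [Prod.norm_def, norm_zero, norm_one]
    refine max_le (max_le (by linarith) (by linarith)) (max_le (by linarith) ?_)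
    linarith [hbN Q]
  -- Differentiating A(η, η) = 0 gives A_η = -A_ξ = -G on the diagonal, the initial value of the
  -- linearized equation.
  set d : ℝ × ℝ → E := fun Q => - G ((Q.2, Q.2), (0, 0)) with hd
  have hdc : Continuous d := by simp only [hd]; fun_prop
  have hdN : ∀ Q, ‖d Q‖ ≤ M * (1 + N) := fun Q => by
    simp only [hd, norm_neg]
    refine (hGb _ _ (by simp)).trans ?_
    nlinarith [M.2]
  obtain ⟨V, hVc, hV⟩ := exists_rayIntegral_affine_fixedPoint hδ hδM hLc hcc hdc hLM hcN hdN
  refine ⟨V, hVc, fun y => by rw [hV, rayIntegral_diag hδ.le, add_zero], ?_⟩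
  -- the parametric equation
  set g : ℝ → ℝ × E → E := fun s z => G ((s, z.1), (z.2, B (s, z.1))) with hg
  -- The differential of (η, z) ↦ ((s, η), (z, B(s, η))), with b in the role of ∂B/∂η.
  set J : ℝ → ℝ → (ℝ × E →L[ℝ] (ℝ × ℝ) × (E × E')) := fun s η =>
    ((0 : ℝ × E →L[ℝ] ℝ).prod (ContinuousLinearMap.fst ℝ ℝ E)).prod
      ((ContinuousLinearMap.snd ℝ ℝ E).prod 0) +
    ((ContinuousLinearMap.inr ℝ (ℝ × ℝ) (E × E')).comp (ContinuousLinearMap.inr ℝ E E')).comp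
      ((ContinuousLinearMap.fst ℝ ℝ E).smulRight (b (s, η))) with hJ
  set g' : ℝ → ℝ × E → (ℝ × E →L[ℝ] E) := fun s z =>
    (fderiv ℝ G ((s, z.1), (z.2, B (s, z.1)))).comp (J s z.1) with hg'
  have hLV : ∀ s η, g' s (η, A (s, η)) (1, V (s, η)) = L (s, η) (V (s, η)) + c (s, η) := by
    intro s η
    simp only [hg', hL, hc, ContinuousLinearMap.comp_apply, hι1, ← map_add]
    congr 1
    simp [hJ]
  have hgd : ∀ s η z, |s - η| < δ → HasFDerivAt (g s) (g' s (η, z)) (η, z) := by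
    intro s η z hs
    have hf1 : HasFDerivAt (fun z : ℝ × E => z.1) (ContinuousLinearMap.fst ℝ ℝ E) (η, z) :=
      hasFDerivAt_fst
    have hf2 : HasFDerivAt (fun z : ℝ × E => z.2) (ContinuousLinearMap.snd ℝ ℝ E) (η, z) :=
      hasFDerivAt_snd
    have hf3 : HasFDerivAt (fun z : ℝ × E => B (s, z.1))
        ((ContinuousLinearMap.fst ℝ ℝ E).smulRight (b (s, η))) (η, z) := by
      have := (hBb s η hs).hasFDerivAt.comp (η, z) hf1
      exact this.congr_fderiv (by ext <;> simp)
    have := ((hasFDerivAt_const s (η, z)).prodMk hf1).prodMk (hf2.prodMk hf3)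
    exact ((hGd ((s, η), (z, B (s, η)))).comp (η, z) this).congr_fderiv (by
      simp only [hg', hJ]
      congr 1
      ext <;> simp)
  have hAd : ∀ s η, |s - η| < δ → HasDerivAt (fun r => A (r, η)) (g s (η, A (s, η))) s := by
    intro s η hs
    have : (fun r => A (r, η)) = fun r => rayIntegral δ (fun Q => G (Q, (A Q, B Q))) (r, η) :=
      funext fun r => hAeq _
    rw [this]
    exact hasDerivAt_rayIntegral (g := fun Q => G (Q, (A Q, B Q))) (hGc.comp hpc) (P := (s, η)) hs
  have hVd : ∀ s η, |s - η| < δ →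
      HasDerivAt (fun r => V (r, η)) (g' s (η, A (s, η)) (1, V (s, η))) s := by
    intro s η hs
    have : (fun r => V (r, η)) = fun r => d (s, η) +
        rayIntegral δ (fun Q => L Q (V Q) + c Q) (r, η) := funext fun r => hV _
    rw [this, hLV]
    exact (hasDerivAt_rayIntegral (g := fun Q => L Q (V Q) + c Q)
      ((hLc.clm_apply hVc).add hcc) (P := (s, η)) hs).const_add _
  intro s η hs
  have hAη : HasDerivAt (fun r => A (s, r)) (V (s, η)) η := by
    refine hasDerivAt_of_linearized (g := g) (g' := g') (y := fun s η => A (s, η))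
      (V := fun s => V (s, η)) (M := M) hA hgd ?_ ?_ hAd hA0 hs (by fun_prop) ?_ M.2
      (by linarith) (fun s hs => hVd s η hs) ?_
    · simp only [hg]; fun_prop
    · simp only [hg', hJ]
      refine (hG'c.comp (by fun_prop)).clm_comp ?_
      refine continuous_const.add (continuous_const.clm_comp ?_)
      exact (ContinuousLinearMap.smulRightL ℝ (ℝ × E) E'
        (ContinuousLinearMap.fst ℝ ℝ E)).continuous.comp (by fun_prop)
    · intro s _ k
      simp only [hg', ContinuousLinearMap.comp_apply]
      refine ((fderiv ℝ G (p (s, η))).le_of_opNorm_le (hG' (s, η)) _).trans_eq ?_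
      simp [hJ, Prod.norm_def]
    · rw [hV, rayIntegral_diag hδ.le]
      simp [hd, hg, hB0]
  -- The right-hand side of the linearized equation is, by the chain rule, the η-derivative of G
  -- along the solution: the mixed derivatives of A coincide.
  refine ⟨hAη, _, hVd s η hs, ?_⟩
  have h2 := (hgd s η (A (s, η)) hs).comp_hasDerivAt η ((hasDerivAt_id η).prodMk hAη)
  exact h2

end Goursat

/-- The open strip `|ξ - η| < δ` around the diagonal. -/
def strip (δ : ℝ) : Set (ℝ × ℝ) := {P | |P.1 - P.2| < δ}

theorem isOpen_strip (δ : ℝ) : IsOpen (strip δ) :=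
  isOpen_lt (by fun_prop) continuous_const

/-! ### Both families of unknowns, by symmetry -/

section Goursat

variable {E E' : Type*} [NormedAddCommGroup E] [NormedSpace ℝ E]
  [NormedAddCommGroup E'] [NormedSpace ℝ E']

/-- A semilinear system in two characteristic variables, with zero data on the diagonal, has a
solution in a strip, which is differentiable in both variables. -/
theorem exists_characteristic_solution [CompleteSpace E] [CompleteSpace E']
    {δ : ℝ} {M : ℝ≥0} (hδ : 0 < δ) (hδM : δ * M ≤ 1 / 4)
    {G : (ℝ × ℝ) × (E × E') → E} {H : (ℝ × ℝ) × (E × E') → E'}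
    (hG : ContDiff ℝ 1 G) (hH : ContDiff ℝ 1 H)
    (hGb : ∀ P z, ‖z‖ ≤ 1 → ‖G (P, z)‖ ≤ M) (hHb : ∀ P z, ‖z‖ ≤ 1 → ‖H (P, z)‖ ≤ M)
    (hGL : LipschitzOnWith M G {p | ‖p.2‖ ≤ 1}) (hHL : LipschitzOnWith M H {p | ‖p.2‖ ≤ 1}) :
    ∃ (A V : ℝ × ℝ → E) (B W : ℝ × ℝ → E'),
      Continuous A ∧ Continuous V ∧ Continuous B ∧ Continuous W ∧
      (∀ P, ‖A P‖ ≤ 1 / 4) ∧ (∀ P, ‖B P‖ ≤ 1 / 4) ∧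
      (∀ y, A (y, y) = 0) ∧ (∀ y, B (y, y) = 0) ∧
      (∀ y, V (y, y) = - G ((y, y), (0, 0))) ∧ (∀ y, W (y, y) = - H ((y, y), (0, 0))) ∧
      (∀ s η, |s - η| < δ →
        HasDerivAt (fun r => A (r, η)) (G ((s, η), (A (s, η), B (s, η)))) s ∧
        HasDerivAt (fun r => A (s, r)) (V (s, η)) η ∧
        HasDerivAt (fun r => B (s, r)) (H ((s, η), (A (s, η), B (s, η)))) η ∧
        HasDerivAt (fun r => B (r, η)) (W (s, η)) s) ∧
      (∀ s η, |s - η| < δ → ∃ k, HasDerivAt (fun r => V (r, η)) k s ∧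
        HasDerivAt (fun r => G ((s, r), (A (s, r), B (s, r)))) k η) ∧
      (∀ s η, |s - η| < δ → ∃ k, HasDerivAt (fun r => W (s, r)) k η ∧
        HasDerivAt (fun r => H ((r, η), (A (r, η), B (r, η)))) k s) := by
  obtain ⟨A, B, hA, hB, hA4, hB4, hAe, hBe⟩ := exists_rayIntegral_fixedPoint hδ hδM
    hG.continuous hH.continuous hGb hHb hGL hHL
  have hGc := hG.continuous
  have hHc := hH.continuous
  have hA0 : ∀ y, A (y, y) = 0 := fun y => by rw [hAe, rayIntegral_diag hδ.le]
  have hB0 : ∀ y, B (y, y) = 0 := fun y => by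
    rw [hBe]; exact rayIntegral_diag hδ.le _ y
  have hAd : ∀ s η, |s - η| < δ →
      HasDerivAt (fun r => A (r, η)) (G ((s, η), (A (s, η), B (s, η)))) s := fun s η hs => by
    have : (fun r => A (r, η)) = fun r => rayIntegral δ (fun Q => G (Q, (A Q, B Q))) (r, η) :=
      funext fun r => hAe _
    rw [this]
    exact hasDerivAt_rayIntegral (g := fun Q => G (Q, (A Q, B Q))) (by fun_prop) (P := (s, η)) hs
  have hBd : ∀ s η, |s - η| < δ →
      HasDerivAt (fun r => B (s, r)) (H ((s, η), (A (s, η), B (s, η)))) η := fun s η hs => by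
    have : (fun r => B (s, r)) = fun r => rayIntegral δ
        (fun Q => H (Q.swap, (A Q.swap, B Q.swap))) (r, s) := funext fun r => hBe _
    rw [this]
    exact hasDerivAt_rayIntegral (g := fun Q => H (Q.swap, (A Q.swap, B Q.swap)))
      (by fun_prop) (P := (η, s)) (by rwa [abs_sub_comm])
  have hz : ∀ Q, ‖(A Q, B Q)‖ ≤ 1 := fun Q => by
    rw [Prod.norm_def]
    exact max_le ((hA4 Q).trans (by norm_num)) ((hB4 Q).trans (by norm_num))
  obtain ⟨V, hVc, hV0, hV⟩ := exists_transversal_deriv (b := fun Q => H (Q, (A Q, B Q))) hδ hδM hG hGb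
    hGL hA hB (by fun_prop) (fun P => hHb _ _ (hz P)) hA4 hB4 hAe hBd hB0
  -- Exchanging the two coordinates and the two unknowns turns the equation for B into one of the
  -- type just treated for A.
  let σ : (ℝ × ℝ) × (E' × E) → (ℝ × ℝ) × (E × E') := fun p => (p.1.swap, p.2.swap)
  have hσ : ContDiff ℝ 1 σ := by
    have : σ = fun p => ((p.1.2, p.1.1), (p.2.2, p.2.1)) := rfl
    rw [this]; fun_prop
  have hσL : LipschitzWith 1 σ := LipschitzWith.of_dist_le_mul fun p q => by
    simp only [σ, Prod.dist_eq, Prod.fst_swap, Prod.snd_swap, NNReal.coe_one, one_mul]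
    rw [max_comm (dist p.1.2 q.1.2), max_comm (dist p.2.2 q.2.2)]
  have hsw : ∀ z : E' × E, ‖z.swap‖ = ‖z‖ := fun z => by
    simp [Prod.norm_def, max_comm]
  obtain ⟨W, hWc, hW0, hW⟩ := exists_transversal_deriv (E := E') (E' := E) (G := fun p => H (σ p))
    (A := fun P => B P.swap) (B := fun P => A P.swap)
    (b := fun Q => G (Q.swap, (A Q.swap, B Q.swap))) hδ hδM (hH.comp hσ)
    (fun P z hz => hHb _ _ (by rwa [hsw]))
    (by
      have := hHL.comp (f := σ) (s := {p | ‖p.2‖ ≤ 1}) (hσL.lipschitzOnWith) (fun p hp => by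
        change ‖p.2.swap‖ ≤ 1
        rw [hsw]; exact hp)
      rwa [mul_one] at this)
    (by fun_prop) (by fun_prop) (by fun_prop) (fun P => hGb _ _ (hz _))
    (fun P => hB4 _) (fun P => hA4 _) (fun P => hBe P.swap)
    (fun s η hs => hAd η s (by rwa [abs_sub_comm])) (fun η => hA0 η)
  refine ⟨A, V, B, fun P => W P.swap, hA, hVc, hB, by fun_prop, hA4, hB4, hA0, hB0, hV0,
    fun y => hW0 y,
    fun s η hs => ⟨hAd s η hs, (hV s η hs).1, hBd s η hs, ?_⟩,
    fun s η hs => (hV s η hs).2, fun s η hs => ?_⟩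
  · exact (hW η s (by rwa [abs_sub_comm])).1
  · exact (hW η s (by rwa [abs_sub_comm])).2

end Goursat

/-! ### Gradients of functions of two variables -/

/-- The linear form with the given partial derivatives. -/
noncomputable def grad (c d : ℝ) : ℝ × ℝ →L[ℝ] ℝ :=
  c • ContinuousLinearMap.fst ℝ ℝ ℝ + d • ContinuousLinearMap.snd ℝ ℝ ℝ

@[simp] theorem grad_apply (c d : ℝ) (v : ℝ × ℝ) : grad c d v = c * v.1 + d * v.2 := by
  simp [grad]

/-- A function of two variables with continuous partial derivatives is differentiable. -/
theorem hasStrictFDerivAt_of_partials {U : Set (ℝ × ℝ)} (hU : IsOpen U)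
    {φ φ₁ φ₂ : ℝ × ℝ → ℝ} (h1 : ContinuousOn φ₁ U) (h2 : ContinuousOn φ₂ U)
    (hd1 : ∀ P ∈ U, HasDerivAt (fun r => φ (r, P.2)) (φ₁ P) P.1)
    (hd2 : ∀ P ∈ U, HasDerivAt (fun r => φ (P.1, r)) (φ₂ P) P.2) {P : ℝ × ℝ} (hP : P ∈ U) :
    HasStrictFDerivAt φ (grad (φ₁ P) (φ₂ P)) P := by
  have hUn : U ∈ 𝓝 P := hU.mem_nhds hP
  have := hasStrictFDerivAt_uncurry_coprod (𝕜 := ℝ) (f := fun x y => φ (x, y)) (u := P)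
    (f₁ := fun x y => (1 : ℝ →L[ℝ] ℝ).smulRight (φ₁ (x, y)))
    (f₂ := fun x y => (1 : ℝ →L[ℝ] ℝ).smulRight (φ₂ (x, y)))
    (by filter_upwards [hUn] with v hv using
      (hd1 v hv).hasFDerivAt.congr_fderiv (by ext; simp [Function.HasUncurry.uncurry]))
    (by filter_upwards [hUn] with v hv using
      (hd2 v hv).hasFDerivAt.congr_fderiv (by ext; simp [Function.HasUncurry.uncurry]))
    ((ContinuousLinearMap.smulRightL ℝ ℝ ℝ 1).continuous.continuousAt.comp
      (h1.continuousAt hUn))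
    ((ContinuousLinearMap.smulRightL ℝ ℝ ℝ 1).continuous.continuousAt.comp
      (h2.continuousAt hUn))
  refine this.congr_fderiv ?_
  ext <;> simp [Function.HasUncurry.uncurry]

/-- A function of two variables with a continuous gradient is `C¹`. -/
theorem contDiffOn_one_of_grad {U : Set (ℝ × ℝ)} (hU : IsOpen U)
    {φ φ₁ φ₂ : ℝ × ℝ → ℝ} (h1 : ContinuousOn φ₁ U) (h2 : ContinuousOn φ₂ U)
    (hd : ∀ P ∈ U, HasFDerivAt φ (grad (φ₁ P) (φ₂ P)) P) : ContDiffOn ℝ 1 φ U := by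
  rw [show (1 : WithTop ℕ∞) = 0 + 1 from rfl, contDiffOn_succ_iff_fderiv_of_isOpen hU]
  refine ⟨fun P hP => (hd P hP).differentiableAt.differentiableWithinAt, by simp, ?_⟩
  rw [contDiffOn_zero]
  refine ContinuousOn.congr (f := fun P => grad (φ₁ P) (φ₂ P)) ?_ (fun P hP => (hd P hP).fderiv)
  unfold grad
  fun_prop

/-! ### The wave equation in characteristic coordinates -/

/-- The growth rate of `ρ = R / u` along its characteristics, where `F(u) = 2 f u ^ a`. -/
noncomputable def sourceR (a f ρ σ : ℝ) : ℝ := a / 2 * (ρ - σ) * ρ + f * (ρ - σ) - ρ * σ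

/-- The growth rate of `σ = S / u` along its characteristics, where `F(u) = 2 f u ^ a`. -/
noncomputable def sourceS (a f ρ σ : ℝ) : ℝ := -(a / 2) * (ρ - σ) * σ + f * (ρ - σ) - ρ * σ

/-- Data on the diagonal for the system in characteristic coordinates: logarithm of the unknown,
Riemann invariants divided by the unknown, position, as functions of the travel time. -/
structure CharData (a W B C : ℝ) (f w₀ ρ₀ σ₀ χ : ℝ → ℝ) : Prop where
  f_contDiff : ContDiff ℝ 1 f
  f_le : ∀ w ≤ W + 1, |f w| ≤ C
  f_deriv : ∀ w ≤ W + 1, |deriv f w| ≤ C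
  ρ_contDiff : ContDiff ℝ 1 ρ₀
  σ_contDiff : ContDiff ℝ 1 σ₀
  w_le : ∀ y, w₀ y ≤ W
  ρ_le : ∀ y, |ρ₀ y| ≤ B
  σ_le : ∀ y, |σ₀ y| ≤ B
  ρ_deriv : ∀ y, |deriv ρ₀ y| ≤ B
  σ_deriv : ∀ y, |deriv σ₀ y| ≤ B
  w_deriv : ∀ y, HasDerivAt w₀ ((ρ₀ y - σ₀ y) / 2) y
  χ_deriv : ∀ y, HasDerivAt χ (Real.exp (a * w₀ y)) y

/-- Solutions of the system in characteristic coordinates `(ξ, η)`: `w = log u`, `ρ = R / u`,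
`σ = S / u`, the time `τ`, the position `X`, and `p = ∂τ/∂ξ`, `q = ∂τ/∂η`. -/
structure IsCharSolution (a δ : ℝ) (f w₀ ρ₀ σ₀ χ : ℝ → ℝ)
    (w ρ σ τ X p q ρ' σ' : ℝ × ℝ → ℝ) : Prop where
  cont_w : Continuous w
  cont_ρ : Continuous ρ
  cont_σ : Continuous σ
  cont_X : Continuous X
  cont_τ : Continuous τ
  cont_p : Continuous p
  cont_q : Continuous q
  cont_ρ' : Continuous ρ'
  cont_σ' : Continuous σ'
  w_near : ∀ s η, |w (s, η) - w₀ η| ≤ 1 / 4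
  ρ_near : ∀ s η, |ρ (s, η) - ρ₀ η| ≤ 1 / 4
  σ_near : ∀ s η, |σ (s, η) - σ₀ s| ≤ 1 / 4
  X_near : ∀ s η, |X (s, η) - χ η| ≤ 1 / 4
  p_near : ∀ s η, |p (s, η) + 1 / 2| ≤ 1 / 4
  q_near : ∀ s η, |q (s, η) - 1 / 2| ≤ 1 / 4
  w_diag : ∀ y, w (y, y) = w₀ y
  ρ_diag : ∀ y, ρ (y, y) = ρ₀ y
  σ_diag : ∀ y, σ (y, y) = σ₀ y
  X_diag : ∀ y, X (y, y) = χ y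
  τ_diag : ∀ y, τ (y, y) = 0
  p_diag : ∀ y, p (y, y) = -1 / 2
  q_diag : ∀ y, q (y, y) = 1 / 2
  w_ξ : ∀ s η, |s - η| < δ → HasDerivAt (fun r => w (r, η)) (p (s, η) * σ (s, η)) s
  w_η : ∀ s η, |s - η| < δ → HasDerivAt (fun r => w (s, r)) (q (s, η) * ρ (s, η)) η
  τ_ξ : ∀ s η, |s - η| < δ → HasDerivAt (fun r => τ (r, η)) (p (s, η)) s
  τ_η : ∀ s η, |s - η| < δ → HasDerivAt (fun r => τ (s, r)) (q (s, η)) η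
  X_ξ : ∀ s η, |s - η| < δ →
    HasDerivAt (fun r => X (r, η)) (-(Real.exp (a * w (s, η)) * p (s, η))) s
  X_η : ∀ s η, |s - η| < δ →
    HasDerivAt (fun r => X (s, r)) (Real.exp (a * w (s, η)) * q (s, η)) η
  ρ_ξ : ∀ s η, |s - η| < δ → HasDerivAt (fun r => ρ (r, η))
    (p (s, η) * sourceR a (f (w (s, η))) (ρ (s, η)) (σ (s, η))) s
  ρ_η : ∀ s η, |s - η| < δ → HasDerivAt (fun r => ρ (s, r)) (ρ' (s, η)) η
  σ_η : ∀ s η, |s - η| < δ → HasDerivAt (fun r => σ (s, r))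
    (q (s, η) * sourceS a (f (w (s, η))) (ρ (s, η)) (σ (s, η))) η
  σ_ξ : ∀ s η, |s - η| < δ → HasDerivAt (fun r => σ (r, η)) (σ' (s, η)) s
  p_η : ∀ s η, |s - η| < δ → HasDerivAt (fun r => p (s, r))
    (-(a / 2) * (ρ (s, η) + σ (s, η)) * p (s, η) * q (s, η)) η
  q_ξ : ∀ s η, |s - η| < δ → HasDerivAt (fun r => q (r, η))
    (-(a / 2) * (ρ (s, η) + σ (s, η)) * p (s, η) * q (s, η)) s
  ρ_ηξ : ∀ s η, |s - η| < δ → ∃ k, HasDerivAt (fun r => ρ' (r, η)) k s ∧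
    HasDerivAt (fun r => p (s, r) * sourceR a (f (w (s, r))) (ρ (s, r)) (σ (s, r))) k η
  σ_ξη : ∀ s η, |s - η| < δ → ∃ k, HasDerivAt (fun r => σ' (s, r)) k η ∧
    HasDerivAt (fun r => q (r, η) * sourceS a (f (w (r, η))) (ρ (r, η)) (σ (r, η))) k s
  ρ'_diag : ∀ y, ρ' (y, y) = deriv ρ₀ y + 1 / 2 * sourceR a (f (w₀ y)) (ρ₀ y) (σ₀ y)
  σ'_diag : ∀ y, σ' (y, y) = deriv σ₀ y - 1 / 2 * sourceS a (f (w₀ y)) (ρ₀ y) (σ₀ y)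

/-- The right-hand side for the unknowns transported in the first variable. -/
noncomputable def fieldA (a : ℝ) (z : Fin 6 → ℝ) : Fin 5 → ℝ :=
  ![z 5 * z 4, z 5 * sourceR a (z 0) (z 2) (z 4), -(a / 2) * (z 2 + z 4) * z 5 * z 3,
    z 5, -(z 1 * z 5)]

/-- The right-hand side for the unknowns transported in the second variable. -/
noncomputable def fieldB (a : ℝ) (z : Fin 6 → ℝ) : Fin 2 → ℝ :=
  ![z 3 * sourceS a (z 0) (z 2) (z 4), -(a / 2) * (z 2 + z 4) * z 5 * z 3]

/-- The state at a point, in terms of the deviations from the data. -/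
noncomputable def stateMap (a : ℝ) (f w₀ ρ₀ σ₀ : ℝ → ℝ) (p : (ℝ × ℝ) × ((Fin 5 → ℝ) × (Fin 2 → ℝ))) :
    Fin 6 → ℝ :=
  ![f (w₀ p.1.2 + p.2.1 0), Real.exp (a * (w₀ p.1.2 + p.2.1 0)), ρ₀ p.1.2 + p.2.1 1,
    1 / 2 + p.2.1 2, σ₀ p.1.1 + p.2.2 0, -1 / 2 + p.2.2 1]

theorem contDiff_fieldA (a : ℝ) : ContDiff ℝ 1 (fieldA a) := by
  rw [contDiff_pi]
  intro i
  fin_cases i <;> simp [fieldA, sourceR] <;> fun_prop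

theorem contDiff_fieldB (a : ℝ) : ContDiff ℝ 1 (fieldB a) := by
  rw [contDiff_pi]
  intro i
  fin_cases i <;> simp [fieldB, sourceS] <;> fun_prop

theorem CharData.w_contDiff {a W B C : ℝ} {f w₀ ρ₀ σ₀ χ : ℝ → ℝ}
    (h : CharData a W B C f w₀ ρ₀ σ₀ χ) : ContDiff ℝ 1 w₀ := by
  rw [contDiff_one_iff_deriv]
  refine ⟨fun y => (h.w_deriv y).differentiableAt, ?_⟩
  rw [show deriv w₀ = fun y => (ρ₀ y - σ₀ y) / 2 from funext fun y => (h.w_deriv y).deriv]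
  have := h.ρ_contDiff.continuous
  have := h.σ_contDiff.continuous
  fun_prop

theorem contDiff_stateMap {a W B C : ℝ} {f w₀ ρ₀ σ₀ χ : ℝ → ℝ}
    (h : CharData a W B C f w₀ ρ₀ σ₀ χ) : ContDiff ℝ 1 (stateMap a f w₀ ρ₀ σ₀) := by
  have h1 := h.f_contDiff
  have h2 := h.w_contDiff
  have h3 := h.ρ_contDiff
  have h4 := h.σ_contDiff
  rw [contDiff_pi]
  intro i
  fin_cases i <;> simp [stateMap] <;> fun_prop

theorem exists_lipschitzOnWith_closedBall {E F : Type*} [NormedAddCommGroup E] [NormedSpace ℝ E]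
    [ProperSpace E] [NormedAddCommGroup F] [NormedSpace ℝ F] {Γ : E → F} (hΓ : ContDiff ℝ 1 Γ)
    (R : ℝ) : ∃ K : ℝ≥0, LipschitzOnWith K Γ (Metric.closedBall 0 R) ∧
      ∀ z ∈ Metric.closedBall 0 R, ‖Γ z‖ ≤ K := by
  have hc : IsCompact (Metric.closedBall (0 : E) R) := isCompact_closedBall 0 R
  obtain ⟨K₁, hK₁⟩ := hc.exists_bound_of_continuousOn
    (hΓ.continuous_fderiv one_ne_zero).continuousOn
  obtain ⟨K₂, hK₂⟩ := hc.exists_bound_of_continuousOn hΓ.continuous.continuousOn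
  refine ⟨(max K₁ K₂).toNNReal, ?_, fun z hz => ((hK₂ z hz).trans (le_max_right _ _)).trans
    (Real.le_coe_toNNReal _)⟩
  refine (convex_closedBall _ _).lipschitzOnWith_of_nnnorm_fderiv_le (𝕜 := ℝ)
    (fun z _ => hΓ.differentiable one_ne_zero z) fun z hz => ?_
  rw [← NNReal.coe_le_coe, coe_nnnorm]
  exact ((hK₁ z hz).trans (le_max_left _ _)).trans (Real.le_coe_toNNReal _)

/-- Stated on a half-line because f and exp(a ·) are controlled only for w bounded above: w tends to
-∞ where u degenerates. -/
theorem abs_sub_le_of_abs_deriv_le {φ φ' : ℝ → ℝ} {C W : ℝ}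
    (h : ∀ x ≤ W, HasDerivAt φ (φ' x) x) (hC : ∀ x ≤ W, |φ' x| ≤ C) {x y : ℝ} (hx : x ≤ W)
    (hy : y ≤ W) : |φ x - φ y| ≤ C * |x - y| :=
  (convex_Iic W).norm_image_sub_le_of_norm_hasDerivWithin_le
    (fun z hz => (h z hz).hasDerivWithinAt) (fun z hz => hC z hz) hy hx

theorem abs_sub_le_of_abs_deriv_le_univ {φ φ' : ℝ → ℝ} {C : ℝ}
    (h : ∀ x, HasDerivAt φ (φ' x) x) (hC : ∀ x, |φ' x| ≤ C) (x y : ℝ) :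
    |φ x - φ y| ≤ C * |x - y| :=
  convex_univ.norm_image_sub_le_of_norm_hasDerivWithin_le
    (fun z _ => (h z).hasDerivWithinAt) (fun z _ => hC z) (mem_univ y) (mem_univ x)

/-- Bounds for the state, uniform in the data. -/
theorem exists_stateMap_bounds {a W B C : ℝ} (ha : 0 ≤ a) (hB : 0 ≤ B) (hC : 0 ≤ C) :
    ∃ (R : ℝ) (L : ℝ≥0), ∀ f w₀ ρ₀ σ₀ χ : ℝ → ℝ, CharData a W B C f w₀ ρ₀ σ₀ χ →
      MapsTo (stateMap a f w₀ ρ₀ σ₀) {p | ‖p.2‖ ≤ 1} (Metric.closedBall 0 R) ∧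
      LipschitzOnWith L (stateMap a f w₀ ρ₀ σ₀) {p | ‖p.2‖ ≤ 1} := by
  set e := Real.exp (a * (W + 1)) with he
  have he0 : 0 < e := Real.exp_pos _
  -- The radius exceeds each of the component bounds C, e, B + 1 and 2. The inner sums, such as w₀ +
  -- z, are (B + 1)-Lipschitz, and composing them with f or exp(a ·) multiplies this by C or a e.
  refine ⟨C + e + B + 2, ⟨(1 + C + a * e) * (B + 1), by positivity⟩,
    fun f w₀ ρ₀ σ₀ χ h => ⟨fun p hp => ?_, LipschitzOnWith.of_dist_le_mul fun p hp q hq => ?_⟩⟩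
  · have hp1 : ∀ i, |p.2.1 i| ≤ 1 := fun i =>
      (norm_le_pi_norm p.2.1 i).trans ((norm_fst_le p.2).trans hp)
    have hp2 : ∀ i, |p.2.2 i| ≤ 1 := fun i =>
      (norm_le_pi_norm p.2.2 i).trans ((norm_snd_le p.2).trans hp)
    have hw : w₀ p.1.2 + p.2.1 0 ≤ W + 1 :=
      add_le_add (h.w_le _) ((le_abs_self _).trans (hp1 0))
    have hadd : ∀ x y A : ℝ, |x| ≤ A → |y| ≤ 1 → |x + y| ≤ A + 1 := fun x y A hx hy =>
      (abs_add_le x y).trans (add_le_add hx hy)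
    rw [mem_closedBall_zero_iff, pi_norm_le_iff_of_nonneg (by positivity)]
    intro i
    have hhalf : |(1 / 2 : ℝ)| ≤ 1 := by norm_num [abs_le]
    have hhalf' : |(-1 / 2 : ℝ)| ≤ 1 := by norm_num [abs_le]
    fin_cases i <;> simp only [stateMap, Fin.isValue, Fin.zero_eta, Fin.mk_one, Fin.reduceFinMk,
      Matrix.cons_val, Matrix.cons_val_zero, Matrix.cons_val_one, Real.norm_eq_abs]
    · linarith [h.f_le _ hw]
    · rw [abs_of_pos (Real.exp_pos _)]
      have : Real.exp (a * (w₀ p.1.2 + p.2.1 0)) ≤ e := by rw [he]; gcongr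
      linarith
    · linarith [hadd _ _ B (h.ρ_le p.1.2) (hp1 1)]
    · linarith [hadd _ _ 1 hhalf (hp1 2)]
    · linarith [hadd _ _ B (h.σ_le p.1.1) (hp2 0)]
    · linarith [hadd _ _ 1 hhalf' (hp2 1)]
  · have hp1 : |p.2.1 0| ≤ 1 := (norm_le_pi_norm p.2.1 0).trans ((norm_fst_le p.2).trans hp)
    have hq1 : |q.2.1 0| ≤ 1 := (norm_le_pi_norm q.2.1 0).trans ((norm_fst_le q.2).trans hq)
    have hwp : w₀ p.1.2 + p.2.1 0 ≤ W + 1 := add_le_add (h.w_le _) ((le_abs_self _).trans hp1)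
    have hwq : w₀ q.1.2 + q.2.1 0 ≤ W + 1 := add_le_add (h.w_le _) ((le_abs_self _).trans hq1)
    set d := dist p q with hd
    have hd0 : 0 ≤ d := dist_nonneg
    have hdd : d = max (max |p.1.1 - q.1.1| |p.1.2 - q.1.2|) (max (dist p.2.1 q.2.1)
      (dist p.2.2 q.2.2)) := rfl
    have d1 : |p.1.1 - q.1.1| ≤ d := by rw [hdd]; simp
    have d2 : |p.1.2 - q.1.2| ≤ d := by rw [hdd]; simp
    have d3 : ∀ i, |p.2.1 i - q.2.1 i| ≤ d := fun i =>
      (dist_le_pi_dist p.2.1 q.2.1 i).trans (by rw [hdd]; simp)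
    have d4 : ∀ i, |p.2.2 i - q.2.2 i| ≤ d := fun i =>
      (dist_le_pi_dist p.2.2 q.2.2 i).trans (by rw [hdd]; simp)
    have key : ∀ (φ : ℝ → ℝ) (x x' y y' : ℝ), |φ x - φ x'| ≤ B * |x - x'| → |x - x'| ≤ d →
        |y - y'| ≤ d → |(φ x + y) - (φ x' + y')| ≤ (B + 1) * d := by
      intro φ x x' y y' h1 h2 h3
      calc |(φ x + y) - (φ x' + y')| = |(φ x - φ x') + (y - y')| := by congr 1; ring
        _ ≤ |φ x - φ x'| + |y - y'| := abs_add_le _ _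
        _ ≤ B * d + d := add_le_add (h1.trans (by gcongr)) h3
        _ = _ := by ring
    have hLw : |(w₀ p.1.2 + p.2.1 0) - (w₀ q.1.2 + q.2.1 0)| ≤ (B + 1) * d := by
      refine key w₀ _ _ _ _ (abs_sub_le_of_abs_deriv_le_univ h.w_deriv (fun y => ?_) _ _) d2 (d3 0)
      have b1 := abs_le.1 (h.ρ_le y)
      have b2 := abs_le.1 (h.σ_le y)
      rw [abs_le]; constructor <;> linarith
    have hρL := abs_sub_le_of_abs_deriv_le_univ
      (fun y => (h.ρ_contDiff.differentiable one_ne_zero y).hasDerivAt) h.ρ_deriv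
    have hσL := abs_sub_le_of_abs_deriv_le_univ
      (fun y => (h.σ_contDiff.differentiable one_ne_zero y).hasDerivAt) h.σ_deriv
    have hone : (B + 1) * d ≤ (1 + C + a * e) * (B + 1) * d := by
      have : 0 ≤ (C + a * e) * (B + 1) * d := by positivity
      linarith
    have hdone : d ≤ (B + 1) * d := by nlinarith
    change dist _ _ ≤ (1 + C + a * e) * (B + 1) * d
    rw [dist_pi_le_iff (by positivity)]
    intro i
    rw [Real.dist_eq]
    fin_cases i <;> simp only [stateMap, Fin.isValue, Fin.zero_eta, Fin.mk_one, Fin.reduceFinMk,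
      Matrix.cons_val, Matrix.cons_val_zero, Matrix.cons_val_one]
    · refine (abs_sub_le_of_abs_deriv_le
        (fun w _ => (h.f_contDiff.differentiable one_ne_zero w).hasDerivAt) h.f_deriv
        hwp hwq).trans ?_
      have : 0 ≤ (1 + a * e) * ((B + 1) * d) := by positivity
      have := mul_le_mul_of_nonneg_left hLw hC
      linarith
    · have hex : ∀ x ≤ W + 1, |Real.exp (a * x) * (a * 1)| ≤ a * e := fun x hx => by
        rw [abs_of_nonneg (by positivity), mul_one, mul_comm]
        have : Real.exp (a * x) ≤ e := by rw [he]; gcongr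
        gcongr
      refine (abs_sub_le_of_abs_deriv_le (φ := fun x => Real.exp (a * x))
        (fun x _ => ((hasDerivAt_id x).const_mul a).exp) hex hwp hwq).trans ?_
      have : 0 ≤ (1 + C) * ((B + 1) * d) := by positivity
      have := mul_le_mul_of_nonneg_left hLw (by positivity : 0 ≤ a * e)
      linarith
    · exact (key ρ₀ _ _ _ _ (hρL _ _) d2 (d3 1)).trans hone
    · rw [add_sub_add_left_eq_sub]; exact ((d3 2).trans hdone).trans hone
    · exact (key σ₀ _ _ _ _ (hσL _ _) d1 (d4 0)).trans hone
    · rw [add_sub_add_left_eq_sub]; exact ((d4 1).trans hdone).trans hone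

/-- Used to identify transversal derivatives: both candidates agree on the diagonal, and their
derivatives along the ray agree by equality of cross derivatives. -/
theorem eq_of_hasDerivAt_eq {δ η : ℝ} {φ ψ : ℝ → ℝ}
    (h : ∀ s, |s - η| < δ → ∃ k, HasDerivAt φ k s ∧ HasDerivAt ψ k s) (h0 : φ η = ψ η) {s : ℝ}
    (hs : |s - η| < δ) : φ s = ψ s := by
  have hb : ∀ r ∈ uIcc η s, |r - η| < δ := fun r hr => (abs_sub_left_of_mem_uIcc hr).trans_lt hs
  have := (convex_uIcc η s).norm_image_sub_le_of_norm_hasDerivWithin_le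
    (f := fun r => φ r - ψ r) (f' := fun _ => 0) (C := 0) (x := η) (y := s)
    (fun r hr => by
      obtain ⟨k, h1, h2⟩ := h r (hb r hr)
      exact ((h1.sub h2).congr_deriv (sub_self k)).hasDerivWithinAt)
    (by simp) left_mem_uIcc right_mem_uIcc
  rw [zero_mul, norm_le_zero_iff, h0, sub_self, sub_zero] at this
  linarith

/-- The width δ₀ is chosen before the data and depends on a, W, B, C only. This is what makes the
final existence time uniform. -/
theorem exists_isCharSolution {a W B C : ℝ} (ha : 0 ≤ a) (hB : 0 ≤ B) (hC : 0 ≤ C) :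
    ∃ δ₀ > 0, ∀ δ, 0 < δ → δ ≤ δ₀ → ∀ f w₀ ρ₀ σ₀ χ : ℝ → ℝ, CharData a W B C f w₀ ρ₀ σ₀ χ →
      ∃ w ρ σ τ X p q ρ' σ', IsCharSolution a δ f w₀ ρ₀ σ₀ χ w ρ σ τ X p q ρ' σ' := by
  obtain ⟨R, L, hRL⟩ := exists_stateMap_bounds (a := a) (W := W) (B := B) (C := C) ha hB hC
  obtain ⟨K₁, hK₁, hK₁'⟩ := exists_lipschitzOnWith_closedBall (contDiff_fieldA a) R
  obtain ⟨K₂, hK₂, hK₂'⟩ := exists_lipschitzOnWith_closedBall (contDiff_fieldB a) R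
  -- M has to dominate both the sup bound max K₁ K₂ of the fields and the Lipschitz constant max K₁
  -- K₂ * L of their compositions with the state; the summand 1 makes it positive.
  set M : ℝ≥0 := max K₁ K₂ * (1 + L) + 1 with hM
  have hM0 : 0 < M := by positivity
  have hKM : max K₁ K₂ ≤ M := by
    calc max K₁ K₂ ≤ max K₁ K₂ * (1 + L) := le_mul_of_one_le_right' (by simp)
      _ ≤ M := by rw [hM]; exact le_self_add
  have hKLM : max K₁ K₂ * L ≤ M := by
    calc max K₁ K₂ * L ≤ max K₁ K₂ * (1 + L) := by gcongr; exact le_add_self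
      _ ≤ M := by rw [hM]; exact le_self_add
  refine ⟨1 / (4 * M), by positivity, fun δ hδ hδ₀ f w₀ ρ₀ σ₀ χ h => ?_⟩
  obtain ⟨hmap, hlip⟩ := hRL f w₀ ρ₀ σ₀ χ h
  set Φ := stateMap a f w₀ ρ₀ σ₀ with hΦ
  have hΦc : ContDiff ℝ 1 Φ := contDiff_stateMap h
  have hδM : δ * M ≤ 1 / 4 := by
    calc δ * M ≤ 1 / (4 * M) * M := by gcongr
      _ = 1 / 4 := by
        have : (M : ℝ) ≠ 0 := by exact_mod_cast hM0.ne'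
        field_simp
  obtain ⟨A, V, D, U, hA, hV, hD, hU, hA4, hD4, hA0, hD0, hV0, hU0, hd, hVk, hUk⟩ :=
    exists_characteristic_solution hδ hδM
    (G := fun p => fieldA a (Φ p)) (H := fun p => fieldB a (Φ p))
    ((contDiff_fieldA a).comp hΦc) ((contDiff_fieldB a).comp hΦc)
    (fun P z hz => (hK₁' _ (hmap (x := (P, z)) hz)).trans
      (by exact_mod_cast (le_max_left _ _).trans hKM))
    (fun P z hz => (hK₂' _ (hmap (x := (P, z)) hz)).trans
      (by exact_mod_cast (le_max_right _ _).trans hKM))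
    ((hK₁.comp hlip hmap).weaken ((mul_le_mul_left (le_max_left _ _) _).trans hKLM))
    ((hK₂.comp hlip hmap).weaken ((mul_le_mul_left (le_max_right _ _) _).trans hKLM))
  have hA4' : ∀ P i, |A P i| ≤ 1 / 4 := fun P i => (norm_le_pi_norm (A P) i).trans (hA4 P)
  have hD4' : ∀ P i, |D P i| ≤ 1 / 4 := fun P i => (norm_le_pi_norm (D P) i).trans (hD4 P)
  have hw0d := h.w_deriv
  have hρ0d : ∀ y, HasDerivAt ρ₀ (deriv ρ₀ y) y := fun y =>
    (h.ρ_contDiff.differentiable one_ne_zero y).hasDerivAt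
  have hσ0d : ∀ y, HasDerivAt σ₀ (deriv σ₀ y) y := fun y =>
    (h.σ_contDiff.differentiable one_ne_zero y).hasDerivAt
  have hw0c : Continuous w₀ := h.w_contDiff.continuous
  have hρ0c : Continuous ρ₀ := h.ρ_contDiff.continuous
  have hσ0c : Continuous σ₀ := h.σ_contDiff.continuous
  have hρ0c' : Continuous (deriv ρ₀) := h.ρ_contDiff.continuous_deriv_one
  have hσ0c' : Continuous (deriv σ₀) := h.σ_contDiff.continuous_deriv_one
  have hχc : Continuous χ := continuous_iff_continuousAt.2 fun y => (h.χ_deriv y).continuousAt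
  -- The components of A are the deviations of w, ρ, q, τ, X from their data, those of D the
  -- deviations of σ and p.
  set w : ℝ × ℝ → ℝ := fun P => w₀ P.2 + A P 0 with hw
  set ρ : ℝ × ℝ → ℝ := fun P => ρ₀ P.2 + A P 1 with hρ
  set q : ℝ × ℝ → ℝ := fun P => 1 / 2 + A P 2 with hq
  set σ : ℝ × ℝ → ℝ := fun P => σ₀ P.1 + D P 0 with hσ
  set p : ℝ × ℝ → ℝ := fun P => -1 / 2 + D P 1 with hp
  have hst : ∀ P, Φ (P, (A P, D P)) = ![f (w P), Real.exp (a * w P), ρ P, q P, σ P, p P] :=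
    fun P => rfl
  have hGA : ∀ P, fieldA a (Φ (P, (A P, D P))) = ![p P * σ P,
      p P * sourceR a (f (w P)) (ρ P) (σ P), -(a / 2) * (ρ P + σ P) * p P * q P,
      p P, -(Real.exp (a * w P) * p P)] := fun P => by rw [hst]; rfl
  have hGB : ∀ P, fieldB a (Φ (P, (A P, D P))) = ![q P * sourceS a (f (w P)) (ρ P) (σ P),
      -(a / 2) * (ρ P + σ P) * p P * q P] := fun P => by rw [hst]; rfl
  have hAξ : ∀ s η, |s - η| < δ → ∀ i, HasDerivAt (fun r => A (r, η) i)
      (fieldA a (Φ ((s, η), (A (s, η), D (s, η)))) i) s := fun s η hs i =>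
    hasDerivAt_pi.1 (hd s η hs).1 i
  have hAη : ∀ s η, |s - η| < δ → ∀ i, HasDerivAt (fun r => A (s, r) i) (V (s, η) i) η :=
    fun s η hs i => hasDerivAt_pi.1 (hd s η hs).2.1 i
  have hDη : ∀ s η, |s - η| < δ → ∀ i, HasDerivAt (fun r => D (s, r) i)
      (fieldB a (Φ ((s, η), (A (s, η), D (s, η)))) i) η := fun s η hs i =>
    hasDerivAt_pi.1 (hd s η hs).2.2.1 i
  have hDξ : ∀ s η, |s - η| < δ → ∀ i, HasDerivAt (fun r => D (r, η) i) (U (s, η) i) s :=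
    fun s η hs i => hasDerivAt_pi.1 (hd s η hs).2.2.2 i
  simp only [hGA] at hAξ
  simp only [hGB] at hDη
  have hVk' : ∀ s η, |s - η| < δ → ∀ i, ∃ k, HasDerivAt (fun r => V (r, η) i) k s ∧
      HasDerivAt (fun r => fieldA a (Φ ((s, r), (A (s, r), D (s, r)))) i) k η :=
    fun s η hs i => by
      obtain ⟨k, h1, h2⟩ := hVk s η hs
      exact ⟨k i, hasDerivAt_pi.1 h1 i, hasDerivAt_pi.1 h2 i⟩
  have hUk' : ∀ s η, |s - η| < δ → ∀ i, ∃ k, HasDerivAt (fun r => U (s, r) i) k η ∧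
      HasDerivAt (fun r => fieldB a (Φ ((r, η), (A (r, η), D (r, η)))) i) k s :=
    fun s η hs i => by
      obtain ⟨k, h1, h2⟩ := hUk s η hs
      exact ⟨k i, hasDerivAt_pi.1 h1 i, hasDerivAt_pi.1 h2 i⟩
  simp only [hGA] at hVk'
  simp only [hGB] at hUk'
  have w_diag : ∀ y, w (y, y) = w₀ y := fun y => by simp [hw, hA0]
  have ρ_diag : ∀ y, ρ (y, y) = ρ₀ y := fun y => by simp [hρ, hA0]
  have σ_diag : ∀ y, σ (y, y) = σ₀ y := fun y => by simp [hσ, hD0]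
  have p_diag : ∀ y, p (y, y) = -1 / 2 := fun y => by simp [hp, hD0]
  have q_diag : ∀ y, q (y, y) = 1 / 2 := fun y => by simp [hq, hA0]
  have hV0' : ∀ y i, V (y, y) i = - (![p (y, y) * σ (y, y),
      p (y, y) * sourceR a (f (w (y, y))) (ρ (y, y)) (σ (y, y)),
      -(a / 2) * (ρ (y, y) + σ (y, y)) * p (y, y) * q (y, y),
      p (y, y), -(Real.exp (a * w (y, y)) * p (y, y))] : Fin 5 → ℝ) i := fun y i => by
    rw [← hGA, hA0, hD0, hV0]; rfl
  have hU0' : ∀ y i, U (y, y) i = - (![q (y, y) * sourceS a (f (w (y, y))) (ρ (y, y)) (σ (y, y)),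
      -(a / 2) * (ρ (y, y) + σ (y, y)) * p (y, y) * q (y, y)] : Fin 2 → ℝ) i := fun y i => by
    rw [← hGB, hA0, hD0, hU0]; rfl
  simp only [w_diag, ρ_diag, σ_diag, p_diag, q_diag] at hV0' hU0'
  -- derivatives in the direction of transport
  have w_ξ : ∀ s η, |s - η| < δ → HasDerivAt (fun r => w (r, η)) (p (s, η) * σ (s, η)) s :=
    fun s η hs => (hAξ s η hs 0).const_add (w₀ η)
  have ρ_ξ : ∀ s η, |s - η| < δ → HasDerivAt (fun r => ρ (r, η))
      (p (s, η) * sourceR a (f (w (s, η))) (ρ (s, η)) (σ (s, η))) s :=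
    fun s η hs => (hAξ s η hs 1).const_add (ρ₀ η)
  have q_ξ : ∀ s η, |s - η| < δ → HasDerivAt (fun r => q (r, η))
      (-(a / 2) * (ρ (s, η) + σ (s, η)) * p (s, η) * q (s, η)) s :=
    fun s η hs => (hAξ s η hs 2).const_add (1 / 2)
  have τ_ξ : ∀ s η, |s - η| < δ → HasDerivAt (fun r => A (r, η) 3) (p (s, η)) s :=
    fun s η hs => hAξ s η hs 3
  have X_ξ : ∀ s η, |s - η| < δ → HasDerivAt (fun r => χ η + A (r, η) 4)
      (-(Real.exp (a * w (s, η)) * p (s, η))) s :=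
    fun s η hs => (hAξ s η hs 4).const_add (χ η)
  have σ_η : ∀ s η, |s - η| < δ → HasDerivAt (fun r => σ (s, r))
      (q (s, η) * sourceS a (f (w (s, η))) (ρ (s, η)) (σ (s, η))) η :=
    fun s η hs => (hDη s η hs 0).const_add (σ₀ s)
  have p_η : ∀ s η, |s - η| < δ → HasDerivAt (fun r => p (s, r))
      (-(a / 2) * (ρ (s, η) + σ (s, η)) * p (s, η) * q (s, η)) η :=
    fun s η hs => (hDη s η hs 1).const_add (-1 / 2)
  -- transversal derivatives
  have hwV : ∀ s η, |s - η| < δ →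
      (ρ₀ η - σ₀ η) / 2 + V (s, η) 0 = q (s, η) * ρ (s, η) := by
    intro s η hs
    -- The cross derivatives (pσ)_η and (qρ)_ξ agree: the difference of the two sources, (a/2)(ρ -
    -- σ)(ρ + σ), is balanced by p_η = q_ξ = -(a/2)(ρ + σ)pq.
    refine eq_of_hasDerivAt_eq (φ := fun s => (ρ₀ η - σ₀ η) / 2 + V (s, η) 0)
      (ψ := fun s => q (s, η) * ρ (s, η)) (fun s hs => ?_) ?_ hs
    · obtain ⟨k, h1, h2⟩ := hVk' s η hs 0
      refine ⟨k, h1.const_add _, ?_⟩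
      have h3 := h2.unique ((p_η s η hs).mul (σ_η s η hs))
      refine ((q_ξ s η hs).mul (ρ_ξ s η hs)).congr_deriv ?_
      rw [h3]
      simp only [sourceR, sourceS]
      ring
    · simp only [hV0', q_diag, ρ_diag, Matrix.cons_val_zero]
      ring
  have w_η : ∀ s η, |s - η| < δ → HasDerivAt (fun r => w (s, r)) (q (s, η) * ρ (s, η)) η :=
    fun s η hs => ((hw0d η).add (hAη s η hs 0)).congr_deriv (hwV s η hs)
  have hτV : ∀ s η, |s - η| < δ → V (s, η) 3 = q (s, η) := by
    intro s η hs
    refine eq_of_hasDerivAt_eq (φ := fun s => V (s, η) 3)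
      (ψ := fun s => q (s, η)) (fun s hs => ?_) ?_ hs
    · obtain ⟨k, h1, h2⟩ := hVk' s η hs 3
      refine ⟨k, h1, ?_⟩
      have h3 := h2.unique (p_η s η hs)
      rw [h3]
      exact q_ξ s η hs
    · simp only [hV0', q_diag]
      simp
      norm_num
  have hXV : ∀ s η, |s - η| < δ →
      Real.exp (a * w₀ η) + V (s, η) 4 = Real.exp (a * w (s, η)) * q (s, η) := by
    intro s η hs
    refine eq_of_hasDerivAt_eq (φ := fun s => Real.exp (a * w₀ η) + V (s, η) 4)
      (ψ := fun s => Real.exp (a * w (s, η)) * q (s, η)) (fun s hs => ?_) ?_ hs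
    · obtain ⟨k, h1, h2⟩ := hVk' s η hs 4
      refine ⟨k, h1.const_add _, ?_⟩
      have h3 := h2.unique ((((w_η s η hs).const_mul a).exp.mul (p_η s η hs)).neg)
      refine (((w_ξ s η hs).const_mul a).exp.mul (q_ξ s η hs)).congr_deriv ?_
      rw [h3]
      ring
    · simp only [hV0', q_diag, w_diag]
      simp
      ring
  refine ⟨w, ρ, σ, fun P => A P 3, fun P => χ P.2 + A P 4, p, q,
    fun P => deriv ρ₀ P.2 + V P 1, fun P => deriv σ₀ P.1 + U P 0, ?_⟩
  exact {
    cont_w := by fun_prop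
    cont_ρ := by fun_prop
    cont_σ := by fun_prop
    cont_X := by fun_prop
    cont_τ := by fun_prop
    cont_p := by fun_prop
    cont_q := by fun_prop
    cont_ρ' := by fun_prop
    cont_σ' := by fun_prop
    w_near := fun s η => by simpa [hw] using hA4' (s, η) 0
    ρ_near := fun s η => by simpa [hρ] using hA4' (s, η) 1
    σ_near := fun s η => by simpa [hσ] using hD4' (s, η) 0
    X_near := fun s η => by simpa using hA4' (s, η) 4
    p_near := fun s η => by
      have : p (s, η) + 1 / 2 = D (s, η) 1 := by simp only [hp]; ring
      rw [this]; exact hD4' (s, η) 1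
    q_near := fun s η => by simpa [hq] using hA4' (s, η) 2
    w_diag := w_diag
    ρ_diag := ρ_diag
    σ_diag := σ_diag
    X_diag := fun y => by simp [hA0]
    τ_diag := fun y => by simp [hA0]
    p_diag := p_diag
    q_diag := q_diag
    w_ξ := w_ξ
    w_η := w_η
    τ_ξ := τ_ξ
    τ_η := fun s η hs => (hAη s η hs 3).congr_deriv (hτV s η hs)
    X_ξ := X_ξ
    X_η := fun s η hs => ((h.χ_deriv η).add (hAη s η hs 4)).congr_deriv (hXV s η hs)
    ρ_ξ := ρ_ξ
    ρ_η := fun s η hs => (hρ0d η).add (hAη s η hs 1)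
    σ_η := σ_η
    σ_ξ := fun s η hs => (hσ0d s).add (hDξ s η hs 0)
    p_η := p_η
    q_ξ := q_ξ
    ρ_ηξ := fun s η hs => by
      obtain ⟨k, h1, h2⟩ := hVk' s η hs 1
      exact ⟨k, h1.const_add (deriv ρ₀ η), h2⟩
    σ_ξη := fun s η hs => by
      obtain ⟨k, h1, h2⟩ := hUk' s η hs 0
      exact ⟨k, h1.const_add (deriv σ₀ s), h2⟩
    ρ'_diag := fun y => by
      simp only [hV0']
      simp
      ring
    σ'_diag := fun y => by
      simp only [hU0']
      simp
      ring }

/-! ### A priori estimates on the domain of dependence -/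

theorem abs_mul_le_mul {x y X Y : ℝ} (hx : |x| ≤ X) (hy : |y| ≤ Y) : |x * y| ≤ X * Y := by
  rw [abs_mul]; exact mul_le_mul hx hy (abs_nonneg _) ((abs_nonneg _).trans hx)

theorem abs_add_le_add {x y X Y : ℝ} (hx : |x| ≤ X) (hy : |y| ≤ Y) : |x + y| ≤ X + Y :=
  (abs_add_le x y).trans (add_le_add hx hy)

theorem abs_sub_le_add {x y X Y : ℝ} (hx : |x| ≤ X) (hy : |y| ≤ Y) : |x - y| ≤ X + Y :=
  (abs_sub x y).trans (add_le_add hx hy)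

/-- Exchanging the two Riemann invariants amounts to changing the sign of F, so every estimate is
needed for one of them only. -/
theorem sourceS_eq (a f ρ σ : ℝ) : sourceS a f ρ σ = sourceR a (-f) σ ρ := by
  unfold sourceS sourceR; ring

/-- The constant in the linear bound for the sources. -/
def sourceConst (a B C : ℝ) : ℝ := (a + 1) * (B + 1) + 2 * C

/-- Although the source is quadratic, one factor of each product is estimated by B + 1. The bound is
thus linear in m, as needed to propagate decaying weights. -/
theorem abs_sourceR_le {a B C m f ρ σ : ℝ} (ha : 0 ≤ a) (hf : |f| ≤ C) (hρ : |ρ| ≤ B + 1)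
    (hρm : |ρ| ≤ m) (hσm : |σ| ≤ m) : |sourceR a f ρ σ| ≤ sourceConst a B C * m := by
  have h2 : |a / 2| ≤ a / 2 := (abs_of_nonneg (by positivity)).le
  have hd := abs_sub_le_add hρm hσm
  refine (abs_sub_le_add (abs_add_le_add (abs_mul_le_mul (abs_mul_le_mul h2 hd) hρ)
    (abs_mul_le_mul hf hd)) (abs_mul_le_mul hρ hσm)).trans_eq ?_
  unfold sourceConst; ring

theorem abs_sourceS_le {a B C m f ρ σ : ℝ} (ha : 0 ≤ a) (hf : |f| ≤ C) (hσ : |σ| ≤ B + 1)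
    (hρm : |ρ| ≤ m) (hσm : |σ| ≤ m) : |sourceS a f ρ σ| ≤ sourceConst a B C * m := by
  rw [sourceS_eq]
  exact abs_sourceR_le ha (by rwa [abs_neg]) hσ hσm hρm

/-- Here σ' is the derivative of σ along its own characteristic, hence already controlled by the
equation. The only unknown derivative is ρ', which enters linearly, so the estimate is ready for
Gronwall. -/
theorem abs_deriv_mul_sourceR_le {a B C m y k : ℝ} {P f ρ σ : ℝ → ℝ} {P' f' ρ' σ' : ℝ}
    (ha : 0 ≤ a) (hB : 0 ≤ B) (hC : 0 ≤ C)
    (hP : HasDerivAt P P' y) (hf : HasDerivAt f f' y) (hρ : HasDerivAt ρ ρ' y)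
    (hσ : HasDerivAt σ σ' y) (hk : HasDerivAt (fun r => P r * sourceR a (f r) (ρ r) (σ r)) k y)
    (bP : |P y| ≤ 1) (bP' : |P'| ≤ a * (B + 1)) (bf : |f y| ≤ C) (bf' : |f'| ≤ C * m)
    (bρ : |ρ y| ≤ B + 1) (bσ : |σ y| ≤ B + 1) (bρm : |ρ y| ≤ m) (bσm : |σ y| ≤ m)
    (bσ' : |σ'| ≤ sourceConst a B C * m) :
    |k| ≤ 2 * sourceConst a B C * |ρ'| + 3 * sourceConst a B C ^ 2 * m := by
  have hm : 0 ≤ m := (abs_nonneg _).trans bρm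
  have hsrc := (((((hρ.sub hσ).const_mul (a / 2)).mul hρ).add (hf.mul (hρ.sub hσ))).sub
    (hρ.mul hσ))
  have hk' := hk.unique (hP.mul hsrc)
  set κ := sourceConst a B C with hκ
  have hκ' : κ = (a + 1) * (B + 1) + 2 * C := hκ
  have bS : |sourceR a (f y) (ρ y) (σ y)| ≤ κ * m := abs_sourceR_le ha bf bρ bρm bσm
  have h2 : |a / 2| ≤ a / 2 := (abs_of_nonneg (by positivity)).le
  have hkb : |k| ≤ a * (B + 1) * (κ * m) + 1 * ((a / 2 * (|ρ'| + κ * m) * (B + 1) +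
      a / 2 * (B + 1 + (B + 1)) * |ρ'| + (C * m * (B + 1 + (B + 1)) + C * (|ρ'| + κ * m))) +
      (|ρ'| * (B + 1) + (B + 1) * (κ * m))) := by
    rw [hk']
    exact abs_add_le_add (abs_mul_le_mul bP' bS) (abs_mul_le_mul bP (abs_sub_le_add
      (abs_add_le_add (abs_add_le_add
        (abs_mul_le_mul (abs_mul_le_mul h2 (abs_sub_le_add le_rfl bσ')) bρ)
        (abs_mul_le_mul (abs_mul_le_mul h2 (abs_sub_le_add bρ bσ)) le_rfl))
        (abs_add_le_add (abs_mul_le_mul bf' (abs_sub_le_add bρ bσ))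
          (abs_mul_le_mul bf (abs_sub_le_add le_rfl bσ'))))
      (abs_add_le_add (abs_mul_le_mul le_rfl bσ) (abs_mul_le_mul bρ bσ'))))
  have hρ0 : 0 ≤ |ρ'| := abs_nonneg _
  have hb : 0 ≤ B + 1 := by positivity
  have hκ0 : 0 ≤ κ := by rw [hκ']; positivity
  have e1 : a / 2 * (B + 1) + a * (B + 1) + C + (B + 1) ≤ 2 * κ := by
    have : 0 ≤ a * (B + 1) := by positivity
    rw [hκ']; linarith
  have e2 : C * (B + 1 + (B + 1)) ≤ κ * κ := by
    have h1 : B + 1 ≤ κ := by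
      have : 0 ≤ a * (B + 1) := by positivity
      rw [hκ']; linarith
    have h3 : 2 * C ≤ κ := by
      have : 0 ≤ (a + 1) * (B + 1) := by positivity
      rw [hκ']; linarith
    calc C * (B + 1 + (B + 1)) = 2 * C * (B + 1) := by ring
      _ ≤ κ * κ := mul_le_mul h3 h1 hb hκ0
  have e3 : a * (B + 1) + a / 2 * (B + 1) + C + (B + 1) ≤ 2 * κ := by linarith
  calc |k| ≤ _ := hkb
    _ = (a / 2 * (B + 1) + a * (B + 1) + C + (B + 1)) * |ρ'| +
        ((a * (B + 1) + a / 2 * (B + 1) + C + (B + 1)) * κ + C * (B + 1 + (B + 1))) * m := by ring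
    _ ≤ 2 * κ * |ρ'| + (2 * κ * κ + κ * κ) * m := by gcongr
    _ = _ := by ring

/-- A Gronwall type bound on an interval of small length. -/
theorem abs_le_of_abs_deriv_le_linear {g g' : ℝ → ℝ} {y s δ c₁ c₂ : ℝ}
    (hg : Continuous g) (hd : ∀ r ∈ uIcc y s, HasDerivAt g (g' r) r)
    (hb : ∀ r ∈ uIcc y s, |g' r| ≤ c₁ * |g r| + c₂) (hc₁ : 0 ≤ c₁) (hs : |s - y| ≤ δ)
    (hδ : δ * c₁ ≤ 1 / 2) (hc₂ : 0 ≤ c₂) : |g s| ≤ 2 * |g y| + 2 * (δ * c₂) := by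
  obtain ⟨z, hz, hmax⟩ := isCompact_uIcc.exists_isMaxOn ⟨y, left_mem_uIcc⟩
    (hg.abs.continuousOn (s := uIcc y s))
  have hm : ∀ r ∈ uIcc y s, |g r| ≤ |g z| := fun r hr => hmax hr
  have hmv := (convex_uIcc y s).norm_image_sub_le_of_norm_hasDerivWithin_le
    (f := g) (C := c₁ * |g z| + c₂) (fun r hr => (hd r hr).hasDerivWithinAt)
    (fun r hr => (hb r hr).trans (by have := hm r hr; gcongr)) left_mem_uIcc hz
  have h1 : |g z| ≤ |g y| + (c₁ * |g z| + c₂) * δ := by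
    calc |g z| = |g y + (g z - g y)| := by rw [add_sub_cancel]
      _ ≤ |g y| + |g z - g y| := abs_add_le _ _
      _ ≤ _ := by
        gcongr
        refine hmv.trans ?_
        gcongr
        exact (abs_sub_left_of_mem_uIcc hz).trans hs
  have h2 := hm s right_mem_uIcc
  have h3 : δ * c₁ * |g z| ≤ 1 / 2 * |g z| := by gcongr
  linarith

section Estimates

variable {a W B C δ : ℝ} {f w₀ ρ₀ σ₀ χ : ℝ → ℝ} {w ρ σ τ X p q ρ' σ' : ℝ × ℝ → ℝ}

theorem IsCharSolution.abs_ρ_le (h : IsCharSolution a δ f w₀ ρ₀ σ₀ χ w ρ σ τ X p q ρ' σ')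
    (hd : CharData a W B C f w₀ ρ₀ σ₀ χ) (s η : ℝ) : |ρ (s, η)| ≤ B + 1 := by
  have h1 := abs_add_le_add (h.ρ_near s η) (hd.ρ_le η)
  rw [sub_add_cancel] at h1
  linarith

theorem IsCharSolution.abs_σ_le (h : IsCharSolution a δ f w₀ ρ₀ σ₀ χ w ρ σ τ X p q ρ' σ')
    (hd : CharData a W B C f w₀ ρ₀ σ₀ χ) (s η : ℝ) : |σ (s, η)| ≤ B + 1 := by
  have h1 := abs_add_le_add (h.σ_near s η) (hd.σ_le s)
  rw [sub_add_cancel] at h1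
  linarith

theorem IsCharSolution.w_le (h : IsCharSolution a δ f w₀ ρ₀ σ₀ χ w ρ σ τ X p q ρ' σ')
    (hd : CharData a W B C f w₀ ρ₀ σ₀ χ) (s η : ℝ) : w (s, η) ≤ W + 1 := by
  have h1 := (abs_le.1 (h.w_near s η)).2
  linarith [hd.w_le η]

theorem IsCharSolution.abs_p_le (h : IsCharSolution a δ f w₀ ρ₀ σ₀ χ w ρ σ τ X p q ρ' σ')
    (s η : ℝ) : |p (s, η)| ≤ 1 := by
  have h1 := abs_le.1 (h.p_near s η)
  rw [abs_le]; constructor <;> linarith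

theorem IsCharSolution.abs_q_le (h : IsCharSolution a δ f w₀ ρ₀ σ₀ χ w ρ σ τ X p q ρ' σ')
    (s η : ℝ) : |q (s, η)| ≤ 1 := by
  have h1 := abs_le.1 (h.q_near s η)
  rw [abs_le]; constructor <;> linarith

theorem sourceConst_nonneg (ha : 0 ≤ a) (hB : 0 ≤ B) (hC : 0 ≤ C) : 0 ≤ sourceConst a B C := by
  unfold sourceConst; positivity

/-- Bound for `ρ` and `σ` by their data on the domain of dependence. -/
theorem IsCharSolution.abs_le_of_data_le
    (h : IsCharSolution a δ f w₀ ρ₀ σ₀ χ w ρ σ τ X p q ρ' σ')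
    (hd : CharData a W B C f w₀ ρ₀ σ₀ χ) (ha : 0 ≤ a) (hB : 0 ≤ B) (hC : 0 ≤ C)
    (hδ : δ * sourceConst a B C ≤ 1 / 4) {s₀ η₀ N : ℝ} (hs : |s₀ - η₀| < δ)
    (hρ : ∀ y ∈ uIcc s₀ η₀, |ρ₀ y| ≤ N) (hσ : ∀ y ∈ uIcc s₀ η₀, |σ₀ y| ≤ N) :
    ∀ s ∈ uIcc s₀ η₀, ∀ η ∈ uIcc s₀ η₀, |ρ (s, η)| ≤ 2 * N ∧ |σ (s, η)| ≤ 2 * N := by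
  set J := uIcc s₀ η₀ with hJ
  set κ := sourceConst a B C with hκ
  have hκ0 : 0 ≤ κ := sourceConst_nonneg ha hB hC
  have hJd : ∀ s ∈ J, ∀ η ∈ J, |s - η| < δ := fun s hs' η hη =>
    (abs_sub_le_of_uIcc_subset_uIcc (uIcc_subset_uIcc hη hs')).trans_lt (by rwa [abs_sub_comm])
  have hc : Continuous (fun P => max |ρ P| |σ P|) := by
    have := h.cont_ρ
    have := h.cont_σ
    fun_prop
  -- The square J × J contains, with each point, the two rays to the diagonal on which ρ and σ are
  -- integrated. The maximum m over it satisfies m ≤ N + m/4.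
  obtain ⟨⟨s₁, η₁⟩, ⟨hs₁, hη₁⟩, hmax⟩ := (isCompact_uIcc.prod isCompact_uIcc :
    IsCompact (J ×ˢ J)).exists_isMaxOn ⟨(s₀, s₀), left_mem_uIcc, left_mem_uIcc⟩ hc.continuousOn
  set m := max |ρ (s₁, η₁)| |σ (s₁, η₁)| with hm
  have hmb : ∀ s ∈ J, ∀ η ∈ J, max |ρ (s, η)| |σ (s, η)| ≤ m := fun s hs η hη =>
    hmax (show (s, η) ∈ J ×ˢ J from ⟨hs, hη⟩)
  have hm0 : 0 ≤ m := (abs_nonneg _).trans (le_max_left _ _)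
  have hδ0 : 0 ≤ δ := (abs_nonneg _).trans hs.le
  have hfb : ∀ s η, |f (w (s, η))| ≤ C := fun s η => hd.f_le _ (h.w_le hd s η)
  have bR : ∀ s ∈ J, ∀ η ∈ J,
      |p (s, η) * sourceR a (f (w (s, η))) (ρ (s, η)) (σ (s, η))| ≤ κ * m := fun s hs η hη => by
    have := abs_mul_le_mul (h.abs_p_le s η) (abs_sourceR_le ha (hfb s η) (h.abs_ρ_le hd s η)
      ((le_max_left _ _).trans (hmb s hs η hη)) ((le_max_right _ _).trans (hmb s hs η hη)))
    rwa [one_mul] at this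
  have bS : ∀ s ∈ J, ∀ η ∈ J,
      |q (s, η) * sourceS a (f (w (s, η))) (ρ (s, η)) (σ (s, η))| ≤ κ * m := fun s hs η hη => by
    have := abs_mul_le_mul (h.abs_q_le s η) (abs_sourceS_le ha (hfb s η) (h.abs_σ_le hd s η)
      ((le_max_left _ _).trans (hmb s hs η hη)) ((le_max_right _ _).trans (hmb s hs η hη)))
    rwa [one_mul] at this
  have hlen : κ * m * δ ≤ 1 / 4 * m := by
    calc κ * m * δ = δ * κ * m := by ring
      _ ≤ _ := by gcongr
  have hsub : uIcc η₁ s₁ ⊆ J := uIcc_subset_uIcc hη₁ hs₁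
  have hsub' : uIcc s₁ η₁ ⊆ J := uIcc_subset_uIcc hs₁ hη₁
  have e1 : |ρ (s₁, η₁)| ≤ N + 1 / 4 * m := by
    have hmv := (convex_uIcc η₁ s₁).norm_image_sub_le_of_norm_hasDerivWithin_le
      (f := fun s => ρ (s, η₁))
      (fun s hs => (h.ρ_ξ s η₁ (hJd s (hsub hs) η₁ hη₁)).hasDerivWithinAt)
      (fun s hs => bR s (hsub hs) η₁ hη₁) left_mem_uIcc right_mem_uIcc
    have h1 : |ρ (s₁, η₁) - ρ₀ η₁| ≤ 1 / 4 * m := by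
      rw [← h.ρ_diag]
      refine hmv.trans (le_trans ?_ hlen)
      gcongr
      exact (hJd s₁ hs₁ η₁ hη₁).le
    have := abs_add_le_add h1 (hρ η₁ hη₁)
    rw [sub_add_cancel] at this
    linarith
  have e2 : |σ (s₁, η₁)| ≤ N + 1 / 4 * m := by
    have hmv := (convex_uIcc s₁ η₁).norm_image_sub_le_of_norm_hasDerivWithin_le
      (f := fun r => σ (s₁, r))
      (fun r hr => (h.σ_η s₁ r (hJd s₁ hs₁ r (hsub' hr))).hasDerivWithinAt)
      (fun r hr => bS s₁ hs₁ r (hsub' hr)) left_mem_uIcc right_mem_uIcc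
    have h1 : |σ (s₁, η₁) - σ₀ s₁| ≤ 1 / 4 * m := by
      rw [← h.σ_diag]
      refine hmv.trans (le_trans ?_ hlen)
      gcongr
      rw [Real.norm_eq_abs, abs_sub_comm]
      exact (hJd s₁ hs₁ η₁ hη₁).le
    have := abs_add_le_add h1 (hσ s₁ hs₁)
    rw [sub_add_cancel] at this
    linarith
  have hmN : m ≤ N + 1 / 4 * m := max_le e1 e2
  intro s hs η hη
  have := hmb s hs η hη
  exact ⟨(le_max_left _ _).trans (by linarith), (le_max_right _ _).trans (by linarith)⟩

/-- Bounds for the transversal derivatives of `ρ` and `σ` by the data on the domain of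
dependence. -/
theorem IsCharSolution.abs_deriv_le_of_data_le
    (h : IsCharSolution a δ f w₀ ρ₀ σ₀ χ w ρ σ τ X p q ρ' σ')
    (hd : CharData a W B C f w₀ ρ₀ σ₀ χ) (ha : 0 ≤ a) (hB : 0 ≤ B) (hC : 0 ≤ C)
    (hδ : δ * sourceConst a B C ≤ 1 / 4) {s₀ η₀ N : ℝ} (hs : |s₀ - η₀| < δ)
    (hρ : ∀ y ∈ uIcc s₀ η₀, |ρ₀ y| ≤ N) (hσ : ∀ y ∈ uIcc s₀ η₀, |σ₀ y| ≤ N) :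
    |ρ' (s₀, η₀)| ≤ 2 * |deriv ρ₀ η₀| + 4 * sourceConst a B C * N ∧
    |σ' (s₀, η₀)| ≤ 2 * |deriv σ₀ s₀| + 4 * sourceConst a B C * N := by
  have hb := h.abs_le_of_data_le hd ha hB hC hδ hs hρ hσ
  set J := uIcc s₀ η₀ with hJ
  set κ := sourceConst a B C with hκ
  have hκ0 : 0 ≤ κ := sourceConst_nonneg ha hB hC
  have hJd : ∀ s ∈ J, ∀ η ∈ J, |s - η| < δ := fun s hs' η hη =>
    (abs_sub_le_of_uIcc_subset_uIcc (uIcc_subset_uIcc hη hs')).trans_lt (by rwa [abs_sub_comm])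
  have hN0 : 0 ≤ N := (abs_nonneg _).trans (hρ s₀ left_mem_uIcc)
  have hfb : ∀ s η, |f (w (s, η))| ≤ C := fun s η => hd.f_le _ (h.w_le hd s η)
  have hfd : ∀ x, HasDerivAt f (deriv f x) x := fun x =>
    (hd.f_contDiff.differentiable one_ne_zero x).hasDerivAt
  have hs0 : s₀ ∈ J := left_mem_uIcc
  have hη0 : η₀ ∈ J := right_mem_uIcc
  have hpq : ∀ s η, |-(a / 2) * (ρ (s, η) + σ (s, η)) * p (s, η) * q (s, η)| ≤ a * (B + 1) := by
    intro s η
    have h2 : |-(a / 2)| ≤ a / 2 := by rw [abs_neg]; exact (abs_of_nonneg (by positivity)).le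
    refine (abs_mul_le_mul (abs_mul_le_mul (abs_mul_le_mul h2 (abs_add_le_add
      (h.abs_ρ_le hd s η) (h.abs_σ_le hd s η))) (h.abs_p_le s η)) (h.abs_q_le s η)).trans_eq ?_
    ring
  have hδ2 : δ * (2 * κ) ≤ 1 / 2 := by linarith
  have hfin : 2 * (δ * (3 * κ ^ 2 * (2 * N))) ≤ 3 * κ * N := by
    calc 2 * (δ * (3 * κ ^ 2 * (2 * N))) = δ * κ * (12 * κ * N) := by ring
      _ ≤ 1 / 4 * (12 * κ * N) := by gcongr
      _ = _ := by ring
  constructor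
  -- The ξ-derivative of ρ' equals the η-derivative of the right-hand side for ρ, so ρ' satisfies a
  -- linear differential inequality in ξ.
  · have hk : ∀ s ∈ J, ∃ k, HasDerivAt (fun r => ρ' (r, η₀)) k s ∧
        |k| ≤ 2 * κ * |ρ' (s, η₀)| + 3 * κ ^ 2 * (2 * N) := by
      intro s hs
      have hsη := hJd s hs η₀ hη0
      obtain ⟨k, h1, h2⟩ := h.ρ_ηξ s η₀ hsη
      refine ⟨k, h1, ?_⟩
      have bm := hb s hs η₀ hη0
      refine abs_deriv_mul_sourceR_le ha hB hC (h.p_η s η₀ hsη)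
        ((hfd _).comp η₀ (h.w_η s η₀ hsη)) (h.ρ_η s η₀ hsη) (h.σ_η s η₀ hsη) h2
        (h.abs_p_le _ _) (hpq _ _) (hfb _ _) ?_ (h.abs_ρ_le hd _ _) (h.abs_σ_le hd _ _)
        bm.1 bm.2 ?_
      · refine abs_mul_le_mul (hd.f_deriv _ (h.w_le hd s η₀)) ?_
        have := abs_mul_le_mul (h.abs_q_le s η₀) bm.1
        rwa [one_mul] at this
      · have := abs_mul_le_mul (h.abs_q_le s η₀)
          (abs_sourceS_le ha (hfb s η₀) (h.abs_σ_le hd s η₀) bm.1 bm.2)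
        rwa [one_mul] at this
    have hc : Continuous (fun r => ρ' (r, η₀)) := by
      have := h.cont_ρ'
      fun_prop
    have hsub : uIcc η₀ s₀ ⊆ J := by rw [uIcc_comm]
    choose! k hk1 hk2 using hk
    have key := abs_le_of_abs_deriv_le_linear hc (fun r hr => hk1 r (hsub hr))
      (fun r hr => hk2 r (hsub hr)) (by positivity) hs.le hδ2 (by positivity)
    have hdiag : |ρ' (η₀, η₀)| ≤ |deriv ρ₀ η₀| + 1 / 2 * (κ * N) := by
      rw [h.ρ'_diag]
      refine abs_add_le_add le_rfl (abs_mul_le_mul (by norm_num [abs_le]) ?_)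
      refine abs_sourceR_le ha (hd.f_le _ ((hd.w_le η₀).trans (by linarith))) ?_ (hρ _ hη0)
        (hσ _ hη0)
      linarith [hd.ρ_le η₀]
    linarith [hfin]
  · have hk : ∀ η ∈ J, ∃ k, HasDerivAt (fun r => σ' (s₀, r)) k η ∧
        |k| ≤ 2 * κ * |σ' (s₀, η)| + 3 * κ ^ 2 * (2 * N) := by
      intro η hη
      have hsη := hJd s₀ hs0 η hη
      obtain ⟨k, h1, h2⟩ := h.σ_ξη s₀ η hsη
      refine ⟨k, h1, ?_⟩
      have bm := hb s₀ hs0 η hη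
      -- From here the argument for ρ' applies with ρ and σ, p and q exchanged and f replaced by -f.
      simp only [sourceS_eq] at h2
      refine abs_deriv_mul_sourceR_le ha hB hC (h.q_ξ s₀ η hsη)
        ((hfd _).comp s₀ (h.w_ξ s₀ η hsη)).neg (h.σ_ξ s₀ η hsη) (h.ρ_ξ s₀ η hsη) h2
        (h.abs_q_le _ _) (hpq _ _) ?_ ?_ (h.abs_σ_le hd _ _) (h.abs_ρ_le hd _ _)
        bm.2 bm.1 ?_
      · simpa using hfb s₀ η
      · rw [abs_neg]
        refine abs_mul_le_mul (hd.f_deriv _ (h.w_le hd s₀ η)) ?_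
        have := abs_mul_le_mul (h.abs_p_le s₀ η) bm.2
        rwa [one_mul] at this
      · have := abs_mul_le_mul (h.abs_p_le s₀ η)
          (abs_sourceR_le ha (hfb s₀ η) (h.abs_ρ_le hd s₀ η) bm.1 bm.2)
        rwa [one_mul] at this
    have hc : Continuous (fun r => σ' (s₀, r)) := by
      have := h.cont_σ'
      fun_prop
    choose! k hk1 hk2 using hk
    have key := abs_le_of_abs_deriv_le_linear hc hk1 hk2 (by positivity)
      (by rw [abs_sub_comm]; exact hs.le) hδ2 (by positivity)
    have hdiag : |σ' (s₀, s₀)| ≤ |deriv σ₀ s₀| + 1 / 2 * (κ * N) := by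
      rw [h.σ'_diag]
      refine abs_sub_le_add le_rfl (abs_mul_le_mul (by norm_num [abs_le]) ?_)
      refine abs_sourceS_le ha (hd.f_le _ ((hd.w_le s₀).trans (by linarith))) ?_ (hρ _ hs0)
        (hσ _ hs0)
      linarith [hd.σ_le s₀]
    linarith [hfin]

end Estimates

/-! ### Inverting the characteristic coordinates -/

/-- The derivative of the map from characteristic coordinates to `(t, x)`. -/
noncomputable def charEquiv (p q l : ℝ) (hp : p ≠ 0) (hq : q ≠ 0) (hl : l ≠ 0) :
    (ℝ × ℝ) ≃L[ℝ] (ℝ × ℝ) :=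
  ContinuousLinearEquiv.equivOfInverse ((grad p q).prod (grad (-(l * p)) (l * q)))
    ((grad (1 / (2 * p)) (-1 / (2 * p * l))).prod (grad (1 / (2 * q)) (1 / (2 * q * l))))
    (fun v => by ext <;> simp <;> field_simp <;> ring)
    (fun v => by ext <;> simp <;> field_simp <;> ring)

section Inverse

variable {a W B C δ : ℝ} {f w₀ ρ₀ σ₀ χ : ℝ → ℝ} {w ρ σ τ X p q ρ' σ' : ℝ × ℝ → ℝ}

theorem IsCharSolution.p_neg (h : IsCharSolution a δ f w₀ ρ₀ σ₀ χ w ρ σ τ X p q ρ' σ')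
    (P : ℝ × ℝ) : p P ≤ -(1 / 4) := by
  have h1 := abs_le.1 (h.p_near P.1 P.2)
  simp only [Prod.mk.eta] at h1
  linarith

theorem IsCharSolution.q_pos (h : IsCharSolution a δ f w₀ ρ₀ σ₀ χ w ρ σ τ X p q ρ' σ')
    (P : ℝ × ℝ) : 1 / 4 ≤ q P := by
  have h1 := abs_le.1 (h.q_near P.1 P.2)
  simp only [Prod.mk.eta] at h1
  linarith

theorem IsCharSolution.hasStrictFDerivAt_τ
    (h : IsCharSolution a δ f w₀ ρ₀ σ₀ χ w ρ σ τ X p q ρ' σ') {P : ℝ × ℝ} (hP : P ∈ strip δ) :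
    HasStrictFDerivAt τ (grad (p P) (q P)) P :=
  hasStrictFDerivAt_of_partials (isOpen_strip δ) h.cont_p.continuousOn h.cont_q.continuousOn
    (fun Q hQ => h.τ_ξ Q.1 Q.2 hQ) (fun Q hQ => h.τ_η Q.1 Q.2 hQ) hP

theorem IsCharSolution.hasStrictFDerivAt_X
    (h : IsCharSolution a δ f w₀ ρ₀ σ₀ χ w ρ σ τ X p q ρ' σ') {P : ℝ × ℝ} (hP : P ∈ strip δ) :
    HasStrictFDerivAt X (grad (-(Real.exp (a * w P) * p P)) (Real.exp (a * w P) * q P)) P := by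
  have := h.cont_w
  have := h.cont_p
  have := h.cont_q
  exact hasStrictFDerivAt_of_partials (isOpen_strip δ)
    (φ₁ := fun P => -(Real.exp (a * w P) * p P)) (φ₂ := fun P => Real.exp (a * w P) * q P)
    (by fun_prop) (by fun_prop)
    (fun Q hQ => h.X_ξ Q.1 Q.2 hQ) (fun Q hQ => h.X_η Q.1 Q.2 hQ) hP

theorem convex_strip (δ : ℝ) : Convex ℝ (strip δ) := by
  have : strip δ = (LinearMap.fst ℝ ℝ ℝ - LinearMap.snd ℝ ℝ ℝ) ⁻¹' (Metric.ball 0 δ) := by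
    ext P; simp [strip]
  rw [this]
  exact (convex_ball _ _).linear_preimage _

/-- Rolle's theorem on the segment from P to Q. -/
theorem exists_segment_deriv_eq_zero {U : Set (ℝ × ℝ)} (hU : Convex ℝ U) {φ φ₁ φ₂ : ℝ × ℝ → ℝ}
    (hd : ∀ P ∈ U, HasFDerivAt φ (grad (φ₁ P) (φ₂ P)) P) {P Q : ℝ × ℝ} (hP : P ∈ U) (hQ : Q ∈ U)
    (h : φ P = φ Q) : ∃ Z ∈ U, φ₁ Z * (Q.1 - P.1) + φ₂ Z * (Q.2 - P.2) = 0 := by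
  have hmem : ∀ θ ∈ Icc (0 : ℝ) 1, AffineMap.lineMap P Q θ ∈ U := fun θ hθ =>
    hU.lineMap_mem hP hQ hθ
  have hder : ∀ θ ∈ Icc (0 : ℝ) 1, HasDerivAt (fun θ => φ (AffineMap.lineMap P Q θ))
      (grad (φ₁ (AffineMap.lineMap P Q θ)) (φ₂ (AffineMap.lineMap P Q θ)) (Q - P)) θ :=
    fun θ hθ => (hd _ (hmem θ hθ)).comp_hasDerivAt θ AffineMap.hasDerivAt_lineMap
  obtain ⟨θ, hθ, h0⟩ := exists_hasDerivAt_eq_zero (a := (0 : ℝ)) (b := 1) one_pos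
    (fun θ hθ => (hder θ hθ).continuousAt.continuousWithinAt) (by simpa using h)
    (fun θ hθ => hder θ (Ioo_subset_Icc_self hθ))
  exact ⟨_, hmem θ (Ioo_subset_Icc_self hθ), by simpa using h0⟩

/-- Equal times force the increments of ξ and η to have the same sign, as p < 0 < q; equal positions
force opposite signs, as both derivatives of X are positive. The two intermediate points may differ,
because only signs matter. -/
theorem IsCharSolution.injOn (h : IsCharSolution a δ f w₀ ρ₀ σ₀ χ w ρ σ τ X p q ρ' σ') :
    InjOn (fun P => (τ P, X P)) (strip δ) := by
  intro P hP Q hQ hPQ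
  rw [Prod.mk.injEq] at hPQ
  obtain ⟨Z, hZ, h1⟩ := exists_segment_deriv_eq_zero (convex_strip δ)
    (fun P hP => (h.hasStrictFDerivAt_τ hP).hasFDerivAt) hP hQ hPQ.1
  obtain ⟨Y, hY, h2⟩ := exists_segment_deriv_eq_zero (convex_strip δ)
    (fun P hP => (h.hasStrictFDerivAt_X hP).hasFDerivAt) hP hQ hPQ.2
  have pZ := h.p_neg Z
  have pY := h.p_neg Y
  have qZ := h.q_pos Z
  have qY := h.q_pos Y
  set l := Real.exp (a * w Y) with hl
  have hl0 : 0 < l := Real.exp_pos _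
  have h3 : -(p Y) * (Q.1 - P.1) + q Y * (Q.2 - P.2) = 0 := by
    have : l * (-(p Y) * (Q.1 - P.1) + q Y * (Q.2 - P.2)) = 0 := by linarith
    exact (mul_eq_zero.1 this).resolve_left hl0.ne'
  have h4 : (q Y * (-p Z) + (-p Y) * q Z) * (Q.2 - P.2) = 0 := by
    linear_combination (-p Z) * h3 + (-p Y) * h1
  have h5 : 0 < q Y * (-p Z) + (-p Y) * q Z := by
    have : 0 < q Y * (-p Z) := mul_pos (by linarith) (by linarith)
    have : 0 < (-p Y) * q Z := mul_pos (by linarith) (by linarith)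
    linarith
  have e2 : Q.2 - P.2 = 0 := (mul_eq_zero.1 h4).resolve_left h5.ne'
  rw [e2, mul_zero, add_zero] at h1
  have e1 : Q.1 - P.1 = 0 := (mul_eq_zero.1 h1).resolve_left (by linarith)
  ext <;> linarith

/-- Mean value theorem in ξ from the diagonal, where τ = 0, with |p| ≥ 1/4; it is obtained from
Rolle for a combination of τ and ξ - η that vanishes at both ends. -/
theorem IsCharSolution.abs_sub_le_τ (h : IsCharSolution a δ f w₀ ρ₀ σ₀ χ w ρ σ τ X p q ρ' σ')
    {P : ℝ × ℝ} (hP : P ∈ strip δ) : |P.1 - P.2| ≤ 4 * |τ P| := by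
  have hD : (P.2, P.2) ∈ strip δ := by
    have : 0 < δ := (abs_nonneg _).trans_lt hP
    simpa [strip] using this
  obtain ⟨Z, hZ, h1⟩ := exists_segment_deriv_eq_zero (convex_strip δ)
    (φ := fun Q => τ Q * (P.1 - P.2) - τ P * (Q.1 - Q.2))
    (φ₁ := fun Q => p Q * (P.1 - P.2) - τ P) (φ₂ := fun Q => q Q * (P.1 - P.2) + τ P)
    (P := P) (Q := (P.2, P.2))
    (fun Q hQ => by
      have e := ((h.hasStrictFDerivAt_τ hQ).hasFDerivAt.mul_const (P.1 - P.2)).sub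
        ((hasFDerivAt_fst (𝕜 := ℝ) (p := Q)).sub hasFDerivAt_snd |>.const_mul (τ P))
      refine e.congr_fderiv ?_
      ext <;> simp <;> ring) hP hD (by simp [h.τ_diag])
  have pZ := h.p_neg Z
  have h2 : (P.1 - P.2) * (p Z * (P.1 - P.2) - τ P) = 0 := by
    simp only [sub_self, mul_zero, add_zero] at h1
    linear_combination -h1
  rcases mul_eq_zero.1 h2 with h3 | h3
  · rw [h3]; simp
  · have h4 : |τ P| = (-p Z) * |P.1 - P.2| := by
      rw [← abs_of_nonneg (by linarith : 0 ≤ -p Z), ← abs_mul, ← abs_neg]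
      congr 1
      linarith
    rw [h4]
    nlinarith [abs_nonneg (P.1 - P.2)]

/-- A connectedness argument. The image of the strip is open by local inversion. It is closed
relative to the slab: where |t| < δ/8, points come from |ξ - η| < δ/2, well inside the strip, and
properness of χ confines them to a compact set when x is bounded. -/
theorem IsCharSolution.slab_subset_image
    (h : IsCharSolution a δ f w₀ ρ₀ σ₀ χ w ρ σ τ X p q ρ' σ') (hδ : 0 < δ)
    (hχ : ∀ R, ∃ N, ∀ y, |χ y| ≤ R → |y| ≤ N) :
    {Q : ℝ × ℝ | |Q.1| < δ / 8} ⊆ (fun P => (τ P, X P)) '' strip δ := by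
  set Φ : ℝ × ℝ → ℝ × ℝ := fun P => (τ P, X P) with hΦ
  have hΦc : Continuous Φ := h.cont_τ.prodMk h.cont_X
  have hslab : {Q : ℝ × ℝ | |Q.1| < δ / 8} = LinearMap.fst ℝ ℝ ℝ ⁻¹' (Metric.ball 0 (δ / 8)) := by
    ext Q; simp
  have hpre : IsPreconnected {Q : ℝ × ℝ | |Q.1| < δ / 8} := by
    rw [hslab]
    exact ((convex_ball _ _).linear_preimage _).isPreconnected
  have hopen : IsOpen (Φ '' strip δ) := by
    rw [isOpen_iff_mem_nhds]
    rintro _ ⟨P, hP, rfl⟩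
    have hp : p P ≠ 0 := by linarith [h.p_neg P]
    have hq : q P ≠ 0 := by linarith [h.q_pos P]
    have hd : HasStrictFDerivAt Φ (charEquiv (p P) (q P) (Real.exp (a * w P)) hp hq
        (Real.exp_pos _).ne' : (ℝ × ℝ) →L[ℝ] (ℝ × ℝ)) P :=
      (h.hasStrictFDerivAt_τ hP).prodMk (h.hasStrictFDerivAt_X hP)
    rw [← hd.map_nhds_eq_of_equiv]
    exact image_mem_map ((isOpen_strip δ).mem_nhds hP)
  refine hpre.subset_of_closure_inter_subset hopen ?_ ?_
  · refine ⟨Φ (0, 0), ?_, (0, 0), by simpa [strip] using hδ, rfl⟩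
    simp [hΦ, h.τ_diag, hδ]
  · rintro Q ⟨hQ1, hQ2⟩
    -- The margin 2 covers the distance 1 allowed around Q and the deviation 1/4 of X from χ.
    obtain ⟨N, hN⟩ := hχ (|Q.2| + 2)
    set K : Set (ℝ × ℝ) := {P | |P.1 - P.2| ≤ δ / 2 ∧ |P.2| ≤ N} with hK
    have hKc : IsCompact K := by
      refine (isCompact_closedBall (0 : ℝ × ℝ) (N + δ / 2)).of_isClosed_subset ?_ ?_
      · exact (isClosed_le (f := fun P : ℝ × ℝ => |P.1 - P.2|) (by fun_prop)
          continuous_const).inter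
            (isClosed_le (f := fun P : ℝ × ℝ => |P.2|) (by fun_prop) continuous_const)
      · rintro P ⟨h1, h2⟩
        rw [mem_closedBall_zero_iff, Prod.norm_def]
        refine max_le ?_ (h2.trans (by linarith))
        have := abs_add_le_add h1 h2
        rw [sub_add_cancel] at this
        rw [Real.norm_eq_abs]; linarith
    set Vn : Set (ℝ × ℝ) := {Z | |Z.1| < δ / 8} ∩ {Z | |Z.2 - Q.2| < 1} with hVn
    have hVo : IsOpen Vn :=
      (isOpen_lt (f := fun Z : ℝ × ℝ => |Z.1|) (by fun_prop) continuous_const).inter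
        (isOpen_lt (f := fun Z : ℝ × ℝ => |Z.2 - Q.2|) (by fun_prop) continuous_const)
    have hsub : Vn ∩ Φ '' strip δ ⊆ Φ '' K := by
      rintro _ ⟨⟨h1, h2⟩, P, hP, rfl⟩
      refine ⟨P, ⟨?_, ?_⟩, rfl⟩
      · have h3 := h.abs_sub_le_τ hP
        change |τ P| < δ / 8 at h1
        linarith
      · refine hN _ ?_
        have h3 := h.X_near P.1 P.2
        change |X P - Q.2| < 1 at h2
        have h4 := abs_add_le_add (abs_sub_le_add h2.le h3) (le_refl |Q.2|)
        rw [show X P - Q.2 - (X (P.1, P.2) - χ P.2) + Q.2 = χ P.2 by simp] at h4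
        linarith
    have hcl : Q ∈ closure (Vn ∩ Φ '' strip δ) :=
      hVo.inter_closure ⟨⟨hQ2, by simp⟩, hQ1⟩
    have : Q ∈ Φ '' K := by
      have := closure_mono hsub hcl
      rwa [(hKc.image hΦc).isClosed.closure_eq] at this
    obtain ⟨P, hP, rfl⟩ := this
    exact ⟨P, lt_of_le_of_lt hP.1 (by linarith), rfl⟩

/-- The inverse of the map from characteristic coordinates to `(t, x)`. -/
theorem IsCharSolution.exists_inverse
    (h : IsCharSolution a δ f w₀ ρ₀ σ₀ χ w ρ σ τ X p q ρ' σ') (hδ : 0 < δ)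
    (hχ : ∀ R, ∃ N, ∀ y, |χ y| ≤ R → |y| ≤ N) :
    ∃ g : ℝ × ℝ → ℝ × ℝ, (∀ y, g (0, χ y) = (y, y)) ∧ ∀ Q : ℝ × ℝ, |Q.1| < δ / 8 →
      g Q ∈ strip δ ∧ τ (g Q) = Q.1 ∧ X (g Q) = Q.2 ∧ ContinuousAt g Q ∧
      ∀ (φ : ℝ × ℝ → ℝ) (φ₁ φ₂ : ℝ), HasFDerivAt φ (grad φ₁ φ₂) (g Q) →
        HasFDerivAt (fun Z => φ (g Z)) (grad ((φ₁ / p (g Q) + φ₂ / q (g Q)) / 2)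
          ((φ₂ / q (g Q) - φ₁ / p (g Q)) / (2 * Real.exp (a * w (g Q))))) Q := by
  set Φ : ℝ × ℝ → ℝ × ℝ := fun P => (τ P, X P) with hΦ
  set g := Function.invFunOn Φ (strip δ) with hg
  have hleft : ∀ P ∈ strip δ, g (Φ P) = P := h.injOn.leftInvOn_invFunOn
  refine ⟨g, fun y => ?_, fun Q hQ => ?_⟩
  · have hy : (y, y) ∈ strip δ := by simpa [strip] using hδ
    have := hleft _ hy
    simpa [hΦ, h.τ_diag, h.X_diag] using this
  · obtain ⟨P, hP, rfl⟩ := h.slab_subset_image hδ hχ hQ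
    have hp : p P ≠ 0 := by linarith [h.p_neg P]
    have hq : q P ≠ 0 := by linarith [h.q_pos P]
    have hd : HasStrictFDerivAt Φ (charEquiv (p P) (q P) (Real.exp (a * w P)) hp hq
        (Real.exp_pos _).ne' : (ℝ × ℝ) →L[ℝ] (ℝ × ℝ)) P :=
      (h.hasStrictFDerivAt_τ hP).prodMk (h.hasStrictFDerivAt_X hP)
    have hgd := hd.to_local_left_inverse (g := g)
      (by filter_upwards [(isOpen_strip δ).mem_nhds hP] with Z hZ using hleft Z hZ)
    have hgP : g (Φ P) = P := hleft P hP
    change g (Φ P) ∈ _ ∧ τ (g (Φ P)) = _ ∧ X (g (Φ P)) = _ ∧ ContinuousAt g (Φ P) ∧ _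
    rw [hgP]
    refine ⟨hP, rfl, rfl, hgd.hasFDerivAt.continuousAt, fun φ φ₁ φ₂ hφ => ?_⟩
    rw [← hgP] at hφ
    refine (hφ.comp (Φ P) hgd.hasFDerivAt).congr_fderiv ?_
    have hl := (Real.exp_pos (a * w P)).ne'
    have hsymm : ∀ v, (charEquiv (p P) (q P) (Real.exp (a * w P)) hp hq hl).symm v =
        (1 / (2 * p P) * v.1 + -1 / (2 * p P * Real.exp (a * w P)) * v.2,
          1 / (2 * q P) * v.1 + 1 / (2 * q P * Real.exp (a * w P)) * v.2) := fun v => by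
      simp [charEquiv]
    ext
    · simp [hsymm]; field_simp
    · simp [hsymm]; field_simp; ring

end Inverse

/-! ### Back to the variables (t, x) -/

/-- The inhomogeneity of the equations for the Riemann invariants. -/
noncomputable def riemannSource (a : ℝ) (F : ℝ → ℝ) (u R S Z : ℝ) : ℝ :=
  a / (2 * u) * (R - S) * Z + F u / (2 * u ^ a) * (R - S)

/-- A solution of the diagonal system for `u` and the Riemann invariants `R`, `S`, in the open
slab `|t| < T₀`, together with the gradients of `R` and `S`. -/
structure IsSlabSolution (a T₀ : ℝ) (F : ℝ → ℝ) (u R S Rt Rx St Sx : ℝ × ℝ → ℝ) : Prop where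
  pos : ∀ Q, |Q.1| < T₀ → 0 < u Q
  grad_u : ∀ Q, |Q.1| < T₀ →
    HasFDerivAt u (grad ((R Q + S Q) / 2) ((R Q - S Q) / (2 * u Q ^ a))) Q
  grad_R : ∀ Q, |Q.1| < T₀ → HasFDerivAt R (grad (Rt Q) (Rx Q)) Q
  grad_S : ∀ Q, |Q.1| < T₀ → HasFDerivAt S (grad (St Q) (Sx Q)) Q
  cont_Rt : ∀ Q, |Q.1| < T₀ → ContinuousAt Rt Q
  cont_Rx : ∀ Q, |Q.1| < T₀ → ContinuousAt Rx Q
  cont_St : ∀ Q, |Q.1| < T₀ → ContinuousAt St Q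
  cont_Sx : ∀ Q, |Q.1| < T₀ → ContinuousAt Sx Q
  eq_R : ∀ Q, |Q.1| < T₀ → Rt Q - u Q ^ a * Rx Q = riemannSource a F (u Q) (R Q) (S Q) (R Q)
  eq_S : ∀ Q, |Q.1| < T₀ → St Q + u Q ^ a * Sx Q = -riemannSource a F (u Q) (R Q) (S Q) (S Q) +
    2 * (F (u Q) / (2 * u Q ^ a) * (R Q - S Q))

theorem exp_mul_eq_rpow (a w : ℝ) : Real.exp (a * w) = Real.exp w ^ a := by
  rw [← Real.exp_mul, mul_comm]

section Construction

variable {a W B C δ : ℝ} {f w₀ ρ₀ σ₀ χ : ℝ → ℝ} {w ρ σ τ X p q ρ' σ' : ℝ × ℝ → ℝ}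

/-- The solution in the variables `(t, x)` obtained from a solution in characteristic
coordinates. -/
theorem IsCharSolution.exists_isSlabSolution
    (h : IsCharSolution a δ f w₀ ρ₀ σ₀ χ w ρ σ τ X p q ρ' σ') (hd : CharData a W B C f w₀ ρ₀ σ₀ χ)
    {F : ℝ → ℝ} (hF : ∀ v, f v = F (Real.exp v) / (2 * Real.exp (a * v))) (hδ : 0 < δ)
    (hχ : ∀ R, ∃ N, ∀ y, |χ y| ≤ R → |y| ≤ N) :
    ∃ (u R S Rt Rx St Sx : ℝ × ℝ → ℝ), IsSlabSolution a (δ / 8) F u R S Rt Rx St Sx ∧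
      (∀ y, u (0, χ y) = Real.exp (w₀ y) ∧ R (0, χ y) = Real.exp (w₀ y) * ρ₀ y ∧
        S (0, χ y) = Real.exp (w₀ y) * σ₀ y) ∧
      ∀ Q, |Q.1| < δ / 8 → ∃ P ∈ strip δ, X P = Q.2 ∧ u Q = Real.exp (w P) ∧
        R Q = u Q * ρ P ∧ S Q = u Q * σ P ∧
        Rt Q = u Q * (σ P * ρ P + sourceR a (f (w P)) (ρ P) (σ P) +
          (ρ P ^ 2 + ρ' P / q P)) / 2 ∧
        Rx Q = u Q * ((ρ P ^ 2 + ρ' P / q P) -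
          (σ P * ρ P + sourceR a (f (w P)) (ρ P) (σ P))) / (2 * u Q ^ a) ∧
        St Q = u Q * (σ P ^ 2 + σ' P / p P +
          (ρ P * σ P + sourceS a (f (w P)) (ρ P) (σ P))) / 2 ∧
        Sx Q = u Q * ((ρ P * σ P + sourceS a (f (w P)) (ρ P) (σ P)) -
          (σ P ^ 2 + σ' P / p P)) / (2 * u Q ^ a) := by
  obtain ⟨g, hg0, hg⟩ := h.exists_inverse hδ hχ
  have cw := h.cont_w
  have cρ := h.cont_ρ
  have cσ := h.cont_σ
  have cp := h.cont_p
  have cq := h.cont_q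
  have cρ' := h.cont_ρ'
  have cσ' := h.cont_σ'
  have cf := hd.f_contDiff.continuous
  have hp0 : ∀ P, p P ≠ 0 := fun P => by linarith [h.p_neg P]
  have hq0 : ∀ P, q P ≠ 0 := fun P => by linarith [h.q_pos P]
  have csR : Continuous (fun P => sourceR a (f (w P)) (ρ P) (σ P)) := by
    unfold sourceR; fun_prop
  have csS : Continuous (fun P => sourceS a (f (w P)) (ρ P) (σ P)) := by
    unfold sourceS; fun_prop
  have hw : ∀ P ∈ strip δ, HasFDerivAt w (grad (p P * σ P) (q P * ρ P)) P := fun P hP =>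
    (hasStrictFDerivAt_of_partials (isOpen_strip δ) (φ₁ := fun P => p P * σ P)
      (φ₂ := fun P => q P * ρ P) (by fun_prop) (by fun_prop) (fun Q hQ => h.w_ξ Q.1 Q.2 hQ)
      (fun Q hQ => h.w_η Q.1 Q.2 hQ) hP).hasFDerivAt
  have hρ : ∀ P ∈ strip δ, HasFDerivAt ρ
      (grad (p P * sourceR a (f (w P)) (ρ P) (σ P)) (ρ' P)) P := fun P hP =>
    (hasStrictFDerivAt_of_partials (isOpen_strip δ)
      (φ₁ := fun P => p P * sourceR a (f (w P)) (ρ P) (σ P))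
      (φ₂ := ρ') (by fun_prop) (by fun_prop) (fun Q hQ => h.ρ_ξ Q.1 Q.2 hQ)
      (fun Q hQ => h.ρ_η Q.1 Q.2 hQ) hP).hasFDerivAt
  have hσ : ∀ P ∈ strip δ, HasFDerivAt σ
      (grad (σ' P) (q P * sourceS a (f (w P)) (ρ P) (σ P))) P := fun P hP =>
    (hasStrictFDerivAt_of_partials (isOpen_strip δ)
      (φ₂ := fun P => q P * sourceS a (f (w P)) (ρ P) (σ P))
      (φ₁ := σ') (by fun_prop) (by fun_prop) (fun Q hQ => h.σ_ξ Q.1 Q.2 hQ)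
      (fun Q hQ => h.σ_η Q.1 Q.2 hQ) hP).hasFDerivAt
  have hE : ∀ P ∈ strip δ, HasFDerivAt (fun P => Real.exp (w P))
      (grad (Real.exp (w P) * (p P * σ P)) (Real.exp (w P) * (q P * ρ P))) P := fun P hP =>
    (hw P hP).exp.congr_fderiv (by ext <;> simp)
  have hER : ∀ P ∈ strip δ, HasFDerivAt (fun P => Real.exp (w P) * ρ P)
      (grad (Real.exp (w P) * (p P * (σ P * ρ P + sourceR a (f (w P)) (ρ P) (σ P))))
        (Real.exp (w P) * (q P * ρ P ^ 2 + ρ' P))) P := fun P hP =>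
    ((hE P hP).mul (hρ P hP)).congr_fderiv (by ext <;> simp <;> ring)
  have hES : ∀ P ∈ strip δ, HasFDerivAt (fun P => Real.exp (w P) * σ P)
      (grad (Real.exp (w P) * (p P * σ P ^ 2 + σ' P))
        (Real.exp (w P) * (q P * (ρ P * σ P + sourceS a (f (w P)) (ρ P) (σ P))))) P := fun P hP =>
    ((hE P hP).mul (hσ P hP)).congr_fderiv (by ext <;> simp <;> ring)
  set e : ℝ × ℝ → ℝ := fun P => Real.exp (w P) with he
  have hexp : ∀ P, Real.exp (w P) = e P := fun _ => rfl
  have ce : Continuous e := by fun_prop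
  have he0 : ∀ P, e P ≠ 0 := fun P => (Real.exp_pos _).ne'
  have hea : ∀ P, Real.exp (a * w P) = e P ^ a := fun P => exp_mul_eq_rpow _ _
  have hea0 : ∀ P, e P ^ a ≠ 0 := fun P => (Real.rpow_pos_of_pos (Real.exp_pos _) a).ne'
  have cea : Continuous (fun P => e P ^ a) := by
    simp only [← hea]; fun_prop
  -- As ∂_ξ = p(∂_t - u^a ∂_x) and ∂_η = q(∂_t + u^a ∂_x), the derivatives in t and x are the half
  -- sum of ∂_η/q and ∂_ξ/p, and their half difference divided by u^a.
  set rt : ℝ × ℝ → ℝ := fun P => e P * (σ P * ρ P + sourceR a (f (w P)) (ρ P) (σ P) +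
    (ρ P ^ 2 + ρ' P / q P)) / 2 with hrt
  set rx : ℝ × ℝ → ℝ := fun P => e P * ((ρ P ^ 2 + ρ' P / q P) -
    (σ P * ρ P + sourceR a (f (w P)) (ρ P) (σ P))) / (2 * e P ^ a) with hrx
  set st : ℝ × ℝ → ℝ := fun P => e P * (σ P ^ 2 + σ' P / p P +
    (ρ P * σ P + sourceS a (f (w P)) (ρ P) (σ P))) / 2 with hst
  set sx : ℝ × ℝ → ℝ := fun P => e P * ((ρ P * σ P + sourceS a (f (w P)) (ρ P) (σ P)) -
    (σ P ^ 2 + σ' P / p P)) / (2 * e P ^ a) with hsx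
  have crt : Continuous rt := by
    have := cρ'.div₀ cq hq0
    simp only [hrt]; fun_prop
  have crx : Continuous rx := by
    have := cρ'.div₀ cq hq0
    simp only [hrx]
    refine Continuous.div₀ (by fun_prop) (by fun_prop) fun P => ?_
    exact mul_ne_zero two_ne_zero (hea0 P)
  have cst : Continuous st := by
    have := cσ'.div₀ cp hp0
    simp only [hst]; fun_prop
  have csx : Continuous sx := by
    have := cσ'.div₀ cp hp0
    simp only [hsx]
    refine Continuous.div₀ (by fun_prop) (by fun_prop) fun P => ?_
    exact mul_ne_zero two_ne_zero (hea0 P)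
  refine ⟨fun Q => e (g Q), fun Q => e (g Q) * ρ (g Q), fun Q => e (g Q) * σ (g Q),
    fun Q => rt (g Q), fun Q => rx (g Q), fun Q => st (g Q), fun Q => sx (g Q), ?_, ?_, ?_⟩
  · constructor
    · exact fun Q _ => Real.exp_pos _
    · intro Q hQ
      obtain ⟨hP, -, -, -, hgr⟩ := hg Q hQ
      refine (hgr _ _ _ (hE _ hP)).congr_fderiv ?_
      have := hp0 (g Q)
      have := hq0 (g Q)
      have := hea0 (g Q)
      rw [hea]
      simp only [hexp]
      congr 1
      · field_simp
        ring
      · field_simp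
    · intro Q hQ
      obtain ⟨hP, -, -, -, hgr⟩ := hg Q hQ
      refine (hgr _ _ _ (hER _ hP)).congr_fderiv ?_
      have := hp0 (g Q)
      have := hq0 (g Q)
      have := hea0 (g Q)
      rw [hea]
      simp only [hrt, hrx, hexp]
      congr 1 <;> field_simp
    · intro Q hQ
      obtain ⟨hP, -, -, -, hgr⟩ := hg Q hQ
      refine (hgr _ _ _ (hES _ hP)).congr_fderiv ?_
      have := hp0 (g Q)
      have := hq0 (g Q)
      have := hea0 (g Q)
      rw [hea]
      simp only [hst, hsx, hexp]
      congr 1 <;> field_simp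
    · exact fun Q hQ => crt.continuousAt.comp (hg Q hQ).2.2.2.1
    · exact fun Q hQ => crx.continuousAt.comp (hg Q hQ).2.2.2.1
    · exact fun Q hQ => cst.continuousAt.comp (hg Q hQ).2.2.2.1
    · exact fun Q hQ => csx.continuousAt.comp (hg Q hQ).2.2.2.1
    · intro Q hQ
      have := hea0 (g Q)
      have := he0 (g Q)
      have hFe : F (e (g Q)) / (2 * e (g Q) ^ a) = f (w (g Q)) := by rw [hF, hea]
      simp only [riemannSource, hFe]
      simp only [hrt, hrx, sourceR]
      field_simp
      ring
    · intro Q hQ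
      have := hea0 (g Q)
      have := he0 (g Q)
      have hFe : F (e (g Q)) / (2 * e (g Q) ^ a) = f (w (g Q)) := by rw [hF, hea]
      simp only [riemannSource, hFe]
      simp only [hst, hsx, sourceS]
      field_simp
      ring
  · intro y
    simp only [hg0, he, h.w_diag, h.ρ_diag, h.σ_diag, and_self]
  · intro Q hQ
    obtain ⟨hP, -, hX, -, -⟩ := hg Q hQ
    exact ⟨g Q, hP, hX, rfl, rfl, rfl, rfl, rfl, rfl, rfl⟩

end Construction

/-! ### From the diagonal system to the classical solution -/

section Slab

variable {a T₀ T : ℝ} {F : ℝ → ℝ} {u R S Rt Rx St Sx : ℝ × ℝ → ℝ}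

theorem isOpen_slab (T₀ : ℝ) : IsOpen {Q : ℝ × ℝ | |Q.1| < T₀} :=
  isOpen_lt (by fun_prop) continuous_const

theorem hasDerivAt_fst_of_grad {φ : ℝ × ℝ → ℝ} {c d t x : ℝ}
    (h : HasFDerivAt φ (grad c d) (t, x)) : HasDerivAt (fun s => φ (s, x)) c t := by
  exact (h.comp_hasDerivAt t ((hasDerivAt_id t).prodMk (hasDerivAt_const t x))).congr_deriv
    (by simp)

theorem hasDerivAt_snd_of_grad {φ : ℝ × ℝ → ℝ} {c d t x : ℝ}
    (h : HasFDerivAt φ (grad c d) (t, x)) : HasDerivAt (fun y => φ (t, y)) d x := by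
  exact (h.comp_hasDerivAt x ((hasDerivAt_const x t).prodMk (hasDerivAt_id x))).congr_deriv
    (by simp)

theorem dt_eq_of_hasDerivAt {v : ℝ → ℝ → ℝ} {t x c : ℝ} (hT : 0 < T) (ht : t ∈ Icc 0 T)
    (h : HasDerivAt (fun s => v s x) c t) : dt T v t x = c :=
  h.hasDerivWithinAt.derivWithin (uniqueDiffOn_Icc hT t ht)

theorem dt_congr {v v' : ℝ → ℝ → ℝ} {t x : ℝ} (ht : t ∈ Icc 0 T)
    (h : ∀ s ∈ Icc 0 T, v s x = v' s x) : dt T v t x = dt T v' t x :=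
  derivWithin_congr h (h t ht)

theorem IsSlabSolution.contDiffOn_R (h : IsSlabSolution a T₀ F u R S Rt Rx St Sx) :
    ContDiffOn ℝ 1 R {Q : ℝ × ℝ | |Q.1| < T₀} :=
  contDiffOn_one_of_grad (isOpen_slab T₀) (fun Q hQ => (h.cont_Rt Q hQ).continuousWithinAt)
    (fun Q hQ => (h.cont_Rx Q hQ).continuousWithinAt) h.grad_R

theorem IsSlabSolution.contDiffOn_S (h : IsSlabSolution a T₀ F u R S Rt Rx St Sx) :
    ContDiffOn ℝ 1 S {Q : ℝ × ℝ | |Q.1| < T₀} :=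
  contDiffOn_one_of_grad (isOpen_slab T₀) (fun Q hQ => (h.cont_St Q hQ).continuousWithinAt)
    (fun Q hQ => (h.cont_Sx Q hQ).continuousWithinAt) h.grad_S

/-- A bootstrap: the gradient of u is a smooth function of u, R, S where u > 0, so u is C¹ like R
and S, and then its gradient is C¹. The open slab contains negative times, so regularity up to t = 0
is obtained by restriction. -/
theorem IsSlabSolution.contDiffOn_u (h : IsSlabSolution a T₀ F u R S Rt Rx St Sx) :
    ContDiffOn ℝ 2 u {Q : ℝ × ℝ | |Q.1| < T₀} := by
  have hu0 : ContinuousOn u {Q : ℝ × ℝ | |Q.1| < T₀} := fun Q hQ =>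
    (h.grad_u Q hQ).continuousAt.continuousWithinAt
  have hR := h.contDiffOn_R
  have hS := h.contDiffOn_S
  have hne : ∀ Q ∈ {Q : ℝ × ℝ | |Q.1| < T₀}, 2 * u Q ^ a ≠ 0 := fun Q hQ =>
    mul_ne_zero two_ne_zero (Real.rpow_pos_of_pos (h.pos Q hQ) a).ne'
  have hu1 : ContDiffOn ℝ 1 u {Q : ℝ × ℝ | |Q.1| < T₀} := by
    refine contDiffOn_one_of_grad (isOpen_slab T₀) ?_ ?_ h.grad_u
    · exact (hR.continuousOn.add hS.continuousOn).div_const 2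
    · refine (hR.continuousOn.sub hS.continuousOn).div
        (continuousOn_const.mul (hu0.rpow_const fun Q hQ => Or.inl (h.pos Q hQ).ne')) hne
  rw [show (2 : WithTop ℕ∞) = 1 + 1 from rfl, contDiffOn_succ_iff_fderiv_of_isOpen (isOpen_slab T₀)]
  refine ⟨fun Q hQ => (h.grad_u Q hQ).differentiableAt.differentiableWithinAt, by simp, ?_⟩
  refine ContDiffOn.congr (f := fun Q => grad ((R Q + S Q) / 2) ((R Q - S Q) / (2 * u Q ^ a))) ?_
    (fun Q hQ => (h.grad_u Q hQ).fderiv)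
  have h1 : ContDiffOn ℝ 1 (fun Q => (R Q + S Q) / 2) {Q : ℝ × ℝ | |Q.1| < T₀} :=
    (hR.add hS).div_const 2
  have h2 : ContDiffOn ℝ 1 (fun Q => (R Q - S Q) / (2 * u Q ^ a)) {Q : ℝ × ℝ | |Q.1| < T₀} :=
    (hR.sub hS).div (contDiffOn_const.mul
      (hu1.rpow_const_of_ne fun Q hQ => (h.pos Q hQ).ne')) hne
  unfold grad
  exact (h1.smul contDiffOn_const).add (h2.smul contDiffOn_const)

theorem IsSlabSolution.dt_u
    (h : IsSlabSolution a T₀ F u R S Rt Rx St Sx) (hT : 0 < T) (hTT : T < T₀)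
    {t x : ℝ} (ht : t ∈ Icc 0 T) :
    dt T (fun t x => u (t, x)) t x = (R (t, x) + S (t, x)) / 2 :=
  dt_eq_of_hasDerivAt hT ht (hasDerivAt_fst_of_grad (h.grad_u (t, x) (by
    rw [abs_of_nonneg ht.1]; exact ht.2.trans_lt hTT)))

theorem IsSlabSolution.dx_u
    (h : IsSlabSolution a T₀ F u R S Rt Rx St Sx) (hTT : T < T₀)
    {t x : ℝ} (ht : t ∈ Icc 0 T) :
    dx (fun t x => u (t, x)) t x = (R (t, x) - S (t, x)) / (2 * u (t, x) ^ a) :=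
  (hasDerivAt_snd_of_grad (h.grad_u (t, x) (by
    rw [abs_of_nonneg ht.1]; exact ht.2.trans_lt hTT))).deriv

theorem IsSlabSolution.riemannInv_one
    (h : IsSlabSolution a T₀ F u R S Rt Rx St Sx) (hT : 0 < T) (hTT : T < T₀)
    {t x : ℝ} (ht : t ∈ Icc 0 T) :
    riemannInv a 1 T (fun t x => u (t, x)) t x = R (t, x) := by
  have hpos := Real.rpow_pos_of_pos (h.pos (t, x) (by
    rw [abs_of_nonneg ht.1]; exact ht.2.trans_lt hTT)) a
  rw [riemannInv, h.dt_u hT hTT ht, h.dx_u hTT ht]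
  field_simp
  ring

theorem IsSlabSolution.riemannInv_neg_one
    (h : IsSlabSolution a T₀ F u R S Rt Rx St Sx) (hT : 0 < T) (hTT : T < T₀)
    {t x : ℝ} (ht : t ∈ Icc 0 T) :
    riemannInv a (-1) T (fun t x => u (t, x)) t x = S (t, x) := by
  have hpos := Real.rpow_pos_of_pos (h.pos (t, x) (by
    rw [abs_of_nonneg ht.1]; exact ht.2.trans_lt hTT)) a
  rw [riemannInv, h.dt_u hT hTT ht, h.dx_u hTT ht]
  field_simp
  ring

theorem IsSlabSolution.dt_riemannInv_one
    (h : IsSlabSolution a T₀ F u R S Rt Rx St Sx) (hT : 0 < T) (hTT : T < T₀)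
    {t x : ℝ} (ht : t ∈ Icc 0 T) :
    dt T (riemannInv a 1 T (fun t x => u (t, x))) t x = Rt (t, x) := by
  rw [dt_congr (v' := fun t x => R (t, x)) ht fun s hs => h.riemannInv_one hT hTT hs]
  exact dt_eq_of_hasDerivAt hT ht (hasDerivAt_fst_of_grad (h.grad_R (t, x) (by
    rw [abs_of_nonneg ht.1]; exact ht.2.trans_lt hTT)))

theorem IsSlabSolution.dt_riemannInv_neg_one
    (h : IsSlabSolution a T₀ F u R S Rt Rx St Sx) (hT : 0 < T) (hTT : T < T₀)
    {t x : ℝ} (ht : t ∈ Icc 0 T) :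
    dt T (riemannInv a (-1) T (fun t x => u (t, x))) t x = St (t, x) := by
  rw [dt_congr (v' := fun t x => S (t, x)) ht fun s hs => h.riemannInv_neg_one hT hTT hs]
  exact dt_eq_of_hasDerivAt hT ht (hasDerivAt_fst_of_grad (h.grad_S (t, x) (by
    rw [abs_of_nonneg ht.1]; exact ht.2.trans_lt hTT)))

theorem IsSlabSolution.dx_riemannInv_one
    (h : IsSlabSolution a T₀ F u R S Rt Rx St Sx) (hT : 0 < T) (hTT : T < T₀)
    {t x : ℝ} (ht : t ∈ Icc 0 T) :
    dx (riemannInv a 1 T (fun t x => u (t, x))) t x = Rx (t, x) := by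
  rw [dx, funext fun y => h.riemannInv_one hT hTT ht (x := y)]
  exact (hasDerivAt_snd_of_grad (h.grad_R (t, x) (by
    rw [abs_of_nonneg ht.1]; exact ht.2.trans_lt hTT))).deriv

theorem IsSlabSolution.dx_riemannInv_neg_one
    (h : IsSlabSolution a T₀ F u R S Rt Rx St Sx) (hT : 0 < T) (hTT : T < T₀)
    {t x : ℝ} (ht : t ∈ Icc 0 T) :
    dx (riemannInv a (-1) T (fun t x => u (t, x))) t x = Sx (t, x) := by
  rw [dx, funext fun y => h.riemannInv_neg_one hT hTT ht (x := y)]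
  exact (hasDerivAt_snd_of_grad (h.grad_S (t, x) (by
    rw [abs_of_nonneg ht.1]; exact ht.2.trans_lt hTT))).deriv

/-- Half the sum of the equations for R and S is the wave equation, because u_t = (R + S)/2 and
u^(2a) u_x = u^a (R - S)/2. -/
theorem IsSlabSolution.isPositiveClassicalSolution
    (h : IsSlabSolution a T₀ F u R S Rt Rx St Sx) (hT : 0 < T) (hTT : T < T₀)
    {u₀ u₁ : ℝ → ℝ} (hu₀ : ∀ x, u (0, x) = u₀ x)
    (hu₁ : ∀ x, R (0, x) + S (0, x) = 2 * u₁ x) :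
    IsPositiveClassicalSolution a F u₀ u₁ T (fun t x => u (t, x)) := by
  have hmem : ∀ t ∈ Icc 0 T, ∀ x : ℝ, |((t, x) : ℝ × ℝ).1| < T₀ := fun t ht x => by
    rw [abs_of_nonneg ht.1]; exact ht.2.trans_lt hTT
  refine ⟨?_, fun t ht x => h.pos _ (hmem t ht x), fun t ht' x => ?_, hu₀, fun x => ?_⟩
  · exact h.contDiffOn_u.mono fun Q hQ => hmem Q.1 hQ.1 Q.2
  · have ht : t ∈ Icc 0 T := Ioc_subset_Icc_self ht'
    have hQ := hmem t ht x
    have hu := h.pos _ hQ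
    have hua := Real.rpow_pos_of_pos hu a
    have e1 : dt T (dt T fun t x => u (t, x)) t x = (Rt (t, x) + St (t, x)) / 2 := by
      rw [dt_congr (v' := fun t x => (R (t, x) + S (t, x)) / 2) ht fun s hs => h.dt_u hT hTT hs]
      exact dt_eq_of_hasDerivAt hT ht (((hasDerivAt_fst_of_grad (h.grad_R _ hQ)).add
        (hasDerivAt_fst_of_grad (h.grad_S _ hQ))).div_const 2)
    have hpow : ∀ y, u (t, y) ^ (2 * a) * dx (fun t x => u (t, x)) t y =
        u (t, y) ^ a * (R (t, y) - S (t, y)) / 2 := fun y => by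
      have hy := h.pos _ (hmem t ht y)
      have hya := Real.rpow_pos_of_pos hy a
      rw [h.dx_u hTT ht, two_mul, Real.rpow_add hy]
      field_simp
    have e2 : dx (fun s y => u (s, y) ^ (2 * a) * dx (fun t x => u (t, x)) s y) t x =
        ((R (t, x) - S (t, x)) / (2 * u (t, x) ^ a) * a * u (t, x) ^ (a - 1) *
          (R (t, x) - S (t, x)) + u (t, x) ^ a * (Rx (t, x) - Sx (t, x))) / 2 := by
      rw [dx, funext hpow]
      exact ((((hasDerivAt_snd_of_grad (h.grad_u _ hQ)).rpow_const (Or.inl hu.ne')).mul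
        ((hasDerivAt_snd_of_grad (h.grad_R _ hQ)).sub
        (hasDerivAt_snd_of_grad (h.grad_S _ hQ)))).div_const 2).deriv
    rw [e1, e2, h.dx_u hTT ht, Real.rpow_sub_one hu.ne']
    have hR := h.eq_R _ hQ
    have hS := h.eq_S _ hQ
    simp only [riemannSource] at hR hS
    have hR' : Rt (t, x) = u (t, x) ^ a * Rx (t, x) + (a / (2 * u (t, x)) * (R (t, x) - S (t, x)) *
      R (t, x) + F (u (t, x)) / (2 * u (t, x) ^ a) * (R (t, x) - S (t, x))) := by linarith
    have hS' : St (t, x) = -(u (t, x) ^ a * Sx (t, x)) - (a / (2 * u (t, x)) *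
      (R (t, x) - S (t, x)) * S (t, x) + F (u (t, x)) / (2 * u (t, x) ^ a) *
      (R (t, x) - S (t, x))) + 2 * (F (u (t, x)) / (2 * u (t, x) ^ a) *
      (R (t, x) - S (t, x))) := by linarith
    rw [hR', hS']
    field_simp
    ring
  · rw [h.dt_u hT hTT ⟨le_rfl, hT.le⟩, hu₁]
    ring

end Slab

/-! ### Travel time -/

/-- The travel-time parametrization for a positive bounded speed. -/
theorem exists_travelTime {k : ℝ → ℝ} (hk : Continuous k) (hpos : ∀ x, 0 < k x) {K : ℝ}
    (hK : ∀ x, k x ≤ K) :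
    ∃ χ : ℝ → ℝ, (∀ y, HasDerivAt χ (k (χ y)) y) ∧ Function.Surjective χ ∧
      ∀ R, ∃ N, ∀ y, |χ y| ≤ R → |y| ≤ N := by
  have hK0 : 0 < K := (hpos 0).trans_le (hK 0)
  have hkc : Continuous (fun x => (k x)⁻¹) := hk.inv₀ fun x => (hpos x).ne'
  set Y : ℝ → ℝ := fun x => ∫ s in (0 : ℝ)..x, (k s)⁻¹ with hY
  have hYd : ∀ x, HasDerivAt Y (k x)⁻¹ x := fun x =>
    intervalIntegral.integral_hasDerivAt_right (hkc.intervalIntegrable _ _)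
      (hkc.stronglyMeasurableAtFilter _ _) hkc.continuousAt
  have hYc : Continuous Y := continuous_iff_continuousAt.2 fun x => (hYd x).continuousAt
  have hYm : StrictMono Y := strictMono_of_hasDerivAt_pos hYd fun x => inv_pos.2 (hpos x)
  -- The bounded speed gives Y' ≥ 1/K; the resulting linear growth makes Y onto, hence χ = Y⁻¹ is
  -- defined on the whole line.
  have hmono : Monotone (fun x => Y x - K⁻¹ * x) := by
    have hd : ∀ x, HasDerivAt (fun x => Y x - K⁻¹ * x) ((k x)⁻¹ - K⁻¹ * 1) x := fun x =>
      (hYd x).sub ((hasDerivAt_id x).const_mul K⁻¹)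
    refine monotone_of_deriv_nonneg (fun x => (hd x).differentiableAt) fun x => ?_
    rw [(hd x).deriv, mul_one, sub_nonneg]
    exact inv_anti₀ (hpos x) (hK x)
  have hY0 : Y 0 = 0 := by simp [hY]
  have hKi : 0 < K⁻¹ := inv_pos.2 hK0
  have htop : Tendsto Y atTop atTop := by
    refine tendsto_atTop_mono' atTop ?_ (tendsto_id.const_mul_atTop hKi)
    filter_upwards [eventually_ge_atTop 0] with x hx
    have := hmono hx
    simp only [hY0, mul_zero, sub_zero, id] at this ⊢
    linarith
  have hbot : Tendsto Y atBot atBot := by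
    refine tendsto_atBot_mono' atBot ?_ (tendsto_id.const_mul_atBot hKi)
    filter_upwards [eventually_le_atBot 0] with x hx
    have := hmono hx
    simp only [hY0, mul_zero, sub_zero, id] at this ⊢
    linarith
  have hsurj : Function.Surjective Y := hYc.surjective htop hbot
  set e := hYm.orderIsoOfSurjective Y hsurj with he
  have hleft : ∀ x, e.symm (Y x) = x := fun x => e.symm_apply_apply x
  have hright : ∀ y, Y (e.symm y) = y := fun y => e.apply_symm_apply y
  refine ⟨e.symm, fun y => ?_, e.symm.surjective, fun R => ⟨max |Y R| |Y (-R)|, fun y hy => ?_⟩⟩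
  · have := (hYd (e.symm y)).of_local_left_inverse e.symm.continuous.continuousAt
      (inv_ne_zero (hpos _).ne') (Eventually.of_forall hright)
    rwa [inv_inv] at this
  · rw [abs_le] at hy
    have h1 := hYm.monotone hy.1
    have h2 := hYm.monotone hy.2
    rw [hright] at h1 h2
    rw [abs_le]
    constructor
    · exact (neg_le_neg (le_max_right _ _)).trans ((neg_abs_le _).trans h1)
    · exact h2.trans ((le_abs_self _).trans (le_max_left _ _))

/-! ### Weights -/

section Weights

theorem one_le_bracket (x : ℝ) : 1 ≤ bracket x := by
  unfold bracket
  rw [Real.one_le_sqrt]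
  nlinarith [sq_nonneg x]

theorem bracket_pos (x : ℝ) : 0 < bracket x := one_pos.trans_le (one_le_bracket x)

theorem bracket_le_mul {x y H : ℝ} (h : |x - y| ≤ H) : bracket x ≤ (1 + H) * bracket y := by
  have hH : 0 ≤ H := (abs_nonneg _).trans h
  have h1 := one_le_bracket y
  have hy : |y| ≤ bracket y := by
    unfold bracket
    exact Real.abs_le_sqrt (by linarith)
  have hsq : bracket y ^ 2 = 1 + y ^ 2 := Real.sq_sqrt (by positivity)
  have hx : bracket x ≤ bracket y + H := by
    conv_lhs => unfold bracket
    rw [Real.sqrt_le_left (by positivity)]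
    have hxy : |x| ≤ |y| + H := by
      have := abs_add_le_add h (le_refl |y|)
      rw [sub_add_cancel] at this
      linarith
    have : x ^ 2 ≤ (|y| + H) ^ 2 := by
      rw [← sq_abs x]
      gcongr
    nlinarith [sq_abs y]
  nlinarith

theorem bracket_rpow_neg_le {x y H b : ℝ} (hb : 0 ≤ b) (h : |x - y| ≤ H) :
    bracket y ^ (-b) ≤ (1 + H) ^ b * bracket x ^ (-b) := by
  have hH : 0 ≤ H := (abs_nonneg _).trans h
  have h1 := bracket_le_mul h
  rw [Real.rpow_neg (bracket_pos y).le, Real.rpow_neg (bracket_pos x).le, ← div_eq_mul_inv,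
    inv_eq_one_div, div_le_div_iff₀ (Real.rpow_pos_of_pos (bracket_pos y) b)
    (Real.rpow_pos_of_pos (bracket_pos x) b), one_mul,
    ← Real.mul_rpow (by positivity) (bracket_pos y).le]
  exact Real.rpow_le_rpow (bracket_pos x).le h1 hb

variable {a α β c₁ c₂ x u : ℝ}

theorem gammaExp_nonneg (hα : 0 ≤ α) : 0 ≤ gammaExp a α := by
  unfold gammaExp
  split_ifs with h
  · exact le_rfl
  · exact mul_nonneg (by linarith) hα

/-- This is the role of α ≤ β: the Riemann invariants divided by u₀ stay bounded. -/
theorem bracket_div_le (hαβ : α ≤ β) (hc₁ : 0 < c₁) (hu : c₁ * bracket x ^ (-α) ≤ u) :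
    bracket x ^ (-β) / u ≤ 1 / c₁ := by
  have hb := Real.rpow_pos_of_pos (bracket_pos x) (-α)
  have hu0 : 0 < u := (mul_pos hc₁ hb).trans_le hu
  rw [div_le_div_iff₀ hu0 hc₁, one_mul]
  refine le_trans ?_ hu
  rw [mul_comm]
  gcongr
  exact one_le_bracket x

/-- The exponents satisfy γ + aα ≤ β: for a ≥ 1 this is aα ≤ β, and for a < 1 the left side equals
α. It lets lower order terms absorb the division by u^a. -/
theorem bracket_div_rpow_le (ha : 0 ≤ a) (hαβ : α ≤ β) (haαβ : a * α ≤ β)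
    (hc₁ : 0 < c₁) (hu : c₁ * bracket x ^ (-α) ≤ u) :
    bracket x ^ (-β) / u ^ a ≤ (c₁ ^ a)⁻¹ * bracket x ^ (-gammaExp a α) := by
  have hb := Real.rpow_pos_of_pos (bracket_pos x) (-α)
  have hu0 : 0 < u := (mul_pos hc₁ hb).trans_le hu
  have hua : c₁ ^ a * bracket x ^ (-(a * α)) ≤ u ^ a := by
    have := Real.rpow_le_rpow (mul_pos hc₁ hb).le hu ha
    rwa [Real.mul_rpow hc₁.le hb.le, ← Real.rpow_mul (bracket_pos x).le,
      show -α * a = -(a * α) by ring] at this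
  have hexp : gammaExp a α + a * α ≤ β := by
    unfold gammaExp
    split_ifs with h
    · linarith
    · linarith
  have hca : 0 < c₁ ^ a := Real.rpow_pos_of_pos hc₁ a
  rw [div_le_iff₀ (Real.rpow_pos_of_pos hu0 a)]
  calc bracket x ^ (-β) ≤ bracket x ^ (-(gammaExp a α + a * α)) := by
        gcongr
        exact one_le_bracket x
    _ = bracket x ^ (-gammaExp a α) * bracket x ^ (-(a * α)) := by
        rw [← Real.rpow_add (bracket_pos x)]
        congr 1
        ring
    _ = (c₁ ^ a)⁻¹ * bracket x ^ (-gammaExp a α) * (c₁ ^ a * bracket x ^ (-(a * α))) := by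
        field_simp
    _ ≤ _ := by
        have := Real.rpow_pos_of_pos (bracket_pos x) (-gammaExp a α)
        gcongr

/-- For a ≥ 1 the power u^(a-1) is bounded by the upper bound of u; for a < 1 it may grow like
⟨x⟩^((1-a)α), and γ is exactly the compensating exponent. The sum on the right covers both cases. -/
theorem bracket_mul_rpow_le (hc₁ : 0 < c₁) (hu : c₁ * bracket x ^ (-α) ≤ u) (hu2 : u ≤ c₂) :
    bracket x ^ (-gammaExp a α) * (u ^ a / u) ≤ c₂ ^ (a - 1) + c₁ ^ (a - 1) := by
  have hb := Real.rpow_pos_of_pos (bracket_pos x) (-α)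
  have hu0 : 0 < u := (mul_pos hc₁ hb).trans_le hu
  have hc₂ : 0 < c₂ := hu0.trans_le hu2
  have p1 : 0 < c₂ ^ (a - 1) := Real.rpow_pos_of_pos hc₂ _
  have p2 : 0 < c₁ ^ (a - 1) := Real.rpow_pos_of_pos hc₁ _
  rw [← Real.rpow_sub_one hu0.ne']
  unfold gammaExp
  split_ifs with h
  · rw [neg_zero, Real.rpow_zero, one_mul]
    have := Real.rpow_le_rpow hu0.le hu2 (sub_nonneg.2 h)
    linarith
  · have h1 := Real.rpow_le_rpow_of_nonpos (mul_pos hc₁ hb) hu (by linarith : a - 1 ≤ 0)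
    rw [Real.mul_rpow hc₁.le hb.le, ← Real.rpow_mul (bracket_pos x).le] at h1
    have p3 := Real.rpow_pos_of_pos (bracket_pos x) (-((1 - a) * α))
    calc _ ≤ bracket x ^ (-((1 - a) * α)) * (c₁ ^ (a - 1) * bracket x ^ (-α * (a - 1))) := by
          gcongr
      _ = c₁ ^ (a - 1) * (bracket x ^ (-((1 - a) * α)) * bracket x ^ (-α * (a - 1))) := by ring
      _ = c₁ ^ (a - 1) := by
          rw [← Real.rpow_add (bracket_pos x), show -((1 - a) * α) + -α * (a - 1) = 0 by ring,
            Real.rpow_zero, mul_one]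
      _ ≤ _ := by linarith

end Weights

/-! ### The data in logarithmic and travel-time variables -/

section Data

variable {a α β c₁ c₂ c₃ c₄ : ℝ} {u₀ u₁ : ℝ → ℝ}

theorem AdmissibleData.pos (h : AdmissibleData a α β c₁ c₂ c₃ c₄ u₀ u₁) (hc₁ : 0 < c₁) (x : ℝ) :
    0 < u₀ x :=
  (mul_pos hc₁ (Real.rpow_pos_of_pos (bracket_pos x) _)).trans_le (h.lower x)

theorem AdmissibleData.contDiff_riemannData (h : AdmissibleData a α β c₁ c₂ c₃ c₄ u₀ u₁)
    (hc₁ : 0 < c₁) (σ : ℝ) : ContDiff ℝ 1 (riemannData a σ u₀ u₁) := by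
  have h1 : ContDiff ℝ 1 u₀ := h.contDiff_u₀.of_le (by norm_num)
  have h2 : ContDiff ℝ 1 (deriv u₀) := by
    have := h.contDiff_u₀
    rw [show (2 : WithTop ℕ∞) = 1 + 1 from rfl, contDiff_succ_iff_deriv] at this
    exact this.2.2
  have h3 : ContDiff ℝ 1 (fun x => u₀ x ^ a) := h1.rpow_const_of_ne fun x => (h.pos hc₁ x).ne'
  exact h.isC1b_u₁.1.add (contDiff_const.mul (h3.mul h2))

/-- The nonlinearity as a function of `log u`. -/
noncomputable def leviFun (a : ℝ) (F : ℝ → ℝ) (v : ℝ) : ℝ := F (Real.exp v) / (2 * Real.exp (a * v))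

theorem LeviCondition.contDiff_leviFun {CF F : ℝ → ℝ} (h : LeviCondition a CF F) :
    ContDiff ℝ 1 (leviFun a F) := by
  have h1 : ContDiff ℝ 1 (fun v => F (Real.exp v)) := by
    rw [← contDiffOn_univ]
    exact h.contDiffOn.comp Real.contDiff_exp.contDiffOn fun v _ => Real.exp_pos v
  refine h1.div (by fun_prop) fun v => ?_
  have := Real.exp_pos (a * v)
  positivity

theorem LeviCondition.abs_leviFun_le {CF F : ℝ → ℝ} (h : LeviCondition a CF F) {K v : ℝ}
    (hv : v ≤ K) : |leviFun a F v| ≤ CF (Real.exp K) / 2 := by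
  have hθ : Real.exp v ∈ Ioc 0 (Real.exp K) := ⟨Real.exp_pos v, Real.exp_le_exp.2 hv⟩
  have h1 := h.bound _ (Real.exp_pos K) _ hθ
  have h2 := Real.exp_pos (a * v)
  rw [← exp_mul_eq_rpow] at h1
  rw [leviFun, abs_div, abs_of_pos (by positivity : 0 < 2 * Real.exp (a * v)),
    div_le_div_iff₀ (by positivity) two_pos]
  linarith

/-- With θ = e^v one has f' = θF'(θ)/(2θ^a) - a f; the Levi conditions bound both terms by
scale-invariant quantities, however negative v is. -/
theorem LeviCondition.abs_deriv_leviFun_le {CF F : ℝ → ℝ} (h : LeviCondition a CF F) (ha : 0 ≤ a)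
    {K v : ℝ} (hv : v ≤ K) :
    |deriv (leviFun a F) v| ≤ CF (Real.exp K) / 2 + a * (CF (Real.exp K) / 2) := by
  have hθ : Real.exp v ∈ Ioc 0 (Real.exp K) := ⟨Real.exp_pos v, Real.exp_le_exp.2 hv⟩
  have h1 := h.bound_deriv _ (Real.exp_pos K) _ hθ
  have h2 := Real.exp_pos (a * v)
  have hFd : HasDerivAt F (deriv F (Real.exp v)) (Real.exp v) :=
    ((h.contDiffOn.differentiableOn one_ne_zero).differentiableAt
      (Ioi_mem_nhds (Real.exp_pos v))).hasDerivAt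
  have hd := ((hFd.comp v (Real.hasDerivAt_exp v)).div
    ((((hasDerivAt_id v).const_mul a).exp).const_mul 2) (by positivity)).deriv
  have heq : deriv (leviFun a F) v =
      deriv F (Real.exp v) * Real.exp v / (2 * Real.exp (a * v)) - a * leviFun a F v := by
    refine hd.trans ?_
    simp only [Function.comp, id, leviFun]
    field_simp
  rw [heq]
  refine abs_sub_le_add ?_ (abs_mul_le_mul (abs_of_nonneg ha).le (h.abs_leviFun_le hv))
  rw [abs_div, abs_of_pos (by positivity : 0 < 2 * Real.exp (a * v)),
    div_le_div_iff₀ (by positivity) two_pos, abs_mul, abs_of_pos (Real.exp_pos v)]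
  have h3 : Real.exp v ^ (a - 1) * Real.exp v = Real.exp (a * v) := by
    rw [Real.rpow_sub_one (Real.exp_pos v).ne', div_mul_cancel₀ _ (Real.exp_pos v).ne',
      exp_mul_eq_rpow]
  have h4 := mul_le_mul_of_nonneg_right h1 (Real.exp_pos v).le
  rw [mul_assoc, h3] at h4
  linarith

/-- The bound for the data in the travel-time coordinate. -/
noncomputable def dataBound (a c₁ c₂ c₃ c₄ : ℝ) : ℝ :=
  c₃ / c₁ + c₄ * (c₂ ^ (a - 1) + c₁ ^ (a - 1)) + c₃ / c₁ * (c₃ / c₁)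

theorem dataBound_nonneg (hc₁ : 0 < c₁) (hc₂ : 0 < c₂) (hc₃ : 0 < c₃) (hc₄ : 0 < c₄) :
    0 ≤ dataBound a c₁ c₂ c₃ c₄ := by
  unfold dataBound; positivity

/-- The data in the travel-time coordinate, with weighted bounds. -/
theorem AdmissibleData.exists_charData (h : AdmissibleData a α β c₁ c₂ c₃ c₄ u₀ u₁) {CF F : ℝ → ℝ}
    (hF : LeviCondition a CF F) (hCF : ∀ K, 0 < K → 0 < CF K) (ha : 0 ≤ a) (hαβ : α ≤ β)
    (hc₁ : 0 < c₁) (hc₂ : 0 < c₂) (hc₃ : 0 < c₃) (hc₄ : 0 < c₄) :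
    ∃ w₀ ρ₀ σ₀ χ : ℝ → ℝ,
      CharData a (Real.log c₂) (dataBound a c₁ c₂ c₃ c₄)
        (CF (Real.exp (Real.log c₂ + 1)) / 2 + a * (CF (Real.exp (Real.log c₂ + 1)) / 2))
        (leviFun a F) w₀ ρ₀ σ₀ χ ∧ Function.Surjective χ ∧ (∀ R, ∃ N, ∀ y, |χ y| ≤ R → |y| ≤ N) ∧
      ∀ y, Real.exp (w₀ y) = u₀ (χ y) ∧
        u₀ (χ y) * ρ₀ y = riemannData a 1 u₀ u₁ (χ y) ∧
        u₀ (χ y) * σ₀ y = riemannData a (-1) u₀ u₁ (χ y) ∧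
        |deriv ρ₀ y| ≤ c₄ * bracket (χ y) ^ (-gammaExp a α) * (u₀ (χ y) ^ a / u₀ (χ y)) +
          c₃ / c₁ * (c₃ * bracket (χ y) ^ (-β) / u₀ (χ y)) ∧
        |deriv σ₀ y| ≤ c₄ * bracket (χ y) ^ (-gammaExp a α) * (u₀ (χ y) ^ a / u₀ (χ y)) +
          c₃ / c₁ * (c₃ * bracket (χ y) ^ (-β) / u₀ (χ y)) := by
  have hpos := h.pos hc₁
  have hu0c : ContDiff ℝ 1 u₀ := h.contDiff_u₀.of_le (by norm_num)
  have hu0d : ∀ x, HasDerivAt u₀ (deriv u₀ x) x := fun x =>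
    (hu0c.differentiable one_ne_zero x).hasDerivAt
  have hkc : Continuous (fun x => u₀ x ^ a) :=
    hu0c.continuous.rpow_const fun x => Or.inl (hpos x).ne'
  obtain ⟨χ, hχd, hχs, hχN⟩ := exists_travelTime hkc
    (fun x => Real.rpow_pos_of_pos (hpos x) a) (K := c₂ ^ a)
    (fun x => Real.rpow_le_rpow (hpos x).le (h.upper x) ha)
  have hχc : Continuous χ := continuous_iff_continuousAt.2 fun y => (hχd y).continuousAt
  have hχ1 : ContDiff ℝ 1 χ := by
    rw [contDiff_one_iff_deriv]
    refine ⟨fun y => (hχd y).differentiableAt, ?_⟩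
    rw [show deriv χ = fun y => u₀ (χ y) ^ a from funext fun y => (hχd y).deriv]
    exact hkc.comp hχc
  set w₀ : ℝ → ℝ := fun y => Real.log (u₀ (χ y)) with hw₀
  have hexp : ∀ y, Real.exp (w₀ y) = u₀ (χ y) := fun y => Real.exp_log (hpos _)
  set ρ₀ : ℝ → ℝ := fun y => riemannData a 1 u₀ u₁ (χ y) / u₀ (χ y) with hρ₀
  set σ₀ : ℝ → ℝ := fun y => riemannData a (-1) u₀ u₁ (χ y) / u₀ (χ y) with hσ₀
  have hw0d : ∀ y, HasDerivAt w₀ ((ρ₀ y - σ₀ y) / 2) y := fun y => by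
    refine (((hu0d (χ y)).comp y (hχd y)).log (hpos _).ne').congr_deriv ?_
    simp only [hρ₀, hσ₀, riemannData, Function.comp_apply]
    have := (hpos (χ y)).ne'
    field_simp
    ring
  -- one Riemann invariant
  have key : ∀ s : ℝ, s = 1 ∨ s = -1 → ∀ y,
      |riemannData a s u₀ u₁ (χ y) / u₀ (χ y)| ≤ c₃ * bracket (χ y) ^ (-β) / u₀ (χ y) ∧
      |riemannData a s u₀ u₁ (χ y) / u₀ (χ y)| ≤ c₃ / c₁ := by
    intro s hs y
    have h1 : |riemannData a s u₀ u₁ (χ y) / u₀ (χ y)| ≤ c₃ * bracket (χ y) ^ (-β) / u₀ (χ y) := by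
      rw [abs_div, abs_of_pos (hpos _)]
      have := hpos (χ y)
      gcongr
      exact h.riemann s hs _
    refine ⟨h1, h1.trans ?_⟩
    rw [mul_div_assoc]
    have := bracket_div_le hαβ hc₁ (h.lower (χ y))
    calc c₃ * (bracket (χ y) ^ (-β) / u₀ (χ y)) ≤ c₃ * (1 / c₁) := by gcongr
      _ = c₃ / c₁ := by ring
  have hw0b : ∀ y, |(ρ₀ y - σ₀ y) / 2| ≤ c₃ / c₁ := fun y => by
    have b1 := abs_le.1 (key 1 (Or.inl rfl) y).2
    have b2 := abs_le.1 (key (-1) (Or.inr rfl) y).2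
    rw [abs_le]; constructor <;> simp only [hρ₀, hσ₀] <;> linarith
  have hder : ∀ s : ℝ, s = 1 ∨ s = -1 → ∀ y,
      |deriv (fun y => riemannData a s u₀ u₁ (χ y) / u₀ (χ y)) y| ≤
        c₄ * bracket (χ y) ^ (-gammaExp a α) * (u₀ (χ y) ^ a / u₀ (χ y)) +
          c₃ / c₁ * (c₃ * bracket (χ y) ^ (-β) / u₀ (χ y)) := by
    intro s hs y
    have hRd : HasDerivAt (riemannData a s u₀ u₁) (deriv (riemannData a s u₀ u₁) (χ y)) (χ y) :=
      ((h.contDiff_riemannData hc₁ s).differentiable one_ne_zero _).hasDerivAt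
    have hq := (hRd.comp y (hχd y)).div ((hu0d (χ y)).comp y (hχd y)) (hpos _).ne'
    -- Quotient rule: the travel time contributes the factor u₀^a, and the logarithmic derivative of
    -- u₀ is w₀' = (ρ₀ - σ₀)/2, already bounded by c₃/c₁.
    have heq : deriv (fun y => riemannData a s u₀ u₁ (χ y) / u₀ (χ y)) y =
        deriv (riemannData a s u₀ u₁) (χ y) * (u₀ (χ y) ^ a / u₀ (χ y)) -
          (ρ₀ y - σ₀ y) / 2 * (riemannData a s u₀ u₁ (χ y) / u₀ (χ y)) := by
      refine hq.deriv.trans ?_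
      have := (hpos (χ y)).ne'
      have e : (ρ₀ y - σ₀ y) / 2 = u₀ (χ y) ^ a * deriv u₀ (χ y) / u₀ (χ y) := by
        simp only [hρ₀, hσ₀, riemannData]
        field_simp
        ring
      rw [e]
      simp only [Function.comp]
      field_simp
    rw [heq]
    refine abs_sub_le_add (abs_mul_le_mul (h.deriv_riemann s hs _) ?_)
      (abs_mul_le_mul (hw0b y) (key s hs y).1)
    exact (abs_of_pos (div_pos (Real.rpow_pos_of_pos (hpos _) a) (hpos _))).le
  have hder' : ∀ s : ℝ, s = 1 ∨ s = -1 → ∀ y,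
      |deriv (fun y => riemannData a s u₀ u₁ (χ y) / u₀ (χ y)) y| ≤ dataBound a c₁ c₂ c₃ c₄ := by
    intro s hs y
    refine (hder s hs y).trans ?_
    have e1 := bracket_mul_rpow_le (a := a) hc₁ (h.lower (χ y)) (h.upper (χ y))
    have e2 := bracket_div_le hαβ hc₁ (h.lower (χ y))
    calc _ = c₄ * (bracket (χ y) ^ (-gammaExp a α) * (u₀ (χ y) ^ a / u₀ (χ y))) +
          c₃ / c₁ * (c₃ * (bracket (χ y) ^ (-β) / u₀ (χ y))) := by ring
      _ ≤ c₄ * (c₂ ^ (a - 1) + c₁ ^ (a - 1)) + c₃ / c₁ * (c₃ * (1 / c₁)) := by gcongr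
      _ ≤ dataBound a c₁ c₂ c₃ c₄ := by
        unfold dataBound
        have : 0 ≤ c₃ / c₁ := by positivity
        rw [mul_one_div]
        linarith
  have hle : c₃ / c₁ ≤ dataBound a c₁ c₂ c₃ c₄ := by
    unfold dataBound
    have : 0 ≤ c₄ * (c₂ ^ (a - 1) + c₁ ^ (a - 1)) + c₃ / c₁ * (c₃ / c₁) := by positivity
    linarith
  have hcd : ∀ s, ContDiff ℝ 1 (fun y => riemannData a s u₀ u₁ (χ y) / u₀ (χ y)) := fun s =>
    ((h.contDiff_riemannData hc₁ s).comp hχ1).div (hu0c.comp hχ1) fun y => (hpos _).ne'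
  have hCF0 := (hCF _ (Real.exp_pos (Real.log c₂ + 1))).le
  refine ⟨w₀, ρ₀, σ₀, χ, ?_, hχs, hχN, fun y => ⟨hexp y, mul_div_cancel₀ _ (hpos _).ne',
    mul_div_cancel₀ _ (hpos _).ne', hder 1 (Or.inl rfl) y, hder (-1) (Or.inr rfl) y⟩⟩
  exact {
    f_contDiff := hF.contDiff_leviFun
    f_le := fun w hw => (hF.abs_leviFun_le hw).trans (le_add_of_nonneg_right (by positivity))
    f_deriv := fun w hw => hF.abs_deriv_leviFun_le ha hw
    ρ_contDiff := hcd 1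
    σ_contDiff := hcd (-1)
    w_le := fun y => Real.log_le_log (hpos _) (h.upper _)
    ρ_le := fun y => (key 1 (Or.inl rfl) y).2.trans hle
    σ_le := fun y => (key (-1) (Or.inr rfl) y).2.trans hle
    ρ_deriv := hder' 1 (Or.inl rfl)
    σ_deriv := hder' (-1) (Or.inr rfl)
    w_deriv := hw0d
    χ_deriv := fun y => by rw [exp_mul_eq_rpow, hexp]; exact hχd y }

end Data

/-! ### Uniqueness by a maximum principle on cones -/

/-- The closed slab `[0, T] × ℝ`. -/
def slab (T : ℝ) : Set (ℝ × ℝ) := Icc 0 T ×ˢ univ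

/-- Uniqueness for weakly coupled transport inequalities, with vanishing initial values, by the
maximum principle on backward cones. -/
theorem eq_zero_of_transport {ι : Type*} [Fintype ι] [Nonempty ι] {T Λ : ℝ}
    {r : ℝ × ℝ → ι → ℝ} {r' : ι → ℝ × ℝ → (ℝ × ℝ →L[ℝ] ℝ)} {l : ι → ℝ × ℝ → ℝ}
    (hd : ∀ i, ∀ Q ∈ slab T, HasFDerivWithinAt (fun Q => r Q i) (r' i Q) (slab T) Q)
    (hl : ∀ i, ∀ Q ∈ slab T, |l i Q| ≤ Λ) (h0 : ∀ x, r (0, x) = 0)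
    (hC : ∀ K ⊆ slab T, IsCompact K → ∃ C, ∀ i, ∀ Q ∈ K, 0 < Q.1 →
      |r' i Q (1, l i Q)| ≤ C * ‖r Q‖) {Q₀ : ℝ × ℝ} (hQ₀ : Q₀ ∈ slab T) : r Q₀ = 0 := by
  obtain ⟨t₀, x₀⟩ := Q₀
  have ht₀ : 0 ≤ t₀ ∧ t₀ ≤ T := hQ₀.1
  have hΛ : 0 ≤ Λ := (abs_nonneg _).trans (hl (Classical.arbitrary ι) _ hQ₀)
  -- The backward cone with apex (t₀, x₀) and slope Λ; no characteristic followed backward in time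
  -- can leave it before t = 0.
  set D : Set (ℝ × ℝ) := {Q | (0 ≤ Q.1 ∧ Q.1 ≤ t₀) ∧ |Q.2 - x₀| ≤ Λ * (t₀ - Q.1)} with hD
  have hDs : D ⊆ slab T := fun Q hQ => ⟨⟨hQ.1.1, hQ.1.2.trans ht₀.2⟩, mem_univ _⟩
  have hDc : IsCompact D := by
    refine (isCompact_Icc.prod (isCompact_closedBall x₀ (Λ * t₀)) :
      IsCompact (Icc 0 t₀ ×ˢ Metric.closedBall x₀ (Λ * t₀))).of_isClosed_subset ?_ ?_
    · have c1 : IsClosed {Q : ℝ × ℝ | 0 ≤ Q.1} := isClosed_le (by fun_prop) (by fun_prop)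
      have c2 : IsClosed {Q : ℝ × ℝ | Q.1 ≤ t₀} := isClosed_le (by fun_prop) (by fun_prop)
      have c3 : IsClosed {Q : ℝ × ℝ | |Q.2 - x₀| ≤ Λ * (t₀ - Q.1)} :=
        isClosed_le (by fun_prop) (by fun_prop)
      exact (c1.inter c2).inter c3
    · rintro Q ⟨h1, h2⟩
      refine ⟨h1, ?_⟩
      rw [Metric.mem_closedBall, Real.dist_eq]
      exact h2.trans (by gcongr; linarith)
  obtain ⟨C, hC⟩ := hC D hDs hDc
  have hrc : ContinuousOn r D := continuousOn_pi.2 fun i Q hQ =>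
    ((hd i Q (hDs hQ)).continuousWithinAt).mono hDs
  -- The exponent C + 1 beats the growth rate C strictly, so that a positive maximum is
  -- contradictory.
  have hφc : ContinuousOn (fun Q : ℝ × ℝ => Real.exp (-(C + 1) * Q.1) * ‖r Q‖) D :=
    (Continuous.continuousOn (by fun_prop)).mul hrc.norm
  have hmem₀ : (t₀, x₀) ∈ D := ⟨⟨ht₀.1, le_rfl⟩, by simp⟩
  obtain ⟨⟨t, x⟩, hQ, hmax⟩ := hDc.exists_isMaxOn ⟨_, hmem₀⟩ hφc
  by_cases hz : ‖r (t, x)‖ = 0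
  · have h1 := hmax hmem₀
    simp only [mem_ofPred_eq, hz, mul_zero] at h1
    have h2 : ‖r (t₀, x₀)‖ ≤ 0 := by
      by_contra hlt
      push Not at hlt
      exact absurd h1 (not_le.2 (mul_pos (Real.exp_pos _) hlt))
    exact norm_le_zero_iff.1 h2
  exfalso
  have hnpos : 0 < ‖r (t, x)‖ := lt_of_le_of_ne (norm_nonneg _) (Ne.symm hz)
  have ht : 0 < t := by
    refine lt_of_le_of_ne hQ.1.1 fun h => hz ?_
    rw [← h, h0, norm_zero]
  obtain ⟨i, hi⟩ := Finite.exists_max (fun i => |r (t, x) i|)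
  have hni : ‖r (t, x)‖ = |r (t, x) i| :=
    le_antisymm ((pi_norm_le_iff_of_nonneg (abs_nonneg _)).2 hi) (norm_le_pi_norm (r (t, x)) i)
  obtain ⟨ε, hε1, hε⟩ : ∃ ε : ℝ, |ε| = 1 ∧ ε * r (t, x) i = |r (t, x) i| := by
    rcases abs_cases (r (t, x) i) with ⟨h1, -⟩ | ⟨h1, -⟩
    · exact ⟨1, by simp, by rw [h1, one_mul]⟩
    · exact ⟨-1, by simp, by rw [h1]; ring⟩
  -- A differentiable function lying below the weighted norm, with equality at the maximum point; it
  -- replaces the norm, which need not be differentiable.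
  set Ψ : ℝ × ℝ → ℝ := fun Q => Real.exp (-(C + 1) * Q.1) * (ε * r Q i) with hΨ
  have hle : ∀ Q, ε * r Q i ≤ ‖r Q‖ := fun Q => by
    calc ε * r Q i ≤ |ε * r Q i| := le_abs_self _
      _ = |r Q i| := by rw [abs_mul, hε1, one_mul]
      _ ≤ ‖r Q‖ := norm_le_pi_norm (r Q) i
  have hΨmax : IsMaxOn Ψ D (t, x) := fun Z hZ => by
    have h1 : Ψ Z ≤ Real.exp (-(C + 1) * Z.1) * ‖r Z‖ := by
      simp only [hΨ]
      have := hle Z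
      gcongr
    have h2 := hmax hZ
    change Ψ Z ≤ Ψ (t, x)
    refine h1.trans (h2.trans_eq ?_)
    simp only [hΨ, hε, hni]
  set L := l i (t, x) with hL
  have hLb : |L| ≤ Λ := hl i _ (hDs hQ)
  -- Going backward along the i-th characteristic direction down to t = 0 stays in the cone because
  -- |L| ≤ Λ; this covers maxima on the boundary of D.
  have htan : (-t, -(t * L)) ∈ posTangentConeAt D (t, x) := by
    refine mem_posTangentConeAt_of_segment_subset ?_
    rw [segment_eq_image']
    rintro _ ⟨θ, hθ, rfl⟩
    have e1 : ((t, x) : ℝ × ℝ) + θ • ((t, x) + (-t, -(t * L)) - (t, x)) =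
        (t - θ * t, x - θ * t * L) := by
      ext <;> simp <;> ring
    change ((t, x) : ℝ × ℝ) + θ • ((t, x) + (-t, -(t * L)) - (t, x)) ∈ D
    rw [e1]
    have hθt : 0 ≤ θ * t := mul_nonneg hθ.1 ht.le
    refine ⟨⟨by nlinarith [hθ.2], by linarith [hQ.1.2]⟩, ?_⟩
    have h1 := hQ.2
    have h2 : |θ * t * L| ≤ θ * t * Λ := by
      rw [abs_mul, abs_of_nonneg hθt]; gcongr
    calc |x - θ * t * L - x₀| = |(x - x₀) - θ * t * L| := by congr 1; ring
      _ ≤ Λ * (t₀ - t) + θ * t * Λ := abs_sub_le_add h1 h2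
      _ = Λ * (t₀ - (t - θ * t)) := by ring
  have hder := ((((hasFDerivAt_fst (𝕜 := ℝ) (p := ((t, x) : ℝ × ℝ))).const_mul
    (-(C + 1))).exp).hasFDerivWithinAt (s := D)).mul
    (((hd i _ (hDs hQ)).mono hDs).const_mul ε)
  have hnon := hΨmax.localize.hasFDerivWithinAt_nonpos hder htan
  have hfin := hC i _ hQ ht
  have hv : ((-t, -(t * L)) : ℝ × ℝ) = (-t) • ((1 : ℝ), L) := by simp
  rw [hv, map_smul] at hnon
  simp only [smul_eq_mul, add_apply, smul_apply, ContinuousLinearMap.coe_fst', mul_one, hε] at hnon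
  have he := Real.exp_pos (-(C + 1) * t)
  have h3 : ε * r' i (t, x) (1, L) ≤ C * |r (t, x) i| := by
    rw [← hni]
    refine le_trans (le_abs_self _) ?_
    rwa [abs_mul, hε1, one_mul]
  have hpos : 0 < |r (t, x) i| := hni ▸ hnpos
  -- The derivative of Ψ in the backward direction: positive by the growth bound, yet nonpositive at
  -- a maximum.
  have h4 : 0 < Real.exp (-(C + 1) * t) * t * ((C + 1) * |r (t, x) i| - ε * r' i (t, x) (1, L)) := by
    refine mul_pos (mul_pos he ht) ?_
    linarith
  linarith

/-- Uniqueness for quasilinear hyperbolic systems in diagonal form. -/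
theorem eqOn_of_diagonal {ι : Type*} [Fintype ι] [Nonempty ι] {T Λ : ℝ} {G : Set (ι → ℝ)}
    (hG : Convex ℝ G) {l N : ι → (ι → ℝ) → ℝ} (hl : ∀ i, ContDiffOn ℝ 1 (l i) G)
    (hN : ∀ i, ContDiffOn ℝ 1 (N i) G) {U V : ℝ × ℝ → ι → ℝ}
    {U' V' : ι → ℝ × ℝ → (ℝ × ℝ →L[ℝ] ℝ)} (hUG : ∀ Q ∈ slab T, U Q ∈ G)
    (hVG : ∀ Q ∈ slab T, V Q ∈ G)
    (hU : ∀ i, ∀ Q ∈ slab T, HasFDerivWithinAt (fun Q => U Q i) (U' i Q) (slab T) Q)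
    (hV : ∀ i, ∀ Q ∈ slab T, HasFDerivWithinAt (fun Q => V Q i) (V' i Q) (slab T) Q)
    (hV' : ∀ i, ContinuousOn (V' i) (slab T))
    (hUeq : ∀ i, ∀ Q ∈ slab T, 0 < Q.1 → U' i Q (1, l i (U Q)) = N i (U Q))
    (hVeq : ∀ i, ∀ Q ∈ slab T, 0 < Q.1 → V' i Q (1, l i (V Q)) = N i (V Q))
    (hΛ : ∀ i, ∀ Q ∈ slab T, |l i (U Q)| ≤ Λ) (h0 : ∀ x, U (0, x) = V (0, x)) :
    EqOn U V (slab T) := by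
  intro Q₀ hQ₀
  have hUc : ContinuousOn U (slab T) := continuousOn_pi.2 fun i Q hQ => (hU i Q hQ).continuousWithinAt
  have hVc : ContinuousOn V (slab T) := continuousOn_pi.2 fun i Q hQ => (hV i Q hQ).continuousWithinAt
  refine sub_eq_zero.1 (eq_zero_of_transport (T := T) (Λ := Λ) (r := fun Q => U Q - V Q)
    (r' := fun i Q => U' i Q - V' i Q) (l := fun i Q => l i (U Q))
    (fun i Q hQ => (hU i Q hQ).sub (hV i Q hQ)) hΛ (fun x => sub_eq_zero.2 (h0 x)) ?_ hQ₀)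
  intro K hK hKc
  have hS : IsCompact (U '' K ∪ V '' K) :=
    (hKc.image_of_continuousOn (hUc.mono hK)).union (hKc.image_of_continuousOn (hVc.mono hK))
  have hSG : U '' K ∪ V '' K ⊆ G := by
    rintro _ (⟨Q, hQ, rfl⟩ | ⟨Q, hQ, rfl⟩)
    · exact hUG Q (hK hQ)
    · exact hVG Q (hK hQ)
  have hlip : ∀ i, ∃ C : ℝ, 0 ≤ C ∧ ∀ Q ∈ K, |N i (U Q) - N i (V Q)| ≤ C * ‖U Q - V Q‖ ∧
      |l i (U Q) - l i (V Q)| ≤ C * ‖U Q - V Q‖ ∧ ‖V' i Q (0, 1)‖ ≤ C := by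
    intro i
    obtain ⟨C₁, hC₁⟩ := ((hN i).locallyLipschitzOn hG).mono hSG
      |>.exists_lipschitzOnWith_of_compact hS
    obtain ⟨C₂, hC₂⟩ := ((hl i).locallyLipschitzOn hG).mono hSG
      |>.exists_lipschitzOnWith_of_compact hS
    obtain ⟨C₃, hC₃⟩ := hKc.exists_bound_of_continuousOn
      (((hV' i).mono hK).clm_apply (continuousOn_const (c := ((0 : ℝ), (1 : ℝ)))))
    refine ⟨max (max C₁ C₂) C₃, le_max_of_le_left (le_max_of_le_left C₁.2), fun Q hQ => ?_⟩
    have mU : U Q ∈ U '' K ∪ V '' K := Or.inl ⟨Q, hQ, rfl⟩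
    have mV : V Q ∈ U '' K ∪ V '' K := Or.inr ⟨Q, hQ, rfl⟩
    refine ⟨?_, ?_, (hC₃ Q hQ).trans (le_max_right _ _)⟩
    · refine (hC₁.norm_sub_le mU mV).trans ?_
      gcongr
      exact (le_max_left _ _).trans (le_max_left _ _)
    · refine (hC₂.norm_sub_le mU mV).trans ?_
      gcongr
      exact (le_max_right _ _).trans (le_max_left _ _)
  choose C hC0 hC using hlip
  obtain ⟨i₀, hi₀⟩ := Finite.exists_max fun i => C i + C i * C i
  refine ⟨C i₀ + C i₀ * C i₀, fun i Q hQ hpos => ?_⟩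
  obtain ⟨h1, h2, h3⟩ := hC i Q hQ
  rw [Real.norm_eq_abs] at h3
  -- V is differentiated along the speed of U; the mismatch of speeds multiplies the x-derivative of
  -- V. Hence only V' has to be continuous and only the speeds of U have to be bounded.
  have hv : ((1 : ℝ), l i (U Q)) = (1, l i (V Q)) + (l i (U Q) - l i (V Q)) • ((0 : ℝ), (1 : ℝ)) := by
    simp
  have e : (U' i Q - V' i Q) (1, l i (U Q)) =
      (N i (U Q) - N i (V Q)) - (l i (U Q) - l i (V Q)) * V' i Q (0, 1) := by
    rw [sub_apply, hUeq i Q (hK hQ) hpos]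
    conv_lhs => rw [hv]
    rw [map_add, map_smul, hVeq i Q (hK hQ) hpos, smul_eq_mul]
    ring
  rw [e]
  have hn := norm_nonneg (U Q - V Q)
  have h4 : |(l i (U Q) - l i (V Q)) * V' i Q (0, 1)| ≤ C i * ‖U Q - V Q‖ * C i := by
    rw [abs_mul]
    have := hC0 i
    gcongr
  calc _ ≤ |N i (U Q) - N i (V Q)| + |(l i (U Q) - l i (V Q)) * V' i Q (0, 1)| := abs_sub _ _
    _ ≤ C i * ‖U Q - V Q‖ + C i * ‖U Q - V Q‖ * C i := add_le_add h1 h4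
    _ = (C i + C i * C i) * ‖U Q - V Q‖ := by ring
    _ ≤ _ := mul_le_mul_of_nonneg_right (hi₀ i) hn

/-! ### Classical solutions as solutions of the diagonal system -/

section Partials

variable {T : ℝ}

theorem derivWithin_of_slab {φ : ℝ × ℝ → ℝ} {φ' : ℝ × ℝ →L[ℝ] ℝ} {t x : ℝ} (hT : 0 < T)
    (ht : t ∈ Icc 0 T) (h : HasFDerivWithinAt φ φ' (slab T) (t, x)) :
    derivWithin (fun s => φ (s, x)) (Icc 0 T) t = φ' (1, 0) := by
  have := h.comp_hasDerivWithinAt (f := fun s => (s, x)) (s := Icc 0 T) t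
    ((hasDerivWithinAt_id t _).prodMk (hasDerivWithinAt_const t _ x))
    (fun s hs => ⟨hs, mem_univ _⟩)
  exact this.derivWithin (uniqueDiffOn_Icc hT t ht)

theorem hasDerivAt_of_slab {φ : ℝ × ℝ → ℝ} {φ' : ℝ × ℝ →L[ℝ] ℝ} {t x : ℝ}
    (ht : t ∈ Icc 0 T) (h : HasFDerivWithinAt φ φ' (slab T) (t, x)) :
    HasDerivAt (fun y => φ (t, y)) (φ' (0, 1)) x := by
  have := h.comp_hasDerivWithinAt (f := fun y => (t, y)) (s := univ) x
    ((hasDerivWithinAt_const x _ t).prodMk (hasDerivWithinAt_id x _))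
    (fun s hs => ⟨ht, mem_univ _⟩)
  exact this.hasDerivAt univ_mem

theorem clm_eq_grad (L : ℝ × ℝ →L[ℝ] ℝ) : L = grad (L (1, 0)) (L (0, 1)) := by
  ext <;> simp

theorem uniqueDiffOn_slab (hT : 0 < T) : UniqueDiffOn ℝ (slab T) :=
  (uniqueDiffOn_Icc hT).prod uniqueDiffOn_univ

/-- Needed for the symmetry of second derivatives on the faces t = 0 and t = T. -/
theorem mem_closure_interior_slab (hT : 0 < T) {Q : ℝ × ℝ} (hQ : Q ∈ slab T) :
    Q ∈ closure (interior (slab T)) := by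
  unfold slab at *
  rw [interior_prod_eq, closure_prod_eq, interior_Icc, closure_Ioo hT.ne, interior_univ,
    closure_univ]
  exact hQ

end Partials

/-- The first derivatives of a classical solution, and the equation, in terms of derivatives on
the slab. -/
theorem IsPositiveClassicalSolution.exists_derivs {a T : ℝ} {F u₀ u₁ : ℝ → ℝ} {v : ℝ → ℝ → ℝ}
    (h : IsPositiveClassicalSolution a F u₀ u₁ T v) (hT : 0 < T) :
    ∃ A B : ℝ × ℝ → (ℝ × ℝ →L[ℝ] ℝ), ContinuousOn A (slab T) ∧ ContinuousOn B (slab T) ∧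
      ∀ Q ∈ slab T,
        HasFDerivWithinAt (fun Q : ℝ × ℝ => v Q.1 Q.2) (grad (dt T v Q.1 Q.2) (dx v Q.1 Q.2))
          (slab T) Q ∧
        HasFDerivWithinAt (fun Q : ℝ × ℝ => dt T v Q.1 Q.2) (A Q) (slab T) Q ∧
        HasFDerivWithinAt (fun Q : ℝ × ℝ => dx v Q.1 Q.2) (B Q) (slab T) Q ∧
        A Q (0, 1) = B Q (1, 0) ∧
        (0 < Q.1 → A Q (1, 0) = 2 * a * v Q.1 Q.2 ^ (2 * a - 1) * dx v Q.1 Q.2 ^ 2 +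
          v Q.1 Q.2 ^ (2 * a) * B Q (0, 1) + F (v Q.1 Q.2) * dx v Q.1 Q.2) := by
  set V : ℝ × ℝ → ℝ := fun Q => v Q.1 Q.2 with hV
  have hu := uniqueDiffOn_slab hT
  have hVc : ContDiffOn ℝ 2 V (slab T) := h.contDiffOn
  have hVd : ∀ Q ∈ slab T, HasFDerivWithinAt V (fderivWithin ℝ V (slab T) Q) (slab T) Q :=
    fun Q hQ => (hVc.differentiableOn two_ne_zero Q hQ).hasFDerivWithinAt
  have hdt : ∀ Q ∈ slab T, dt T v Q.1 Q.2 = fderivWithin ℝ V (slab T) Q (1, 0) := fun Q hQ =>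
    derivWithin_of_slab hT hQ.1 (hVd Q hQ)
  have hdx : ∀ Q ∈ slab T, dx v Q.1 Q.2 = fderivWithin ℝ V (slab T) Q (0, 1) := fun Q hQ =>
    (hasDerivAt_of_slab hQ.1 (hVd Q hQ)).deriv
  have hV' : ContDiffOn ℝ 1 (fderivWithin ℝ V (slab T)) (slab T) :=
    hVc.fderivWithin hu (by norm_num)
  have hAc : ContDiffOn ℝ 1 (fun Q : ℝ × ℝ => dt T v Q.1 Q.2) (slab T) :=
    (hV'.clm_apply contDiffOn_const).congr hdt
  have hBc : ContDiffOn ℝ 1 (fun Q : ℝ × ℝ => dx v Q.1 Q.2) (slab T) :=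
    (hV'.clm_apply contDiffOn_const).congr hdx
  have hAd : ∀ Q ∈ slab T, HasFDerivWithinAt (fun Q : ℝ × ℝ => dt T v Q.1 Q.2)
      (fderivWithin ℝ (fun Q : ℝ × ℝ => dt T v Q.1 Q.2) (slab T) Q) (slab T) Q :=
    fun Q hQ => (hAc.differentiableOn one_ne_zero Q hQ).hasFDerivWithinAt
  have hBd : ∀ Q ∈ slab T, HasFDerivWithinAt (fun Q : ℝ × ℝ => dx v Q.1 Q.2)
      (fderivWithin ℝ (fun Q : ℝ × ℝ => dx v Q.1 Q.2) (slab T) Q) (slab T) Q :=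
    fun Q hQ => (hBc.differentiableOn one_ne_zero Q hQ).hasFDerivWithinAt
  refine ⟨_, _, hAc.continuousOn_fderivWithin hu le_rfl,
    hBc.continuousOn_fderivWithin hu le_rfl, fun Q hQ => ⟨?_, hAd Q hQ, hBd Q hQ, ?_, ?_⟩⟩
  · rw [hdt Q hQ, hdx Q hQ, ← clm_eq_grad]
    exact hVd Q hQ
  · have hV2 : HasFDerivWithinAt (fderivWithin ℝ V (slab T))
        (fderivWithin ℝ (fderivWithin ℝ V (slab T)) (slab T) Q) (slab T) Q :=
      (hV'.differentiableOn one_ne_zero Q hQ).hasFDerivWithinAt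
    have e : ∀ w : ℝ × ℝ, HasFDerivWithinAt (fun Z => fderivWithin ℝ V (slab T) Z w)
        ((fderivWithin ℝ (fderivWithin ℝ V (slab T)) (slab T) Q).flip w) (slab T) Q := fun w => by
      refine (hV2.clm_apply (hasFDerivWithinAt_const w Q (slab T))).congr_fderiv ?_
      ext <;> simp
    have eA := ((e (1, 0)).congr hdt (hdt Q hQ)).fderivWithin (hu Q hQ)
    have eB := ((e (0, 1)).congr hdx (hdx Q hQ)).fderivWithin (hu Q hQ)
    rw [eA, eB]
    have hs : IsSymmSndFDerivWithinAt ℝ V (slab T) Q :=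
      (hVc Q hQ).isSymmSndFDerivWithinAt (by simp) hu (mem_closure_interior_slab hT hQ) hQ
    exact hs.eq _ _
  · intro hpos
    obtain ⟨t, x⟩ := Q
    have heq := h.equation t ⟨hpos, hQ.1.2⟩ x
    have e1 : dt T (dt T v) t x =
        fderivWithin ℝ (fun Q : ℝ × ℝ => dt T v Q.1 Q.2) (slab T) (t, x) (1, 0) :=
      derivWithin_of_slab (φ := fun Q : ℝ × ℝ => dt T v Q.1 Q.2) hT hQ.1 (hAd _ hQ)
    have hvpos := h.pos t hQ.1 x
    have hvd : HasDerivAt (fun y => v t y) (dx v t x) x := by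
      have := hasDerivAt_of_slab hQ.1 (hVd _ hQ)
      rwa [← hdx _ hQ] at this
    have e2 : dx (fun s y => v s y ^ (2 * a) * dx v s y) t x =
        dx v t x * (2 * a) * v t x ^ (2 * a - 1) * dx v t x + v t x ^ (2 * a) *
        fderivWithin ℝ (fun Q : ℝ × ℝ => dx v Q.1 Q.2) (slab T) (t, x) (0, 1) :=
      ((hvd.rpow_const (Or.inl hvpos.ne')).mul
        (hasDerivAt_of_slab (φ := fun Q : ℝ × ℝ => dx v Q.1 Q.2) hQ.1 (hBd _ hQ))).deriv
    rw [← e1, heq, e2]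
    ring

/-- The right-hand side of the diagonal system for `(u, u_t + u ^ a u_x, u_t - u ^ a u_x)`. -/
noncomputable def diagSource (a : ℝ) (F : ℝ → ℝ) : Fin 3 → (Fin 3 → ℝ) → ℝ :=
  ![fun p => (p 1 + p 2) / 2,
    fun p => a * (p 1 - p 2) / (2 * p 0) * p 1 + F (p 0) * (p 1 - p 2) / (2 * p 0 ^ a),
    fun p => -(a * (p 1 - p 2) / (2 * p 0) * p 2) + F (p 0) * (p 1 - p 2) / (2 * p 0 ^ a)]

/-- The characteristic speeds of the diagonal system. -/
noncomputable def diagSpeed (a : ℝ) : Fin 3 → (Fin 3 → ℝ) → ℝ :=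
  ![fun _ => 0, fun p => -p 0 ^ a, fun p => p 0 ^ a]

theorem contDiffOn_diagSpeed (a : ℝ) (i : Fin 3) :
    ContDiffOn ℝ 1 (diagSpeed a i) {p | 0 < p 0} := by
  have h0 : ContDiffOn ℝ 1 (fun p : Fin 3 → ℝ => p 0) {p | 0 < p 0} :=
    (contDiff_apply ℝ ℝ 0).contDiffOn
  have ha : ContDiffOn ℝ 1 (fun p : Fin 3 → ℝ => p 0 ^ a) {p | 0 < p 0} :=
    h0.rpow_const_of_ne fun p hp => ne_of_gt hp
  fin_cases i
  · exact contDiffOn_const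
  · exact ha.neg
  · exact ha

theorem contDiffOn_diagSource {a : ℝ} {F : ℝ → ℝ} (hF : ContDiffOn ℝ 1 F (Ioi 0)) (i : Fin 3) :
    ContDiffOn ℝ 1 (diagSource a F i) {p | 0 < p 0} := by
  have h0 : ∀ j, ContDiffOn ℝ 1 (fun p : Fin 3 → ℝ => p j) {p | 0 < p 0} := fun j =>
    (contDiff_apply ℝ ℝ j).contDiffOn
  have ha : ContDiffOn ℝ 1 (fun p : Fin 3 → ℝ => 2 * p 0 ^ a) {p | 0 < p 0} :=
    contDiffOn_const.mul ((h0 0).rpow_const_of_ne fun p hp => ne_of_gt hp)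
  have hFc : ContDiffOn ℝ 1 (fun p : Fin 3 → ℝ => F (p 0)) {p | 0 < p 0} :=
    hF.comp (h0 0) fun p hp => hp
  have hd := (h0 1).sub (h0 2)
  have hA : ContDiffOn ℝ 1 (fun p : Fin 3 → ℝ => a * (p 1 - p 2) / (2 * p 0)) {p | 0 < p 0} :=
    (contDiffOn_const.mul hd).div (contDiffOn_const.mul (h0 0)) fun p hp =>
      mul_ne_zero two_ne_zero (ne_of_gt hp)
  have hB : ContDiffOn ℝ 1 (fun p : Fin 3 → ℝ => F (p 0) * (p 1 - p 2) / (2 * p 0 ^ a))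
      {p | 0 < p 0} :=
    (hFc.mul hd).div ha fun p hp => mul_ne_zero two_ne_zero (Real.rpow_pos_of_pos hp a).ne'
  fin_cases i
  · exact ((h0 1).add (h0 2)).div_const 2
  · exact (hA.mul (h0 1)).add hB
  · exact (hA.mul (h0 2)).neg.add hB

/-- A positive classical solution solves the diagonal system. -/
theorem IsPositiveClassicalSolution.exists_diagonal {a T : ℝ} {F u₀ u₁ : ℝ → ℝ} {v : ℝ → ℝ → ℝ}
    (h : IsPositiveClassicalSolution a F u₀ u₁ T v) (hT : 0 < T) :
    ∃ (P : ℝ × ℝ → Fin 3 → ℝ) (P' : Fin 3 → ℝ × ℝ → (ℝ × ℝ →L[ℝ] ℝ)),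
      (∀ Q, P Q 0 = v Q.1 Q.2) ∧
      (∀ i, ∀ Q ∈ slab T, HasFDerivWithinAt (fun Q => P Q i) (P' i Q) (slab T) Q) ∧
      (∀ i, ContinuousOn (P' i) (slab T)) ∧
      (∀ i, ∀ Q ∈ slab T, 0 < Q.1 → P' i Q (1, diagSpeed a i (P Q)) = diagSource a F i (P Q)) ∧
      ∀ x, P (0, x) = ![u₀ x, riemannData a 1 u₀ u₁ x, riemannData a (-1) u₀ u₁ x] := by
  obtain ⟨A, B, hA, hB, hd⟩ := h.exists_derivs hT
  have hpos : ∀ Q ∈ slab T, 0 < v Q.1 Q.2 := fun Q hQ => h.pos _ hQ.1 _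
  set R' : ℝ → ℝ × ℝ → (ℝ × ℝ →L[ℝ] ℝ) := fun s Q => A Q + s • (v Q.1 Q.2 ^ a • B Q +
    dx v Q.1 Q.2 • ((a * v Q.1 Q.2 ^ (a - 1)) • grad (dt T v Q.1 Q.2) (dx v Q.1 Q.2))) with hR'
  have hvc : ContinuousOn (fun Q : ℝ × ℝ => v Q.1 Q.2) (slab T) := fun Q hQ =>
    (hd Q hQ).1.continuousWithinAt
  have htc : ContinuousOn (fun Q : ℝ × ℝ => dt T v Q.1 Q.2) (slab T) := fun Q hQ =>
    (hd Q hQ).2.1.continuousWithinAt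
  have hxc : ContinuousOn (fun Q : ℝ × ℝ => dx v Q.1 Q.2) (slab T) := fun Q hQ =>
    (hd Q hQ).2.2.1.continuousWithinAt
  have hrc : ∀ b : ℝ, ContinuousOn (fun Q : ℝ × ℝ => v Q.1 Q.2 ^ b) (slab T) := fun b =>
    hvc.rpow_const fun Q hQ => Or.inl (hpos Q hQ).ne'
  have hgc : ContinuousOn (fun Q : ℝ × ℝ => grad (dt T v Q.1 Q.2) (dx v Q.1 Q.2)) (slab T) := by
    unfold grad
    fun_prop
  have hR'c : ∀ s, ContinuousOn (R' s) (slab T) := fun s => by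
    have h1 := hrc a
    have h2 := hrc (a - 1)
    simp only [hR']
    fun_prop
  have hRd : ∀ s, ∀ Q ∈ slab T,
      HasFDerivWithinAt (fun Q : ℝ × ℝ => riemannInv a s T v Q.1 Q.2) (R' s Q) (slab T) Q := by
    intro s Q hQ
    obtain ⟨d1, d2, d3, -, -⟩ := hd Q hQ
    exact d2.add (((d1.rpow_const (Or.inl (hpos Q hQ).ne')).mul d3).const_mul s)
  have hReq : ∀ s : ℝ, s * s = 1 → ∀ Q ∈ slab T, 0 < Q.1 →
      R' s Q (1, -(s * v Q.1 Q.2 ^ a)) = s * (a * v Q.1 Q.2 ^ (a - 1) * dx v Q.1 Q.2 *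
        riemannInv a s T v Q.1 Q.2) + F (v Q.1 Q.2) * dx v Q.1 Q.2 := by
    intro s hs Q hQ hQ1
    obtain ⟨-, -, -, d4, d5⟩ := hd Q hQ
    have d5 := d5 hQ1
    have hv := hpos Q hQ
    have e1 : v Q.1 Q.2 ^ (2 * a) = v Q.1 Q.2 ^ a * v Q.1 Q.2 ^ a := by
      rw [← Real.rpow_add hv]; congr 1; ring
    have e2 : v Q.1 Q.2 ^ (2 * a - 1) = v Q.1 Q.2 ^ a * v Q.1 Q.2 ^ (a - 1) := by
      rw [← Real.rpow_add hv]; congr 1; ring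
    rw [e1, e2] at d5
    have hA' := clm_eq_grad (A Q)
    have hB' := clm_eq_grad (B Q)
    rw [d4, d5] at hA'
    simp only [hR', riemannInv]
    rw [hA', hB']
    simp only [add_apply, smul_apply, grad_apply, smul_eq_mul, mul_one, mul_zero, add_zero, zero_add]
    -- The coefficient collects the terms in which s occurs twice, so that s² = 1 treats both
    -- invariants at once.
    linear_combination (-(v Q.1 Q.2 ^ a * v Q.1 Q.2 ^ a * B Q (0, 1) +
      2 * a * v Q.1 Q.2 ^ a * v Q.1 Q.2 ^ (a - 1) * dx v Q.1 Q.2 ^ 2)) * hs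
  refine ⟨fun Q => ![v Q.1 Q.2, riemannInv a 1 T v Q.1 Q.2, riemannInv a (-1) T v Q.1 Q.2],
    ![fun Q => grad (dt T v Q.1 Q.2) (dx v Q.1 Q.2), R' 1, R' (-1)], fun Q => rfl, ?_, ?_, ?_, ?_⟩
  · intro i Q hQ
    fin_cases i
    · exact (hd Q hQ).1
    · exact hRd 1 Q hQ
    · exact hRd (-1) Q hQ
  · intro i
    fin_cases i
    · exact hgc
    · exact hR'c 1
    · exact hR'c (-1)
  · intro i Q hQ hQ1
    have hv := hpos Q hQ
    have hva := (Real.rpow_pos_of_pos hv a).ne'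
    have e3 : v Q.1 Q.2 ^ (a - 1) = v Q.1 Q.2 ^ a / v Q.1 Q.2 := Real.rpow_sub_one hv.ne' a
    fin_cases i
    · simp [diagSpeed, diagSource, riemannInv]
      ring
    · have := hReq 1 (by norm_num) Q hQ hQ1
      rw [e3, one_mul] at this
      refine this.trans ?_
      simp only [diagSource, riemannInv, Fin.mk_one, Fin.isValue, Matrix.cons_val]
      field_simp
      ring
    · have := hReq (-1) (by norm_num) Q hQ hQ1
      rw [e3, neg_one_mul, neg_neg] at this
      refine this.trans ?_
      simp only [diagSource, riemannInv, Fin.reduceFinMk, Fin.isValue, Matrix.cons_val]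
      field_simp
      ring
  · intro x
    have e : dx v 0 x = deriv u₀ x := by
      unfold dx
      rw [show (fun y => v 0 y) = u₀ from funext h.initial]
    simp [riemannInv, riemannData, e, h.initial, h.initial_deriv]

/-- Bounded positive classical solutions are unique. -/
theorem IsPositiveClassicalSolution.eq {a T K : ℝ} {F u₀ u₁ : ℝ → ℝ} {u v : ℝ → ℝ → ℝ}
    (hu : IsPositiveClassicalSolution a F u₀ u₁ T u)
    (hv : IsPositiveClassicalSolution a F u₀ u₁ T v) (ha : 0 ≤ a) (hT : 0 < T)
    (hF : ContDiffOn ℝ 1 F (Ioi 0)) (hK : ∀ t ∈ Icc 0 T, ∀ x, u t x ≤ K) {t : ℝ}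
    (ht : t ∈ Icc 0 T) (x : ℝ) : v t x = u t x := by
  obtain ⟨U, U', hU0, hUd, -, hUeq, hUi⟩ := hu.exists_diagonal hT
  obtain ⟨V, V', hV0, hVd, hVc, hVeq, hVi⟩ := hv.exists_diagonal hT
  have hG : Convex ℝ {p : Fin 3 → ℝ | 0 < p 0} :=
    (convex_Ioi (0 : ℝ)).linear_preimage (LinearMap.proj (R := ℝ) (φ := fun _ : Fin 3 => ℝ) 0)
  -- The bounded solution u supplies the cone slope K^a; v enters through its continuous derivatives
  -- only.
  have := eqOn_of_diagonal (Λ := K ^ a) hG (contDiffOn_diagSpeed a) (contDiffOn_diagSource hF)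
    (fun Q hQ => show 0 < U Q 0 from (hU0 Q).symm ▸ hu.pos _ hQ.1 _)
    (fun Q hQ => show 0 < V Q 0 from (hV0 Q).symm ▸ hv.pos _ hQ.1 _) hUd hVd hVc hUeq hVeq
    (fun i Q hQ => ?_) (fun x => (hUi x).trans (hVi x).symm)
    (show (t, x) ∈ slab T from ⟨ht, mem_univ _⟩)
  · have h1 := congrFun this 0
    rw [hU0, hV0] at h1
    exact h1.symm
  · have hpos := hu.pos _ hQ.1 Q.2
    have hK0 : 0 ≤ K := hpos.le.trans (hK _ hQ.1 _)
    have h1 : |U Q 0 ^ a| ≤ K ^ a := by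
      rw [hU0, abs_of_pos (Real.rpow_pos_of_pos hpos a)]
      exact Real.rpow_le_rpow hpos.le (hK _ hQ.1 _) ha
    fin_cases i
    · simpa [diagSpeed] using Real.rpow_nonneg hK0 a
    · simpa [diagSpeed] using h1
    · simpa [diagSpeed] using h1

/-! ### Weighted bounds -/

section Bounds

variable {a α β c₁ c₂ c₃ c₄ W B C δ : ℝ} {f w₀ ρ₀ σ₀ χ u₀ u₁ : ℝ → ℝ}
  {w ρ σ τ X p q ρ' σ' : ℝ × ℝ → ℝ}

/-- On the domain of dependence, the data are evaluated near the point under consideration. -/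
theorem IsCharSolution.near_data
    (h : IsCharSolution a δ f w₀ ρ₀ σ₀ χ w ρ σ τ X p q ρ' σ') (hd : CharData a W B C f w₀ ρ₀ σ₀ χ)
    (ha : 0 ≤ a) (hδ : δ ≤ 1) {s η y : ℝ} (hs : |s - η| < δ) (hy : y ∈ uIcc s η) :
    |X (s, η) - χ y| ≤ Real.exp (a * W) + 1 ∧ |w (s, η) - w₀ y| ≤ B + 1 := by
  have hyη : |η - y| ≤ 1 := by
    have := abs_sub_right_of_mem_uIcc hy
    rw [abs_sub_comm η s] at this
    linarith
  have hB : 0 ≤ B := (abs_nonneg _).trans (hd.ρ_le y)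
  have h1 : |χ η - χ y| ≤ Real.exp (a * W) * |η - y| :=
    abs_sub_le_of_abs_deriv_le_univ hd.χ_deriv (fun z => by
      rw [abs_of_pos (Real.exp_pos _)]
      have := hd.w_le z
      gcongr) η y
  have h2 : |w₀ η - w₀ y| ≤ B * |η - y| :=
    abs_sub_le_of_abs_deriv_le_univ hd.w_deriv (fun z => by
      have b1 := abs_le.1 (hd.ρ_le z)
      have b2 := abs_le.1 (hd.σ_le z)
      rw [abs_le]
      constructor <;> linarith) η y
  have h3 := abs_add_le_add (h.X_near s η) h1
  have h4 := abs_add_le_add (h.w_near s η) h2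
  rw [sub_add_sub_cancel] at h3 h4
  have h5 := mul_le_mul_of_nonneg_left hyη (Real.exp_pos (a * W)).le
  have h6 := mul_le_mul_of_nonneg_left hyη hB
  constructor <;> linarith

/-- Weighted bounds for the solution in characteristic coordinates. -/
theorem IsCharSolution.weighted_le
    (h : IsCharSolution a δ f w₀ ρ₀ σ₀ χ w ρ σ τ X p q ρ' σ') (hd : CharData a W B C f w₀ ρ₀ σ₀ χ)
    (hu : AdmissibleData a α β c₁ c₂ c₃ c₄ u₀ u₁)
    (ha : 0 ≤ a) (hα : 0 ≤ α) (hβ : 0 ≤ β) (hc₁ : 0 < c₁) (hc₃ : 0 < c₃) (hc₄ : 0 < c₄)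
    (hC : 0 ≤ C) (hδ : δ ≤ 1) (hδκ : δ * sourceConst a B C ≤ 1 / 4)
    (hdat : ∀ y, Real.exp (w₀ y) = u₀ (χ y) ∧
        u₀ (χ y) * ρ₀ y = riemannData a 1 u₀ u₁ (χ y) ∧
        u₀ (χ y) * σ₀ y = riemannData a (-1) u₀ u₁ (χ y) ∧
        |deriv ρ₀ y| ≤ c₄ * bracket (χ y) ^ (-gammaExp a α) * (u₀ (χ y) ^ a / u₀ (χ y)) +
          c₃ / c₁ * (c₃ * bracket (χ y) ^ (-β) / u₀ (χ y)) ∧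
        |deriv σ₀ y| ≤ c₄ * bracket (χ y) ^ (-gammaExp a α) * (u₀ (χ y) ^ a / u₀ (χ y)) +
          c₃ / c₁ * (c₃ * bracket (χ y) ^ (-β) / u₀ (χ y)))
    {H e v x N M : ℝ} (hH : H = 1 + (Real.exp (a * W) + 1)) (he : e = Real.exp (B + 1))
    {s η : ℝ} (hs : |s - η| < δ) (hv : v = Real.exp (w (s, η))) (hx : X (s, η) = x)
    (hN : N = c₃ * (H ^ β * bracket x ^ (-β)) * (e / v))
    (hM : M = c₄ * (H ^ gammaExp a α * bracket x ^ (-gammaExp a α)) * ((e * v) ^ a * (e / v)) +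
      c₃ / c₁ * N) :
    c₁ / (e * H ^ α) * bracket x ^ (-α) ≤ v ∧ |ρ (s, η)| ≤ 2 * N ∧ |σ (s, η)| ≤ 2 * N ∧
      |ρ' (s, η)| ≤ 2 * M + 4 * sourceConst a B C * N ∧
      |σ' (s, η)| ≤ 2 * M + 4 * sourceConst a B C * N := by
  have hγ : 0 ≤ gammaExp a α := gammaExp_nonneg hα
  have hB : 0 ≤ B := (abs_nonneg _).trans (hd.ρ_le 0)
  have hHpos : 0 < H := by rw [hH]; positivity
  have hepos : 0 < e := by rw [he]; positivity
  have hvpos : 0 < v := by rw [hv]; positivity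
  have hHp : ∀ b : ℝ, 0 < H ^ b := fun b => Real.rpow_pos_of_pos hHpos b
  have hpos := hu.pos hc₁
  have hbr : ∀ b y : ℝ, 0 < bracket y ^ b := fun b y => Real.rpow_pos_of_pos (bracket_pos y) b
  -- On the domain of dependence the initial positions lie within H - 1 of x, and u₀ differs from v
  -- by at most the factor e in either direction; all weights are compared through these two facts.
  have hcmp : ∀ y ∈ uIcc s η, |x - χ y| ≤ Real.exp (a * W) + 1 ∧ v ≤ e * u₀ (χ y) ∧
      u₀ (χ y) ≤ e * v := by
    intro y hy
    obtain ⟨h1, h2⟩ := h.near_data hd ha hδ hs hy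
    rw [hx] at h1
    rw [abs_le] at h2
    refine ⟨h1, ?_, ?_⟩
    · rw [← (hdat y).1, hv, he, ← Real.exp_add]
      gcongr
      linarith
    · rw [← (hdat y).1, hv, he, ← Real.exp_add]
      gcongr
      linarith
  have hinv : ∀ y ∈ uIcc s η, 1 / u₀ (χ y) ≤ e / v := fun y hy => by
    rw [div_le_div_iff₀ (hpos _) hvpos, one_mul]
    exact (hcmp y hy).2.1
  have hwt : ∀ y ∈ uIcc s η, ∀ b : ℝ, 0 ≤ b →
      bracket (χ y) ^ (-b) ≤ H ^ b * bracket x ^ (-b) := fun y hy b hb => by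
    rw [hH]
    exact bracket_rpow_neg_le hb (hcmp y hy).1
  have hNb : ∀ y ∈ uIcc s η, c₃ * bracket (χ y) ^ (-β) / u₀ (χ y) ≤ N := fun y hy => by
    have h1 := hwt y hy β hβ
    have h2 := hinv y hy
    have h3 := hpos (χ y)
    have h4 := hbr (-β) (χ y)
    have h5 := hbr (-β) x
    have h6 := hHp β
    rw [hN, div_eq_mul_one_div]
    gcongr
  have hMb : ∀ y ∈ uIcc s η, c₄ * bracket (χ y) ^ (-gammaExp a α) * (u₀ (χ y) ^ a / u₀ (χ y)) +
      c₃ / c₁ * (c₃ * bracket (χ y) ^ (-β) / u₀ (χ y)) ≤ M := fun y hy => by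
    have h1 := hwt y hy _ hγ
    have h2 := hinv y hy
    have h3 := hpos (χ y)
    have h4 := hbr (-gammaExp a α) (χ y)
    have h5 := hbr (-gammaExp a α) x
    have h6 := (hcmp y hy).2.2
    have h7 := hNb y hy
    have h8 := hHp (gammaExp a α)
    rw [hM, div_eq_mul_one_div (u₀ (χ y) ^ a)]
    gcongr
  have hR : ∀ y ∈ uIcc s η, |ρ₀ y| ≤ N := fun y hy => by
    refine le_trans ?_ (hNb y hy)
    rw [le_div_iff₀ (hpos _), mul_comm, ← abs_of_pos (hpos (χ y)), ← abs_mul,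
      (hdat y).2.1]
    exact hu.riemann 1 (Or.inl rfl) _
  have hS : ∀ y ∈ uIcc s η, |σ₀ y| ≤ N := fun y hy => by
    refine le_trans ?_ (hNb y hy)
    rw [le_div_iff₀ (hpos _), mul_comm, ← abs_of_pos (hpos (χ y)), ← abs_mul,
      (hdat y).2.2.1]
    exact hu.riemann (-1) (Or.inr rfl) _
  obtain ⟨b1, b2⟩ := h.abs_le_of_data_le hd ha hB hC hδκ hs hR hS s left_mem_uIcc η right_mem_uIcc
  obtain ⟨b3, b4⟩ := h.abs_deriv_le_of_data_le hd ha hB hC hδκ hs hR hS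
  have m1 := (hdat η).2.2.2.1.trans (hMb η right_mem_uIcc)
  have m2 := (hdat s).2.2.2.2.trans (hMb s left_mem_uIcc)
  refine ⟨?_, b1, b2, b3.trans (by linarith), b4.trans (by linarith)⟩
  have hl : bracket x ^ (-α) ≤ H ^ α * bracket (χ η) ^ (-α) := by
    rw [hH]
    refine bracket_rpow_neg_le hα ?_
    rw [abs_sub_comm]
    exact (hcmp η right_mem_uIcc).1
  have hHα : 0 < H ^ α := Real.rpow_pos_of_pos hHpos α
  calc c₁ / (e * H ^ α) * bracket x ^ (-α)
      ≤ c₁ / (e * H ^ α) * (H ^ α * bracket (χ η) ^ (-α)) := by gcongr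
    _ = c₁ * bracket (χ η) ^ (-α) / e := by field_simp
    _ ≤ u₀ (χ η) / e := by
        have := hu.lower (χ η)
        gcongr
    _ ≤ v := by
        rw [div_le_iff₀ hepos, mul_comm]
        exact (hcmp η right_mem_uIcc).2.2

/-- The two terms are derivatives of a Riemann invariant divided by u: the first along its own
characteristic, the second along the other family, with k equal to q or p. -/
theorem abs_add_abs_le_of_char {κ N M r s g d k : ℝ} (hr : |r| ≤ B + 1) (hrN : |r| ≤ 2 * N)
    (hsN : |s| ≤ 2 * N) (hg : |g| ≤ κ * (2 * N)) (hd : |d| ≤ 2 * M + 4 * κ * N)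
    (hk : 1 / 4 ≤ |k|) :
    |s * r + g| + |r ^ 2 + d / k| ≤ 8 * M + (4 * (B + 1) + 18 * κ) * N := by
  have h1 := abs_add_le_add (abs_mul_le_mul hsN hr) hg
  have h2 : |d / k| ≤ 4 * (2 * M + 4 * κ * N) := by
    rw [abs_div, div_le_iff₀ (by linarith)]
    nlinarith [abs_nonneg d]
  have h3 := abs_add_le_add (abs_mul_le_mul hrN hr) h2
  rw [← sq] at h3
  linarith

/-- Passes from characteristic derivatives to those in t and x, with V = u^a. Dividing by V is
harmless because v E ≤ D V, that is, the characteristic derivatives themselves carry a factor u^a.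
-/
theorem abs_half_add_abs_le {v V L E₁ E₂ E D : ℝ} (hv : 0 ≤ v) (hV : 0 < V) (hVL : V ≤ L)
    (hE : |E₁| + |E₂| ≤ E) (hD0 : 0 ≤ D) (hD : v * E ≤ D * V) :
    |v * (E₁ + E₂) / 2| + |v * (E₂ - E₁) / (2 * V)| ≤ D * (L + 1) / 2 := by
  have h1 : |v * (E₁ + E₂)| ≤ D * V := by
    rw [abs_mul, abs_of_nonneg hv]
    exact (mul_le_mul_of_nonneg_left ((abs_add_le _ _).trans hE) hv).trans hD
  have h2 : |v * (E₂ - E₁)| ≤ D * V := by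
    rw [abs_mul, abs_of_nonneg hv]
    refine (mul_le_mul_of_nonneg_left ((abs_sub _ _).trans ?_) hv).trans hD
    linarith
  have h3 : |v * (E₂ - E₁) / (2 * V)| ≤ D / 2 := by
    rw [abs_div, abs_of_pos (by positivity : 0 < 2 * V), div_le_iff₀ (by positivity)]
    linarith
  have h4 : |v * (E₁ + E₂) / 2| ≤ D * L / 2 := by
    rw [abs_div, abs_two]
    have := mul_le_mul_of_nonneg_left hVL hD0
    linarith
  linarith

end Bounds

end DegenerateWave

/-! ### Choice of constants and conclusion -/

open DegenerateWave in
theorem theorem1 (a α β c₁ c₂ c₃ c₄ : ℝ) (CF : ℝ → ℝ)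
    (ha : 0 ≤ a) (hα : 0 ≤ α) (hβ : 0 ≤ β) (hαβ : α ≤ β) (haαβ : a * α ≤ β)
    (hc₁ : 0 < c₁) (hc₂ : 0 < c₂) (hc₃ : 0 < c₃) (hc₄ : 0 < c₄)
    (hCF : ∀ K, 0 < K → 0 < CF K) :
    ∃ T > 0, ∃ C₁ > 0, ∃ C₂ > 0, ∃ C₃ > 0, ∃ C₄ > 0,
      ∀ u₀ u₁ F : ℝ → ℝ,
        DegenerateWave.AdmissibleData a α β c₁ c₂ c₃ c₄ u₀ u₁ →
        DegenerateWave.LeviCondition a CF F →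
        ∃ u : ℝ → ℝ → ℝ,
          DegenerateWave.IsPositiveClassicalSolution a F u₀ u₁ T u ∧
          DegenerateWave.WeightedBounds a α β C₁ C₂ C₃ C₄ T u ∧
          ∀ v : ℝ → ℝ → ℝ,
            DegenerateWave.IsPositiveClassicalSolution a F u₀ u₁ T v →
            ∀ t ∈ Set.Icc 0 T, ∀ x, v t x = u t x := by
  set W := Real.log c₂ with hW
  set B := dataBound a c₁ c₂ c₃ c₄ with hBdef
  set C := CF (Real.exp (W + 1)) / 2 + a * (CF (Real.exp (W + 1)) / 2) with hCdef
  set κ := sourceConst a B C with hκ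
  have hB : 0 ≤ B := dataBound_nonneg hc₁ hc₂ hc₃ hc₄
  have hC : 0 ≤ C := by
    have := hCF _ (Real.exp_pos (W + 1))
    positivity
  have hκ0 : 0 ≤ κ := sourceConst_nonneg ha hB hC
  obtain ⟨δ₀, hδ₀, hex⟩ := exists_isCharSolution (W := W) ha hB hC
  -- The three entries serve existence in the strip, the size of the domain of dependence, and
  -- absorption in the Gronwall arguments; κ + 1 avoids dividing by zero.
  set δ := min δ₀ (min 1 (1 / (4 * (κ + 1)))) with hδdef
  have hδ : 0 < δ := lt_min hδ₀ (lt_min one_pos (by positivity))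
  have hδ1 : δ ≤ 1 := (min_le_right _ _).trans (min_le_left _ _)
  have hδκ : δ * κ ≤ 1 / 4 := by
    have h1 : δ ≤ 1 / (4 * (κ + 1)) := (min_le_right _ _).trans (min_le_right _ _)
    rw [le_div_iff₀ (by positivity)] at h1
    nlinarith
  -- Half of the height δ/8 of the open slab, so that the closed slab [0, T] lies inside it.
  have hT : 0 < δ / 16 := by positivity
  have hTT : δ / 16 < δ / 8 := by linarith
  set H := 1 + (Real.exp (a * W) + 1) with hH
  set e := Real.exp (B + 1) with he
  have hHpos : 0 < H := by positivity
  have hepos : 0 < e := by positivity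
  set C₁ := c₁ / (e * H ^ α) with hC₁
  have hHp : ∀ b : ℝ, 0 < H ^ b := fun b => Real.rpow_pos_of_pos hHpos b
  have hC₁pos : 0 < C₁ := div_pos hc₁ (mul_pos hepos (hHp α))
  set L := Real.exp (W + 1) ^ a with hL
  have hLpos : 0 < L := Real.rpow_pos_of_pos (Real.exp_pos _) a
  -- Once the bound on the characteristic derivatives is multiplied by u, A₁ is the coefficient of
  -- ⟨x⟩^(-γ) u^a and A₂ that of ⟨x⟩^(-β).
  set A₁ := 8 * (c₄ * H ^ gammaExp a α * (e ^ a * e)) with hA₁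
  set A₂ := (8 * (c₃ / c₁) + (4 * (B + 1) + 18 * κ)) * (c₃ * H ^ β * e) with hA₂
  have hA₁pos : 0 < A₁ := by
    have h1 := hHp (gammaExp a α)
    have h2 := Real.rpow_pos_of_pos hepos a
    positivity
  have hA₂pos : 0 < A₂ := by
    have h1 := hHp β
    positivity
  have hCa : 0 < C₁ ^ a := Real.rpow_pos_of_pos hC₁pos a
  set D := A₁ + A₂ * (C₁ ^ a)⁻¹ with hD
  have hDpos : 0 < D := by positivity
  refine ⟨δ / 16, hT, C₁, hC₁pos, Real.exp (W + 1), Real.exp_pos _, 2 * (c₃ * H ^ β * e),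
    by have := hHp β; positivity, D * (L + 1) / 2, by positivity, ?_⟩
  intro u₀ u₁ F hu hF
  obtain ⟨w₀, ρ₀, σ₀, χ, hd, hsurj, hprop, hdat⟩ := hu.exists_charData hF hCF ha hαβ hc₁ hc₂ hc₃ hc₄
  obtain ⟨w, ρ, σ, τ, X, p, q, ρ', σ', h⟩ := hex δ hδ (min_le_left _ _) _ _ _ _ _ hd
  obtain ⟨u, R, S, Rt, Rx, St, Sx, hsl, hinit, hpt⟩ :=
    h.exists_isSlabSolution hd (F := F) (fun v => rfl) hδ hprop
  have hsol : IsPositiveClassicalSolution a F u₀ u₁ (δ / 16) (fun t x => u (t, x)) := by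
    refine hsl.isPositiveClassicalSolution hT hTT (fun x => ?_) (fun x => ?_)
    · obtain ⟨y, rfl⟩ := hsurj x
      rw [(hinit y).1, (hdat y).1]
    · obtain ⟨y, rfl⟩ := hsurj x
      rw [(hinit y).2.1, (hinit y).2.2, (hdat y).1, (hdat y).2.1, (hdat y).2.2.1]
      unfold riemannData
      ring
  -- all bounds at one point
  have key : ∀ t ∈ Icc 0 (δ / 16), ∀ x, C₁ * bracket x ^ (-α) ≤ u (t, x) ∧
      u (t, x) ≤ Real.exp (W + 1) ∧ |R (t, x)| ≤ 2 * (c₃ * H ^ β * e) * bracket x ^ (-β) ∧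
      |S (t, x)| ≤ 2 * (c₃ * H ^ β * e) * bracket x ^ (-β) ∧
      |Rt (t, x)| + |Rx (t, x)| ≤ D * (L + 1) / 2 * bracket x ^ (-gammaExp a α) ∧
      |St (t, x)| + |Sx (t, x)| ≤ D * (L + 1) / 2 * bracket x ^ (-gammaExp a α) := by
    intro t ht x
    obtain ⟨⟨s, η⟩, hP, hX, eu, eR, eS, eRt, eRx, eSt, eSx⟩ := hpt (t, x) (by
      rw [abs_of_nonneg ht.1]; exact ht.2.trans_lt hTT)
    have hs : |s - η| < δ := hP
    obtain ⟨b0, b1, b2, b3, b4⟩ := h.weighted_le hd hu ha hα hβ hc₁ hc₃ hc₄ hC hδ1 hδκ hdat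
      (H := H) (e := e) hH he hs eu hX rfl rfl
    set v := u (t, x) with hv
    have hvpos : 0 < v := by rw [eu]; exact Real.exp_pos _
    have hvle : v ≤ Real.exp (W + 1) := by
      rw [eu]
      exact Real.exp_le_exp.2 (h.w_le hd s η)
    have hva : 0 < v ^ a := Real.rpow_pos_of_pos hvpos a
    have hvaL : v ^ a ≤ L := Real.rpow_le_rpow hvpos.le hvle ha
    set bβ := bracket x ^ (-β) with hbβ
    set bγ := bracket x ^ (-gammaExp a α) with hbγ
    have hbγpos : 0 < bγ := Real.rpow_pos_of_pos (bracket_pos x) _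
    have hmul : ∀ r : ℝ, |r| ≤ 2 * (c₃ * (H ^ β * bβ) * (e / v)) →
        |v * r| ≤ 2 * (c₃ * H ^ β * e) * bβ := fun r hr => by
      rw [abs_mul, abs_of_pos hvpos]
      calc v * |r| ≤ v * (2 * (c₃ * (H ^ β * bβ) * (e / v))) := by gcongr
        _ = _ := by field_simp
    -- The lower bound just obtained for u at time t, with constant C₁, replaces that of the data
    -- here; this is where aα ≤ β enters.
    have hwt : bβ ≤ (C₁ ^ a)⁻¹ * bγ * v ^ a := by
      have := bracket_div_rpow_le ha hαβ haαβ hC₁pos b0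
      rwa [div_le_iff₀ hva] at this
    have hf := hd.f_le _ (h.w_le hd s η)
    have hfin : ∀ E₁ E₂ : ℝ, |E₁| + |E₂| ≤
        8 * (c₄ * (H ^ gammaExp a α * bγ) * ((e * v) ^ a * (e / v)) +
          c₃ / c₁ * (c₃ * (H ^ β * bβ) * (e / v))) +
          (4 * (B + 1) + 18 * κ) * (c₃ * (H ^ β * bβ) * (e / v)) →
        |v * (E₁ + E₂) / 2| + |v * (E₂ - E₁) / (2 * v ^ a)| ≤ D * (L + 1) / 2 * bγ := by
      intro E₁ E₂ hE
      refine (abs_half_add_abs_le hvpos.le hva hvaL hE (D := D * bγ) (by positivity) ?_).trans_eq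
        (by ring)
      rw [Real.mul_rpow hepos.le hvpos.le]
      calc _ = A₁ * bγ * v ^ a + A₂ * bβ := by
            simp only [hA₁, hA₂]
            field_simp
            ring
        _ ≤ A₁ * bγ * v ^ a + A₂ * ((C₁ ^ a)⁻¹ * bγ * v ^ a) := by gcongr
        _ = D * bγ * v ^ a := by simp only [hD]; ring
    have hq : 1 / 4 ≤ |q (s, η)| := (h.q_pos _).trans (le_abs_self _)
    have hp : 1 / 4 ≤ |p (s, η)| := by
      rw [le_abs]; right; linarith [h.p_neg (s, η)]
    have hρB := h.abs_ρ_le hd s η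
    have hσB := h.abs_σ_le hd s η
    refine ⟨b0, hvle, ?_, ?_, ?_, ?_⟩
    · rw [eR]; exact hmul _ b1
    · rw [eS]; exact hmul _ b2
    · rw [eRt, eRx]
      exact hfin _ _ (abs_add_abs_le_of_char hρB b1 b2 (abs_sourceR_le ha hf hρB b1 b2) b3 hq)
    · rw [eSt, eSx]
      refine hfin _ _ ?_
      rw [add_comm]
      exact abs_add_abs_le_of_char hσB b2 b1 (abs_sourceS_le ha hf hσB b1 b2) b4 hp
  refine ⟨fun t x => u (t, x), hsol, ⟨fun t ht x => (key t ht x).1, fun t ht x => (key t ht x).2.1,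
    ?_, ?_⟩, fun v hv t ht x => hsol.eq hv ha hT hF.contDiffOn
      (fun t ht x => (key t ht x).2.1) ht x⟩
  · rintro _ (rfl | rfl) t ht x
    · rw [hsl.riemannInv_one hT hTT ht]
      exact (key t ht x).2.2.1
    · rw [hsl.riemannInv_neg_one hT hTT ht]
      exact (key t ht x).2.2.2.1
  · rintro _ (rfl | rfl) t ht x
    · rw [hsl.dt_riemannInv_one hT hTT ht, hsl.dx_riemannInv_one hT hTT ht]
      exact (key t ht x).2.2.2.2.1
    · rw [hsl.dt_riemannInv_neg_one hT hTT ht, hsl.dx_riemannInv_neg_one hT hTT ht]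
      exact (key t ht x).2.2.2.2.2
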